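/- **Conventions.** A hypergraph $G$ consists of a finite vertex set $V(G)$ and a set $E(G)$ of nonempty subsets of $V(G)$ (hyperedges); its rank is the maximum size of a hyperedge. A homomorphism from $H$ to $G$ is a map $\varphi:V(H)\to V(G)$ with $\{\varphi(v):v\in e\}\in E(G)$ for all $e\in E(H)$; $\mathrm{Hom}_H(G)$ is the number of homomorphisms from $H$ to $G$. Let $l\in\{0,1,2,\dots\}\cup\{\infty\}$. * For $S\subseteq V(G)$, the induced $l$-trimmed subhypergraph $G\langle S\rangle_l$ has vertex set $S$ and hyperedges $\{e\cap S: e\in E(G),\ |e\setminus S|\le l,\ e\cap S\ne\emptyset\}$. The $l$-degeneracy $\kappa_l(G)$ is the least $\kappa\in\mathbb N$ such that for every nonempty $S\subseteq V(G)$ some vertex of $S$ lies in at most $\kappa$ hyperedges of $G\langle S\rangle_l$. * For a vertex ordering $\pi$ of $H$, the $l$-skeleton of $(H,\pi)$ is the directed acyclic graph on $V(H)$ that has, for each hyperedge $e$, arcs from each of the first $l+1$ vertices of $e$ to every vertex that comes after it in $e$. * A DAG-tree decomposition of a directed acyclic graph $D$ is a rooted tree whose nodes are assigned sets of sources of $D$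 (bags), such that every source is in some bag, and $\mathrm{Reach}(B_1)\cap \mathrm{Reach}(B_2)\subseteq \mathrm{Reach}(B)$ whenever the node of bag $B$ lies on the path between those of $B_1$ and $B_2$, where $\mathrm{Reach}(B)$ is the set of vertices reachable from $B$. Its width is the maximum size of a bag, and the DAG-treewidth $\tau(D)$ is the minimum width of a decomposition of $D$. The $l$-DAG-treewidth $\tau_l(H)$ is the maximum of $\tau$ of the $l$-skeleton of $(H,\pi)$ over all vertex orderings $\pi$. **Theorem.** Let $l\in\{0,1,2,\dots\}\cup\{\infty\}$ and let $H$ be a (fixed) finite hypergraph. There is an algorithm (a word RAM program, depending only on $H$ and $l$) such that for every $r$ there are a constant $c$ and a polynomial $p$ with coefficients in $\mathbb N$ with the following property. For every hypergraph $G$ of rank at most $r$ with $n$ vertices and $m$ hyperedges, given as a list of its hyperedges, and every word size $w$ with $2^w\ge (n+m+2)^c$ (so words of $O(\log(n+m))$ bits suffice), the algorithm computes $\mathrm{Hom}_H(G)$ in time at most $$p(\kappa_l(G))\cdot n^{\tau_l(H)}\cdot\log m ,$$ where $n$ is read as $\max(n,1)$ and $\log m$ as $\lfloor\log_2\max(m,2)\rfloor$.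 -/

import Mathlib

/-! ### Hypergraphs: trimming, degeneracy, homomorphisms

Hypergraphs are Mathlib's `Hypergraph α` (a vertex set `V(G)` and a set `E(G)` of subsets of it). -/

namespace Hypergraph

/-- The supremum of the arities of the hyperedges. -/
noncomputable def rank {α : Type*} (G : Hypergraph α) : ℕ∞ :=
  ⨆ e ∈ E(G), e.encard

/-- The number of hyperedges that contain the vertex `v`. -/
noncomputable def degree {α : Type*} (G : Hypergraph α) (v : α) : ℕ∞ :=
  {e : Set α | e ∈ E(G) ∧ v ∈ e}.encard

/-- The `l`-trimmed subhypergraph of `G` induced by `S`: its hyperedges are the nonempty sets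
`e ∩ S` where `e` is a hyperedge of `G` with at most `l` vertices outside `S`. -/
def inducedTrimmed {α : Type*} (G : Hypergraph α) (l : ℕ∞) (S : Set α) : Hypergraph α where
  vertexSet := S
  edgeSet := {f | f.Nonempty ∧ ∃ e ∈ E(G), (e \ S).encard ≤ l ∧ f = e ∩ S}
  subset_vertexSet_of_mem_edgeSet' := by
    rintro f ⟨-, e, -, -, rfl⟩
    exact Set.inter_subset_right

/-- `G` is `κ`-`l`-degenerate: every induced `l`-trimmed subhypergraph (on at least one vertex) has
minimum degree at most `κ`. -/
def IsDegenerate {α : Type*} (G : Hypergraph α) (l : ℕ∞) (κ : ℕ) : Prop :=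
  ∀ S : Set α, S ⊆ V(G) → S.Nonempty → ∃ v ∈ S, (G.inducedTrimmed l S).degree v ≤ κ

/-- The `l`-degeneracy `κ_l(G)` of a finite hypergraph. -/
noncomputable def degeneracy {α : Type*} (G : Hypergraph α) (l : ℕ∞) : ℕ :=
  sInf {κ : ℕ | G.IsDegenerate l κ}

/-- `φ : V(H) → V(G)` is a homomorphism if the image of every hyperedge is a hyperedge. -/
def IsHom {α β : Type*} (H : Hypergraph α) (G : Hypergraph β) (φ : V(H) → V(G)) : Prop :=
  ∀ e ∈ E(H), (fun v : V(H) => (φ v : β)) '' {v : V(H) | (v : α) ∈ e} ∈ E(G)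

/-- The number of homomorphisms from `H` to `G`. -/
noncomputable def homCount {α β : Type*} (H : Hypergraph α) (G : Hypergraph β) : ℕ :=
  Nat.card {φ : V(H) → V(G) // H.IsHom G φ}

end Hypergraph

/-! ### DAG-tree decompositions -/

namespace Digraph

/-- Sources: the vertices without incoming arcs. -/
def sources {V : Type*} (D : Digraph V) : Set V :=
  {s | ∀ u, ¬ D.Adj u s}

/-- The vertices reachable by directed paths (possibly of length zero) from a vertex of `B`. -/
def reach {V : Type*} (D : Digraph V) (B : Set V) : Set V :=
  {v | ∃ s ∈ B, Relation.ReflTransGen D.Adj s v}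

/-- A DAG-tree decomposition: a rooted tree whose nodes carry bags of sources, such that every
source is in a bag, and `Reach(B₁) ∩ Reach(B₂) ⊆ Reach(B)` whenever `B` lies on the path between
`B₁` and `B₂`. -/
structure DAGTreeDecomposition {V : Type*} (D : Digraph V) where
  /-- The number of nodes of the tree. -/
  size : ℕ
  /-- The tree. -/
  tree : SimpleGraph (Fin size)
  isTree : tree.IsTree
  /-- The root. -/
  root : Fin size
  /-- The bags. -/
  bag : Fin size → Finset V
  bag_subset : ∀ i, (bag i : Set V) ⊆ D.sources
  covers : ∀ s ∈ D.sources, ∃ i, s ∈ bag i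
  reach_inter : ∀ (i j : Fin size) (p : tree.Walk i j), p.IsPath → ∀ b ∈ p.support,
    D.reach (bag i) ∩ D.reach (bag j) ⊆ D.reach (bag b)

/-- The width of a decomposition: the maximum size of a bag. -/
def DAGTreeDecomposition.width {V : Type*} {D : Digraph V} (T : D.DAGTreeDecomposition) : ℕ :=
  Finset.univ.sup fun i => (T.bag i).card

/-- The DAG-treewidth of a (finite) directed acyclic graph. -/
noncomputable def dagTreewidth {V : Type*} (D : Digraph V) : ℕ :=
  sInf {k : ℕ | ∃ T : D.DAGTreeDecomposition, T.width = k}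

end Digraph

namespace Hypergraph

/-- The `l`-skeleton of the directed acyclic hypergraph given by `H` and the vertex ordering `π`:
for each hyperedge `e`, there are arcs from each of the first `l + 1` vertices of `e` (those with at
most `l` vertices of `e` before them) to all the vertices that come after it in `e`. -/
def skeleton {α : Type*} (H : Hypergraph α) (l : ℕ∞) (π : V(H) ≃ Fin V(H).ncard) :
    Digraph V(H) where
  Adj u v := ∃ e ∈ E(H), (u : α) ∈ e ∧ (v : α) ∈ e ∧ π u < π v ∧
    {x : V(H) | (x : α) ∈ e ∧ π x < π u}.encard ≤ l

/-- The `l`-DAG-treewidth `τ_l(H)` of a finite hypergraph: the maximum, over all acyclic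
orientations (that is, over all vertex orderings), of the DAG-treewidth of the `l`-skeleton. -/
noncomputable def dagTreewidth {α : Type*} (H : Hypergraph α) (l : ℕ∞) : ℕ :=
  ⨆ π : V(H) ≃ Fin V(H).ncard, (H.skeleton l π).dagTreewidth

end Hypergraph

/-! ### The word RAM

A random access machine whose registers and memory cells hold `w`-bit words, with unit-cost
arithmetic, comparisons and indirect addressing. Programs are structured (sequencing, conditionals,
loops); each instruction, each branching and each test of a loop condition takes one step. -/

namespace WordRAM

/-- The unit-cost operations. -/
inductive Op where
  | add | sub | mul | lt | eq

/-- The value of an operation before reduction modulo `2 ^ w`; `sub` is truncated at `0`, and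
comparisons return `0` or `1`. -/
def Op.eval : Op → ℕ → ℕ → ℕ
  | .add, a, b => a + b
  | .sub, a, b => a - b
  | .mul, a, b => a * b
  | .lt, a, b => if a < b then 1 else 0
  | .eq, a, b => if a = b then 1 else 0

/-- Instructions; `i`, `j`, `k` are register names. -/
inductive Instr where
  /-- `r_i := c` for a constant `c` -/
  | const (i c : ℕ)
  /-- `r_i := r_j o r_k` -/
  | op (o : Op) (i j k : ℕ)
  /-- `r_i := mem[r_j]` -/
  | load (i j : ℕ)
  /-- `mem[r_i] := r_j` -/
  | store (i j : ℕ)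

/-- Programs. -/
inductive Program where
  | skip
  | instr (a : Instr)
  | seq (p q : Program)
  /-- if `r_i ≠ 0` then `p` else `q` -/
  | ite (i : ℕ) (p q : Program)
  /-- while `r_i ≠ 0` do `p` -/
  | loop (i : ℕ) (p : Program)

/-- A configuration of the registers and of the memory. -/
structure State where
  reg : ℕ → ℕ
  mem : ℕ → ℕ

/-- The effect of an instruction on a machine with `w`-bit words. -/
def Instr.exec (w : ℕ) (s : State) : Instr → State
  | .const i c => { s with reg := Function.update s.reg i (c % 2 ^ w) }
  | .op o i j k => { s with reg := Function.update s.reg i (o.eval (s.reg j) (s.reg k) % 2 ^ w) }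
  | .load i j => { s with reg := Function.update s.reg i (s.mem (s.reg j)) }
  | .store i j => { s with mem := Function.update s.mem (s.reg i) (s.reg j) }

/-- `Exec w p s t s'`: on a machine with `w`-bit words, the program `p` started in the state `s`
halts after exactly `t` steps in the state `s'`. -/
inductive Exec (w : ℕ) : Program → State → ℕ → State → Prop where
  | skip (s : State) : Exec w .skip s 1 s
  | instr (a : Instr) (s : State) : Exec w (.instr a) s 1 (a.exec w s)
  | seq {p q : Program} {s₁ s₂ s₃ : State} {t₁ t₂ : ℕ} :
      Exec w p s₁ t₁ s₂ → Exec w q s₂ t₂ s₃ → Exec w (.seq p q) s₁ (t₁ + t₂) s₃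
  | ite_true {i : ℕ} {p q : Program} {s s' : State} {t : ℕ} :
      s.reg i ≠ 0 → Exec w p s t s' → Exec w (.ite i p q) s (t + 1) s'
  | ite_false {i : ℕ} {p q : Program} {s s' : State} {t : ℕ} :
      s.reg i = 0 → Exec w q s t s' → Exec w (.ite i p q) s (t + 1) s'
  | loop_done {i : ℕ} {p : Program} {s : State} :
      s.reg i = 0 → Exec w (.loop i p) s 1 s
  | loop_step {i : ℕ} {p : Program} {s₁ s₂ s₃ : State} {t₁ t₂ : ℕ} :
      s₁.reg i ≠ 0 → Exec w p s₁ t₁ s₂ → Exec w (.loop i p) s₂ t₂ s₃ →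
      Exec w (.loop i p) s₁ (t₁ + t₂ + 1) s₃

/-- The initial state: the input is in the first cells of the memory, all else is `0`. -/
def init (input : List ℕ) : State where
  reg _ := 0
  mem a := input.getD a 0

end WordRAM

/-! ### Hypergraphs as inputs -/

namespace Hypergraph

/-- `L` is a list of the hyperedges of `G`, without repetition and in any order, each given as a
list of its vertices, without repetition and in any order; the vertices of `G` are
`0, …, n - 1`. -/
structure IsListing (G : Hypergraph ℕ) (n : ℕ) (L : List (List ℕ)) : Prop where
  vertexSet_eq : V(G) = Set.Iio n
  edge_nodup : ∀ a ∈ L, a.Nodup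
  pairwise_ne : L.Pairwise fun a b => {v | v ∈ a} ≠ {v | v ∈ b}
  edgeSet_eq : E(G) = {e | ∃ a ∈ L, e = {v | v ∈ a}}

/-- The input words: the number of vertices, the number of hyperedges, and then each hyperedge as
its arity followed by its vertices. -/
def encode (n : ℕ) (L : List (List ℕ)) : List ℕ :=
  n :: L.length :: L.flatMap fun a => a.length :: a

end Hypergraph

/-!
The algorithm is written in a small structured language with registers and arrays and an explicit
cost semantics (`ArrayMachine.Stmt`, `ArrayMachine.Run`). All numbers that occur are less than
`B = N ^ k`, where `N = n + m + 2` and `k` depends on the program only, so the cell `a` of the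
`j`-th array can live at the address `j * B + a` of a word RAM with `O(log N)` bits;
`ArrayMachine.Run.exec_code` is the simulation, with constant overhead built into the costs. Since
memory is initially zero, a table may be indexed by the code of a tuple, its digits in base `N`
(`ArrayMachine.tupleCode`), and needs no initialization.

A minimum-degree ordering of `G` takes too long to compute and is replaced by an approximate one. By
degeneracy, at most `κ |S|` trimmed hyperedges live on a set `S` of remaining vertices
(`Hypergraph.IsDegenerate.encard_inducedTrimmed_le`), so on average a vertex of `S` has at most `r² κ`
neighbours in them, and at least half of the vertices have at most twice as many. All these are removed
in one round, which takes time linear in `n` and `m ≤ κ n`; the set halves in each round, and after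
the first round only vertices of hyperedges remain, at most `r m`, so `O(r + log m)` rounds suffice
(`ArrayMachine.Wp.peel`). The keys that record the order of removal have the property that for
every vertex `x` at most `2 r² κ` vertices `y` are close to it: `x` and `y` are in a common hyperedge,
`x` is among its first `l + 1` vertices, and `y` does not come before `x`. The program has a list of
the vertices close to each `x`, and a table of the tuples that exhaust a hyperedge of `G`
(`ArrayMachine.Wp.recordAll`).

A map `φ : V(H) → V(G)` pulls the order on `V(G)` back to a vertex ordering `π` of `H`, with ties
broken by a fixed numbering; the homomorphisms are counted for each `π` separately, among finitely
many that induce each orientation of the hyperedges once (`ArrayMachine.exists_orientations`). If `φ`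
is a homomorphism of this kind and the `l`-skeleton has an arc from `u` to `v`, then `φ v` is close
to `φ u`. So when `φ` is known on a bag of sources, each further vertex in the reach of the bag has
only `O(κ)` possible values: the partial homomorphisms on the reach of a bag of size at most `τ` can
be listed by nested loops, of which at most `τ` run over all `n` vertices and the others over lists
of close vertices (`ArrayMachine.exists_cells`). Every hyperedge of `H` is contained in the reach of
a bag, since its first vertex reaches all of it. By the tree condition the reaches of the bags, taken
by decreasing distance from the root, have the running intersection property
(`ArrayMachine.runningIntersection_of_isTree`). So the sum over all `φ` of the product of the
indicator functions of the nodes is computed by dynamic programming, in which the sums for a node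
are tabulated by the values on the vertices shared with later nodes, and the table becomes a factor
of the weight of a single later node (`ArrayMachine.exists_wp_sumNodes`).

Registers of the array machine are used as follows: `0` for the result, `1`, `2`, `3` for `n`, `m`
and `N`, `4` for the number of the current round of peeling, `5`, `6`, `7` for the position of
the current hyperedge in the input, its index and its size, `8` to `16` for local variables, and
those from `100` on for the images of the vertices of `H` and the indices of the loops over them. Array `0` is
the input, array `1` has the keys, arrays `2`, `3`, `4` have the table of close pairs, the degrees and
the lists of close vertices, array `5` is the table of hyperedges, and the arrays from `6` on are for
dynamic programming.
-/

/-! ### A structured language with arrays, and its translation to the word RAM -/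

namespace ArrayMachine

/-- Expressions: constants, registers, machine operations and entries of the `k`-th array. -/
inductive Expr where
  | const (c : ℕ)
  | reg (i : ℕ)
  | op (o : WordRAM.Op) (a b : Expr)
  | arr (k : ℕ) (a : Expr)

namespace Expr

instance : Add Expr := ⟨.op .add⟩
instance : Mul Expr := ⟨.op .mul⟩
instance : Sub Expr := ⟨.op .sub⟩

/-- The comparison `a < b`, with value `1` or `0`. -/
abbrev lt (a b : Expr) : Expr := .op .lt a b

/-- The test `a = b`, with value `1` or `0`. -/
abbrev eq (a b : Expr) : Expr := .op .eq a b

end Expr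

/-- A state of the array machine. -/
structure State where
  /-- The registers. -/
  reg : ℕ → ℕ
  /-- `arr k a` is the entry of the `k`-th array at the index `a`. -/
  arr : ℕ → ℕ → ℕ

namespace State

/-- Assignment of a register. -/
def setReg (σ : State) (i v : ℕ) : State := { σ with reg := Function.update σ.reg i v }

/-- Assignment of an array entry. -/
def setArr (σ : State) (k a v : ℕ) : State :=
  { σ with arr := Function.update σ.arr k (Function.update (σ.arr k) a v) }

@[simp] theorem setReg_reg (σ : State) (i v j : ℕ) :
    (σ.setReg i v).reg j = if j = i then v else σ.reg j := by
  simp [setReg, Function.update_apply]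

@[simp] theorem setReg_arr (σ : State) (i v : ℕ) : (σ.setReg i v).arr = σ.arr := rfl

@[simp] theorem setArr_reg (σ : State) (k a v : ℕ) : (σ.setArr k a v).reg = σ.reg := rfl

@[simp] theorem setArr_arr (σ : State) (k a v k' : ℕ) :
    (σ.setArr k a v).arr k' = if k' = k then Function.update (σ.arr k) a v else σ.arr k' := by
  simp only [setArr, Function.update_apply]

end State

namespace Expr

/-- The value of an expression, without reduction modulo the word size. -/
def eval (σ : State) : Expr → ℕ
  | const c => c
  | reg i => σ.reg i
  | op o a b => o.eval (a.eval σ) (b.eval σ)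
  | arr k a => σ.arr k (a.eval σ)

/-- The operation `o` applied to `a` and `b` has a value below `B`. Nothing is asked of the
operations that cannot leave the range of their operands. -/
def _root_.WordRAM.Op.Fits (B : ℕ) : WordRAM.Op → ℕ → ℕ → Prop
  | .add, a, b => a + b < B
  | .mul, a, b => a * b < B
  | _, _, _ => True

/-- No operation in the evaluation of an expression produces a value above the bound `B`. -/
def Ok (B : ℕ) (σ : State) : Expr → Prop
  | const _ => True
  | reg _ => True
  | op o a b => a.Ok B σ ∧ b.Ok B σ ∧ o.Fits B (a.eval σ) (b.eval σ)
  | arr _ a => a.Ok B σ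

/-- The largest constant or array name in an expression. -/
def top : Expr → ℕ
  | const c => c
  | reg _ => 0
  | op _ a b => max a.top b.top
  | arr k a => max k a.top

/-- The number of instructions in the translation of an expression. -/
def cost : Expr → ℕ
  | const _ => 1
  | reg _ => 2
  | op _ a b => a.cost + (b.cost + 1)
  | arr _ a => a.cost + 4

@[simp] theorem eval_const (σ : State) (c : ℕ) : (const c).eval σ = c := rfl
@[simp] theorem eval_reg (σ : State) (i : ℕ) : (reg i).eval σ = σ.reg i := rfl
@[simp] theorem eval_arr (σ : State) (k : ℕ) (a : Expr) :
    (arr k a).eval σ = σ.arr k (a.eval σ) := rfl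
@[simp] theorem eval_add (σ : State) (a b : Expr) : (a + b).eval σ = a.eval σ + b.eval σ := rfl
@[simp] theorem eval_mul (σ : State) (a b : Expr) : (a * b).eval σ = a.eval σ * b.eval σ := rfl
@[simp] theorem eval_sub (σ : State) (a b : Expr) : (a - b).eval σ = a.eval σ - b.eval σ := rfl
@[simp] theorem eval_lt (σ : State) (a b : Expr) :
    (op .lt a b).eval σ = if a.eval σ < b.eval σ then 1 else 0 := rfl
@[simp] theorem eval_eq (σ : State) (a b : Expr) :
    (op .eq a b).eval σ = if a.eval σ = b.eval σ then 1 else 0 := rfl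

theorem _root_.WordRAM.Op.eval_lt_le_one (a b : ℕ) : WordRAM.Op.lt.eval a b ≤ 1 := by
  simp only [WordRAM.Op.eval]
  split_ifs <;> simp

@[simp] theorem ok_const (B : ℕ) (σ : State) (c : ℕ) : (const c).Ok B σ := trivial
@[simp] theorem ok_reg (B : ℕ) (σ : State) (i : ℕ) : (reg i).Ok B σ := trivial
@[simp] theorem ok_arr (B : ℕ) (σ : State) (k : ℕ) (a : Expr) :
    (arr k a).Ok B σ ↔ a.Ok B σ := Iff.rfl
@[simp] theorem ok_add (B : ℕ) (σ : State) (a b : Expr) :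
    (a + b).Ok B σ ↔ a.Ok B σ ∧ b.Ok B σ ∧ a.eval σ + b.eval σ < B := Iff.rfl
@[simp] theorem ok_mul (B : ℕ) (σ : State) (a b : Expr) :
    (a * b).Ok B σ ↔ a.Ok B σ ∧ b.Ok B σ ∧ a.eval σ * b.eval σ < B := Iff.rfl
@[simp] theorem ok_sub (B : ℕ) (σ : State) (a b : Expr) :
    (a - b).Ok B σ ↔ a.Ok B σ ∧ b.Ok B σ := by
  change _ ∧ _ ∧ True ↔ _
  simp
@[simp] theorem ok_lt (B : ℕ) (σ : State) (a b : Expr) :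
    (op .lt a b).Ok B σ ↔ a.Ok B σ ∧ b.Ok B σ := by
  change _ ∧ _ ∧ True ↔ _
  simp
@[simp] theorem ok_eq (B : ℕ) (σ : State) (a b : Expr) :
    (op .eq a b).Ok B σ ↔ a.Ok B σ ∧ b.Ok B σ := by
  change _ ∧ _ ∧ True ↔ _
  simp

@[simp] theorem cost_const (c : ℕ) : (const c).cost = 1 := rfl
@[simp] theorem cost_reg (i : ℕ) : (reg i).cost = 2 := rfl
@[simp] theorem cost_op (o : WordRAM.Op) (a b : Expr) :
    (op o a b).cost = a.cost + (b.cost + 1) := rfl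
@[simp] theorem cost_arr (k : ℕ) (a : Expr) : (arr k a).cost = a.cost + 4 := rfl
@[simp] theorem cost_add (a b : Expr) : (a + b).cost = a.cost + (b.cost + 1) := rfl
@[simp] theorem cost_mul (a b : Expr) : (a * b).cost = a.cost + (b.cost + 1) := rfl
@[simp] theorem cost_sub (a b : Expr) : (a - b).cost = a.cost + (b.cost + 1) := rfl

end Expr

/-- Statements of the array language. -/
inductive Stmt where
  | skip
  /-- `r_i := e` -/
  | assign (i : ℕ) (e : Expr)
  /-- `arr_k[a] := e` -/
  | store (k : ℕ) (a e : Expr)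
  | seq (p q : Stmt)
  | ite (e : Expr) (p q : Stmt)
  | while (e : Expr) (p : Stmt)

namespace Stmt

/-- The registers that a statement assigns. -/
def regs : Stmt → Set ℕ
  | skip => ∅
  | assign i _ => {i}
  | store _ _ _ => ∅
  | seq p q => p.regs ∪ q.regs
  | ite _ p q => p.regs ∪ q.regs
  | .while _ p => p.regs

/-- The arrays that a statement modifies. -/
def arrs : Stmt → Set ℕ
  | skip => ∅
  | assign _ _ => ∅
  | store k _ _ => {k}
  | seq p q => p.arrs ∪ q.arrs
  | ite _ p q => p.arrs ∪ q.arrs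
  | .while _ p => p.arrs

/-- The largest constant or array name in a statement. -/
def top : Stmt → ℕ
  | skip => 0
  | assign _ e => e.top
  | store k a e => max k (max a.top e.top)
  | seq p q => max p.top q.top
  | ite e p q => max e.top (max p.top q.top)
  | .while e p => max e.top p.top

@[simp] theorem regs_skip : skip.regs = ∅ := rfl
@[simp] theorem regs_assign (i : ℕ) (e : Expr) : (assign i e).regs = {i} := rfl
@[simp] theorem regs_store (k : ℕ) (a e : Expr) : (store k a e).regs = ∅ := rfl
@[simp] theorem regs_seq (p q : Stmt) : (seq p q).regs = p.regs ∪ q.regs := rfl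
@[simp] theorem regs_ite (e : Expr) (p q : Stmt) : (ite e p q).regs = p.regs ∪ q.regs := rfl
@[simp] theorem regs_while (e : Expr) (p : Stmt) : (Stmt.while e p).regs = p.regs := rfl
@[simp] theorem arrs_skip : skip.arrs = ∅ := rfl
@[simp] theorem arrs_assign (i : ℕ) (e : Expr) : (assign i e).arrs = ∅ := rfl
@[simp] theorem arrs_store (k : ℕ) (a e : Expr) : (store k a e).arrs = {k} := rfl
@[simp] theorem arrs_seq (p q : Stmt) : (seq p q).arrs = p.arrs ∪ q.arrs := rfl
@[simp] theorem arrs_ite (e : Expr) (p q : Stmt) : (ite e p q).arrs = p.arrs ∪ q.arrs := rfl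
@[simp] theorem arrs_while (e : Expr) (p : Stmt) : (Stmt.while e p).arrs = p.arrs := rfl

end Stmt

/-- `Run B p σ t τ`: the statement `p`, started in the state `σ`, halts in the state `τ` after
exactly `t` steps of its translation, and no value above the bound `B` appears on the way. -/
inductive Run (B : ℕ) : Stmt → State → ℕ → State → Prop where
  | skip (σ : State) : Run B .skip σ 1 σ
  | assign {i : ℕ} {e : Expr} {σ : State} :
      e.Ok B σ → Run B (.assign i e) σ (e.cost + 2) (σ.setReg i (e.eval σ))
  | store {k : ℕ} {a e : Expr} {σ : State} : a.Ok B σ → e.Ok B σ →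
      Run B (.store k a e) σ (a.cost + (e.cost + 4)) (σ.setArr k (a.eval σ) (e.eval σ))
  | seq {p q : Stmt} {σ τ υ : State} {t₁ t₂ : ℕ} :
      Run B p σ t₁ τ → Run B q τ t₂ υ → Run B (.seq p q) σ (t₁ + t₂) υ
  | ite_true {e : Expr} {p q : Stmt} {σ τ : State} {t : ℕ} : e.Ok B σ → e.eval σ ≠ 0 →
      Run B p σ t τ → Run B (.ite e p q) σ (e.cost + (t + 1)) τ
  | ite_false {e : Expr} {p q : Stmt} {σ τ : State} {t : ℕ} : e.Ok B σ → e.eval σ = 0 →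
      Run B q σ t τ → Run B (.ite e p q) σ (e.cost + (t + 1)) τ
  | while_done {e : Expr} {p : Stmt} {σ : State} : e.Ok B σ → e.eval σ = 0 →
      Run B (.while e p) σ (e.cost + 1) σ
  | while_step {e : Expr} {p : Stmt} {σ τ υ : State} {t₁ t₂ : ℕ} : e.Ok B σ → e.eval σ ≠ 0 →
      Run B p σ t₁ τ → Run B (.while e p) τ t₂ υ →
      Run B (.while e p) σ (e.cost + (t₁ + t₂ + 1)) υ

/-- The states `σ` and `τ` differ only in registers and arrays that `p` may modify. -/
structure Agree (p : Stmt) (σ τ : State) : Prop where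
  reg : ∀ i, i ∉ p.regs → τ.reg i = σ.reg i
  arr : ∀ k, k ∉ p.arrs → τ.arr k = σ.arr k

theorem Agree.refl (p : Stmt) (σ : State) : Agree p σ σ := ⟨fun _ _ => rfl, fun _ _ => rfl⟩

theorem Agree.trans {p : Stmt} {σ τ υ : State} (h : Agree p σ τ) (h' : Agree p τ υ) :
    Agree p σ υ :=
  ⟨fun i hi => (h'.reg i hi).trans (h.reg i hi), fun k hk => (h'.arr k hk).trans (h.arr k hk)⟩

theorem Agree.mono {p q : Stmt} {σ τ : State} (h : Agree p σ τ) (hr : p.regs ⊆ q.regs)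
    (ha : p.arrs ⊆ q.arrs) : Agree q σ τ :=
  ⟨fun i hi => h.reg i fun h => hi (hr h), fun k hk => h.arr k fun h => hk (ha h)⟩

theorem Run.agree {B : ℕ} {p : Stmt} {σ τ : State} {t : ℕ} (h : Run B p σ t τ) :
    Agree p σ τ := by
  induction h with
  | skip σ => exact .refl _ _
  | assign h => exact ⟨fun j hj => by
      simp only [State.setReg_reg]
      exact if_neg hj, fun _ _ => rfl⟩
  | store h h' =>
    refine ⟨fun _ _ => rfl, fun j hj => ?_⟩
    simp only [State.setArr_arr]
    exact if_neg hj
  | seq h h' ih ih' =>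
    exact (ih.mono Set.subset_union_left Set.subset_union_left).trans
      (ih'.mono Set.subset_union_right Set.subset_union_right)
  | ite_true _ _ _ ih => exact ih.mono Set.subset_union_left Set.subset_union_left
  | ite_false _ _ _ ih => exact ih.mono Set.subset_union_right Set.subset_union_right
  | while_done => exact .refl _ _
  | while_step _ _ _ _ ih ih' =>
    exact (ih.mono (q := .while _ _) subset_rfl subset_rfl).trans ih'

/-! ### Translation -/

open WordRAM (Program Instr Op Exec)

/-- The RAM registers that hold intermediate values. Even registers hold the registers of the array
machine, and register `1` holds the length of the memory block reserved for each array. -/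
def tmp (d : ℕ) : ℕ := 2 * d + 3

/-- Program that puts the value of an expression in the temporary register number `d`. -/
def Expr.code : Expr → ℕ → Program
  | const c, d => .instr (.const (tmp d) c)
  | reg i, d => .seq (.instr (.const (tmp d) 0)) (.instr (.op .add (tmp d) (tmp d) (2 * i)))
  | op o a b, d => .seq (a.code d) (.seq (b.code (d + 1))
      (.instr (.op o (tmp d) (tmp d) (tmp (d + 1)))))
  | arr k a, d => .seq (a.code d) (.seq (.instr (.const (tmp (d + 1)) k))
      (.seq (.instr (.op .mul (tmp (d + 1)) (tmp (d + 1)) 1))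
      (.seq (.instr (.op .add (tmp d) (tmp (d + 1)) (tmp d))) (.instr (.load (tmp d) (tmp d))))))

/-- Translation of the array language to the word RAM. -/
def Stmt.code : Stmt → Program
  | skip => .skip
  | assign i e => .seq (e.code 0) (.seq (.instr (.const (tmp 1) 0))
      (.instr (.op .add (2 * i) (tmp 0) (tmp 1))))
  | store k a e => .seq (a.code 0) (.seq (e.code 1) (.seq (.instr (.const (tmp 2) k))
      (.seq (.instr (.op .mul (tmp 2) (tmp 2) 1)) (.seq (.instr (.op .add (tmp 0) (tmp 2) (tmp 0)))
      (.instr (.store (tmp 0) (tmp 1)))))))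
  | seq p q => .seq p.code q.code
  | ite e p q => .seq (e.code 0) (.ite (tmp 0) p.code q.code)
  | .while e p => .seq (e.code 0) (.loop (tmp 0) (.seq p.code (e.code 0)))

/-- All registers and array entries are less than `B`. -/
structure Bounded (B : ℕ) (σ : State) : Prop where
  reg : ∀ i, σ.reg i < B
  arr : ∀ k a, σ.arr k a < B

/-- The RAM state `s` represents the state `σ`: entry `a < B` of array `k ≤ T` is at address
`k * B + a`. -/
structure Represents (B T : ℕ) (σ : State) (s : WordRAM.State) : Prop where
  reg : ∀ i, s.reg (2 * i) = σ.reg i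
  base : s.reg 1 = B
  mem : ∀ k ≤ T, ∀ a < B, s.mem (k * B + a) = σ.arr k a

theorem Expr.eval_lt_bound {B : ℕ} (hB : 2 ≤ B) {σ : State} (hσ : Bounded B σ) (e : Expr)
    (h : e.Ok B σ) (ht : e.top < B) : e.eval σ < B := by
  induction e with
  | const c => exact ht
  | reg i => exact hσ.reg i
  | op o a b iha ihb =>
    obtain ⟨h1, h2, h3⟩ := h
    simp only [top, max_lt_iff] at ht
    have ha := iha h1 ht.1
    cases o
    · exact h3
    · exact lt_of_le_of_lt (Nat.sub_le _ _) ha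
    · exact h3
    · simp only [eval, WordRAM.Op.eval]
      split_ifs <;> omega
    · simp only [eval, WordRAM.Op.eval]
      split_ifs <;> omega
  | arr k a iha => exact hσ.arr _ _

theorem Run.bounded {B : ℕ} (hB : 2 ≤ B) {p : Stmt} {σ τ : State} {t : ℕ} (h : Run B p σ t τ)
    (hσ : Bounded B σ) (ht : p.top < B) : Bounded B τ := by
  induction h with
  | skip σ => exact hσ
  | @assign i e σ h =>
    have := e.eval_lt_bound hB hσ h ht
    refine ⟨fun j => ?_, hσ.arr⟩
    simp only [State.setReg_reg]
    split_ifs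
    · exact this
    · exact hσ.reg j
  | @store k a e σ h h' =>
    simp only [Stmt.top, max_lt_iff] at ht
    have := e.eval_lt_bound hB hσ h' ht.2.2
    refine ⟨hσ.reg, fun j b => ?_⟩
    simp only [State.setArr_arr]
    split_ifs
    · rw [Function.update_apply]
      split_ifs
      · exact this
      · exact hσ.arr _ _
    · exact hσ.arr _ _
  | seq h h' ih ih' =>
    simp only [Stmt.top, max_lt_iff] at ht
    exact ih' (ih hσ ht.1) ht.2
  | ite_true _ _ _ ih =>
    simp only [Stmt.top, max_lt_iff] at ht
    exact ih hσ ht.2.1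
  | ite_false _ _ _ ih =>
    simp only [Stmt.top, max_lt_iff] at ht
    exact ih hσ ht.2.2
  | while_done => exact hσ
  | while_step _ _ _ _ ih ih' =>
    simp only [Stmt.top, max_lt_iff] at ht ih'
    exact ih' (ih hσ ht.2) ht

/-- Writing a temporary register. -/
def setTmp (s : WordRAM.State) (d v : ℕ) : WordRAM.State :=
  { s with reg := Function.update s.reg (tmp d) v }

theorem setTmp_reg_tmp (s : WordRAM.State) (d v j : ℕ) :
    (setTmp s d v).reg (tmp j) = if j = d then v else s.reg (tmp j) := by
  simp [setTmp, Function.update_apply, tmp]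

theorem setTmp_reg_even (s : WordRAM.State) (d v i : ℕ) :
    (setTmp s d v).reg (2 * i) = s.reg (2 * i) := by
  simp only [setTmp, Function.update_apply, tmp]
  rw [if_neg (by omega)]

theorem setTmp_reg_one (s : WordRAM.State) (d v : ℕ) : (setTmp s d v).reg 1 = s.reg 1 := by
  simp [setTmp, tmp]

theorem Represents.setTmp {B T : ℕ} {σ : State} {s : WordRAM.State} (h : Represents B T σ s)
    (d v : ℕ) : Represents B T σ (setTmp s d v) :=
  ⟨fun i => by rw [setTmp_reg_even, h.reg], by rw [setTmp_reg_one, h.base], h.mem⟩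

theorem exec_const_tmp {w c : ℕ} (hc : c < 2 ^ w) (d : ℕ) (s : WordRAM.State) :
    Exec w (.instr (.const (tmp d) c)) s 1 (setTmp s d c) := by
  have := Exec.instr (w := w) (.const (tmp d) c) s
  rwa [Instr.exec, Nat.mod_eq_of_lt hc] at this

theorem exec_op_tmp {w : ℕ} (o : Op) (d i j : ℕ) (s : WordRAM.State)
    (h : o.eval (s.reg i) (s.reg j) < 2 ^ w) :
    Exec w (.instr (.op o (tmp d) i j)) s 1 (setTmp s d (o.eval (s.reg i) (s.reg j))) := by
  have := Exec.instr (w := w) (.op o (tmp d) i j) s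
  rwa [Instr.exec, Nat.mod_eq_of_lt h] at this

theorem exec_load_tmp {w : ℕ} (d i : ℕ) (s : WordRAM.State) :
    Exec w (.instr (.load (tmp d) i)) s 1 (setTmp s d (s.mem (s.reg i))) :=
  Exec.instr (.load (tmp d) i) s

theorem address_lt {B T M k a : ℕ} (hM : (T + 1) * B ≤ M) (hk : k ≤ T) (ha : a < B) :
    k * B + a < M := by
  have : k * B ≤ T * B := Nat.mul_le_mul_right _ hk
  rw [add_mul] at hM
  omega

theorem Expr.exec_code {w B T : ℕ} (hB : 2 ≤ B) (hT : T < B) (hw : (T + 1) * B ≤ 2 ^ w)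
    {σ : State} (hσ : Bounded B σ) (e : Expr) (hok : e.Ok B σ) (htop : e.top ≤ T) (d : ℕ)
    (s : WordRAM.State) (hs : Represents B T σ s) :
    ∃ s', Exec w (e.code d) s e.cost s' ∧ Represents B T σ s' ∧ s'.reg (tmp d) = e.eval σ ∧
      ∀ j < d, s'.reg (tmp j) = s.reg (tmp j) := by
  have hBw : B ≤ 2 ^ w := le_trans (Nat.le_mul_of_pos_left _ (by omega)) hw
  induction e generalizing d s with
  | const c =>
    have hc : c ≤ T := htop
    refine ⟨setTmp s d c, exec_const_tmp (by omega) d s, hs.setTmp d c, ?_, fun j hj => ?_⟩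
    · simp [setTmp_reg_tmp]
    · rw [setTmp_reg_tmp, if_neg hj.ne]
  | reg i =>
    have hi := hσ.reg i
    have h1 := exec_const_tmp (w := w) (c := 0) (by omega) d s
    have h2 := exec_op_tmp (w := w) .add d (tmp d) (2 * i) (setTmp s d 0) (by
      simp only [setTmp_reg_tmp, setTmp_reg_even, hs.reg, WordRAM.Op.eval, if_true]
      omega)
    refine ⟨_, .seq h1 h2, (hs.setTmp _ _).setTmp _ _, ?_, fun j hj => ?_⟩
    · simp [setTmp_reg_tmp, setTmp_reg_even, hs.reg, WordRAM.Op.eval, eval]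
    · simp only [setTmp_reg_tmp, if_neg hj.ne]
  | op o a b iha ihb =>
    have hval := (op o a b).eval_lt_bound hB hσ hok (by omega)
    obtain ⟨ha, hb, -⟩ := hok
    simp only [top, max_le_iff] at htop
    obtain ⟨s₁, e₁, r₁, v₁, k₁⟩ := iha ha htop.1 d s hs
    obtain ⟨s₂, e₂, r₂, v₂, k₂⟩ := ihb hb htop.2 (d + 1) s₁ r₁
    have hv : o.eval (s₂.reg (tmp d)) (s₂.reg (tmp (d + 1))) = (op o a b).eval σ := by
      rw [v₂, k₂ d (by omega), v₁]
      rfl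
    have h3 := exec_op_tmp (w := w) o d (tmp d) (tmp (d + 1)) s₂ (by omega)
    rw [hv] at h3
    refine ⟨_, .seq e₁ (.seq e₂ h3), r₂.setTmp _ _, ?_, fun j hj => ?_⟩
    · simp [setTmp_reg_tmp]
    · rw [setTmp_reg_tmp, if_neg hj.ne, k₂ j (by omega), k₁ j hj]
  | arr k a iha =>
    simp only [top, max_le_iff] at htop
    have hval := a.eval_lt_bound hB hσ hok (by omega)
    have haddr := address_lt hw htop.1 hval
    obtain ⟨s₁, e₁, r₁, v₁, k₁⟩ := iha hok htop.2 d s hs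
    have h2 := exec_const_tmp (w := w) (c := k) (by omega) (d + 1) s₁
    set s₂ := setTmp s₁ (d + 1) k with hs₂
    have r₂ : Represents B T σ s₂ := r₁.setTmp _ _
    have h3 := exec_op_tmp (w := w) .mul (d + 1) (tmp (d + 1)) 1 s₂ (by
      simp only [hs₂, setTmp_reg_tmp, setTmp_reg_one, r₁.base, WordRAM.Op.eval, if_true]
      omega)
    have hv3 : Op.mul.eval (s₂.reg (tmp (d + 1))) (s₂.reg 1) = k * B := by
      simp [hs₂, setTmp_reg_tmp, setTmp_reg_one, r₁.base, WordRAM.Op.eval]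
    rw [hv3] at h3
    set s₃ := setTmp s₂ (d + 1) (k * B) with hs₃
    have r₃ : Represents B T σ s₃ := r₂.setTmp _ _
    have hv4 : Op.add.eval (s₃.reg (tmp (d + 1))) (s₃.reg (tmp d)) = k * B + a.eval σ := by
      simp [hs₃, hs₂, setTmp_reg_tmp, v₁, WordRAM.Op.eval]
    have h4 := exec_op_tmp (w := w) .add d (tmp (d + 1)) (tmp d) s₃ (by omega)
    rw [hv4] at h4
    set s₄ := setTmp s₃ d (k * B + a.eval σ) with hs₄
    have r₄ : Represents B T σ s₄ := r₃.setTmp _ _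
    have h5 := exec_load_tmp (w := w) d (tmp d) s₄
    have hv5 : s₄.mem (s₄.reg (tmp d)) = σ.arr k (a.eval σ) := by
      rw [hs₄, setTmp_reg_tmp, if_pos rfl]
      exact r₄.mem k htop.1 _ hval
    rw [hv5] at h5
    refine ⟨_, .seq e₁ (.seq h2 (.seq h3 (.seq h4 h5))), r₄.setTmp _ _, ?_, fun j hj => ?_⟩
    · simp [setTmp_reg_tmp]
    · simp only [setTmp_reg_tmp, hs₄, hs₃, hs₂, if_neg hj.ne, if_neg (show j ≠ d + 1 by omega)]
      exact k₁ j hj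

/-- The translation of a statement runs in lockstep with it. -/
theorem Run.exec_code {w B T : ℕ} (hB : 2 ≤ B) (hT : T < B) (hw : (T + 1) * B ≤ 2 ^ w)
    {p : Stmt} {σ τ : State} {t : ℕ} (h : Run B p σ t τ) (hσ : Bounded B σ) (htop : p.top ≤ T)
    (s : WordRAM.State) (hs : Represents B T σ s) :
    ∃ s', Exec w p.code s t s' ∧ Represents B T τ s' := by
  have hBw : B ≤ 2 ^ w := le_trans (Nat.le_mul_of_pos_left _ (by omega)) hw
  induction h generalizing s with
  | skip σ => exact ⟨s, .skip s, hs⟩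
  | @assign i e σ h =>
    have hval := e.eval_lt_bound hB hσ h (lt_of_le_of_lt htop hT)
    obtain ⟨s₁, e₁, r₁, v₁, -⟩ := e.exec_code hB hT hw hσ h htop 0 s hs
    have h2 := exec_const_tmp (w := w) (c := 0) (by omega) 1 s₁
    have h3 := Exec.instr (w := w) (.op .add (2 * i) (tmp 0) (tmp 1)) (setTmp s₁ 1 0)
    have hv : Op.add.eval ((setTmp s₁ 1 0).reg (tmp 0)) ((setTmp s₁ 1 0).reg (tmp 1)) =
        e.eval σ := by
      simp [setTmp_reg_tmp, v₁, WordRAM.Op.eval]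
    rw [Instr.exec, hv, Nat.mod_eq_of_lt (by omega)] at h3
    have r₂ := r₁.setTmp 1 0
    refine ⟨_, .seq e₁ (.seq h2 h3), ⟨fun j => ?_, ?_, fun k hk a ha => r₂.mem k hk a ha⟩⟩
    · have : 2 * j = 2 * i ↔ j = i := by omega
      simp only [Function.update_apply, State.setReg_reg, this, r₂.reg]
    · simp only [Function.update_apply]
      rw [if_neg (by omega), r₂.base]
  | @store k a e σ h h' =>
    simp only [Stmt.top, max_le_iff] at htop
    have hval := e.eval_lt_bound hB hσ h' (by omega)
    have hvala := a.eval_lt_bound hB hσ h (by omega)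
    have haddr := address_lt hw htop.1 hvala
    obtain ⟨s₁, e₁, r₁, v₁, -⟩ := a.exec_code hB hT hw hσ h htop.2.1 0 s hs
    obtain ⟨s₂, e₂, r₂, v₂, k₂⟩ := e.exec_code hB hT hw hσ h' htop.2.2 1 s₁ r₁
    have h3 := exec_const_tmp (w := w) (c := k) (by omega) 2 s₂
    set s₃ := setTmp s₂ 2 k with hs₃
    have r₃ : Represents B T σ s₃ := r₂.setTmp _ _
    have hv4 : Op.mul.eval (s₃.reg (tmp 2)) (s₃.reg 1) = k * B := by
      simp [hs₃, setTmp_reg_tmp, setTmp_reg_one, r₂.base, WordRAM.Op.eval]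
    have h4 := exec_op_tmp (w := w) .mul 2 (tmp 2) 1 s₃ (by omega)
    rw [hv4] at h4
    set s₄ := setTmp s₃ 2 (k * B) with hs₄
    have r₄ : Represents B T σ s₄ := r₃.setTmp _ _
    have hv5 : Op.add.eval (s₄.reg (tmp 2)) (s₄.reg (tmp 0)) = k * B + a.eval σ := by
      simp [hs₄, hs₃, setTmp_reg_tmp, k₂, v₁, WordRAM.Op.eval]
    have h5 := exec_op_tmp (w := w) .add 0 (tmp 2) (tmp 0) s₄ (by omega)
    rw [hv5] at h5
    set s₅ := setTmp s₄ 0 (k * B + a.eval σ) with hs₅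
    have r₅ : Represents B T σ s₅ := r₄.setTmp _ _
    have h6 := Exec.instr (w := w) (.store (tmp 0) (tmp 1)) s₅
    have ha0 : s₅.reg (tmp 0) = k * B + a.eval σ := by simp [hs₅, setTmp_reg_tmp]
    have ha1 : s₅.reg (tmp 1) = e.eval σ := by simp [hs₅, hs₄, hs₃, setTmp_reg_tmp, v₂]
    rw [Instr.exec, ha0, ha1] at h6
    refine ⟨_, .seq e₁ (.seq e₂ (.seq h3 (.seq h4 (.seq h5 h6)))),
      ⟨r₅.reg, r₅.base, fun j hj b hb => ?_⟩⟩
    have hinj : j * B + b = k * B + a.eval σ ↔ j = k ∧ b = a.eval σ := by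
      constructor
      · intro h
        have h1 : (j * B + b) / B = j := by
          rw [mul_comm, Nat.mul_add_div (by omega), Nat.div_eq_of_lt hb, add_zero]
        have h2 : (k * B + a.eval σ) / B = k := by
          rw [mul_comm, Nat.mul_add_div (by omega), Nat.div_eq_of_lt hvala, add_zero]
        have h3 : j = k := by rw [← h1, ← h2, h]
        subst h3
        exact ⟨rfl, by omega⟩
      · rintro ⟨rfl, rfl⟩
        rfl
    simp only [Function.update_apply, State.setArr_arr, hinj, r₅.mem j hj b hb]
    by_cases hjk : j = k
    · subst hjk
      simp [Function.update_apply]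
    · simp [hjk]
  | seq h h' ih ih' =>
    simp only [Stmt.top, max_le_iff] at htop
    obtain ⟨s₁, e₁, r₁⟩ := ih hσ htop.1 s hs
    obtain ⟨s₂, e₂, r₂⟩ := ih' (h.bounded hB hσ (by omega)) htop.2 s₁ r₁
    exact ⟨s₂, .seq e₁ e₂, r₂⟩
  | ite_true h h0 _ ih =>
    simp only [Stmt.top, max_le_iff] at htop
    obtain ⟨s₁, e₁, r₁, v₁, -⟩ := Expr.exec_code hB hT hw hσ _ h htop.1 0 s hs
    obtain ⟨s₂, e₂, r₂⟩ := ih hσ htop.2.1 s₁ r₁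
    exact ⟨s₂, .seq e₁ (.ite_true (by rwa [v₁]) e₂), r₂⟩
  | ite_false h h0 _ ih =>
    simp only [Stmt.top, max_le_iff] at htop
    obtain ⟨s₁, e₁, r₁, v₁, -⟩ := Expr.exec_code hB hT hw hσ _ h htop.1 0 s hs
    obtain ⟨s₂, e₂, r₂⟩ := ih hσ htop.2.2 s₁ r₁
    exact ⟨s₂, .seq e₁ (.ite_false (by rwa [v₁]) e₂), r₂⟩
  | while_done h h0 =>
    simp only [Stmt.top, max_le_iff] at htop
    obtain ⟨s₁, e₁, r₁, v₁, -⟩ := Expr.exec_code hB hT hw hσ _ h htop.1 0 s hs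
    exact ⟨s₁, .seq e₁ (.loop_done (by rwa [v₁])), r₁⟩
  | while_step h h0 hp hl ih ih' =>
    simp only [Stmt.top, max_le_iff] at htop ih'
    obtain ⟨s₁, e₁, r₁, v₁, -⟩ := Expr.exec_code hB hT hw hσ _ h htop.1 0 s hs
    obtain ⟨s₂, e₂, r₂⟩ := ih hσ htop.2 s₁ r₁
    obtain ⟨s₃, e₃, r₃⟩ := ih' (hp.bounded hB hσ (by omega)) htop s₂ r₂
    cases e₃ with
    | @seq _ _ _ s' _ t₁ t₂ e₃ e₄ =>
      have := Exec.seq e₁ (.loop_step (by rwa [v₁]) (.seq e₂ e₃) e₄)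
      refine ⟨s₃, ?_, r₃⟩
      simp only [add_assoc] at this ⊢
      exact this

/-! ### Upper bounds for running times -/

/-- From the state `σ`, the statement `p` takes at most `T` steps and ends in a state with the
property `Q`. -/
def Wp (B : ℕ) (p : Stmt) (T : ℕ) (σ : State) (Q : State → Prop) : Prop :=
  ∃ t τ, Run B p σ t τ ∧ t ≤ T ∧ Q τ

theorem Wp.mono {B : ℕ} {p : Stmt} {T T' : ℕ} {σ : State} {Q Q' : State → Prop}
    (h : Wp B p T σ Q) (hT : T ≤ T') (hQ : ∀ τ, Agree p σ τ → Q τ → Q' τ) : Wp B p T' σ Q' := by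
  obtain ⟨t, τ, h1, h2, h3⟩ := h
  exact ⟨t, τ, h1, h2.trans hT, hQ τ h1.agree h3⟩

theorem Wp.skip {B T : ℕ} {σ : State} {Q : State → Prop} (hT : 1 ≤ T) (hQ : Q σ) :
    Wp B .skip T σ Q :=
  ⟨1, σ, .skip σ, hT, hQ⟩

theorem Wp.assign {B T i : ℕ} {e : Expr} {σ : State} {Q : State → Prop} (hok : e.Ok B σ)
    (hT : e.cost + 2 ≤ T) (hQ : Q (σ.setReg i (e.eval σ))) : Wp B (.assign i e) T σ Q :=
  ⟨_, _, .assign hok, hT, hQ⟩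

theorem Wp.store {B T k : ℕ} {a e : Expr} {σ : State} {Q : State → Prop} (ha : a.Ok B σ)
    (he : e.Ok B σ) (hT : a.cost + (e.cost + 4) ≤ T)
    (hQ : Q (σ.setArr k (a.eval σ) (e.eval σ))) : Wp B (.store k a e) T σ Q :=
  ⟨_, _, .store ha he, hT, hQ⟩

theorem Wp.seq {B T₁ T₂ T : ℕ} {p q : Stmt} {σ : State} {Q R : State → Prop}
    (hp : Wp B p T₁ σ R) (hq : ∀ τ, Agree p σ τ → R τ → Wp B q T₂ τ Q) (hT : T₁ + T₂ ≤ T) :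
    Wp B (.seq p q) T σ Q := by
  obtain ⟨t₁, τ, h1, h2, h3⟩ := hp
  obtain ⟨t₂, υ, k1, k2, k3⟩ := hq τ h1.agree h3
  exact ⟨_, υ, .seq h1 k1, by omega, k3⟩

theorem Wp.ite {B T T' : ℕ} {e : Expr} {p q : Stmt} {σ : State} {Q : State → Prop}
    (hok : e.Ok B σ) (hp : e.eval σ ≠ 0 → Wp B p T σ Q) (hq : e.eval σ = 0 → Wp B q T σ Q)
    (hT : e.cost + (T + 1) ≤ T') : Wp B (.ite e p q) T' σ Q := by
  by_cases h : e.eval σ = 0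
  · obtain ⟨t, τ, h1, h2, h3⟩ := hq h
    exact ⟨_, τ, .ite_false hok h h1, by omega, h3⟩
  · obtain ⟨t, τ, h1, h2, h3⟩ := hp h
    exact ⟨_, τ, .ite_true hok h h1, by omega, h3⟩

theorem Wp.while_done {B T : ℕ} {e : Expr} {p : Stmt} {σ : State} {Q : State → Prop}
    (hok : e.Ok B σ) (h0 : e.eval σ = 0) (hT : e.cost + 1 ≤ T) (hQ : Q σ) :
    Wp B (.while e p) T σ Q :=
  ⟨_, σ, .while_done hok h0, hT, hQ⟩

theorem Wp.while_step {B T₁ T₂ T : ℕ} {e : Expr} {p : Stmt} {σ : State} {Q R : State → Prop}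
    (hok : e.Ok B σ) (h0 : e.eval σ ≠ 0) (hp : Wp B p T₁ σ R)
    (hq : ∀ τ, Agree p σ τ → R τ → Wp B (.while e p) T₂ τ Q) (hT : e.cost + (T₁ + T₂ + 1) ≤ T) :
    Wp B (.while e p) T σ Q := by
  obtain ⟨t₁, τ, h1, h2, h3⟩ := hp
  obtain ⟨t₂, υ, k1, k2, k3⟩ := hq τ h1.agree h3
  exact ⟨_, υ, .while_step hok h0 h1 k1, by omega, k3⟩

end ArrayMachine

/-! ### Loops over lists -/

namespace ArrayMachine

/-- `for ri < bound do (rx := val; p)`, where `val` is evaluated anew in each round. -/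
def loopOver (ri rx : ℕ) (bound val : Expr) (p : Stmt) : Stmt :=
  .seq (.assign ri (.const 0)) (.while (.lt (.reg ri) bound)
    (.seq (.seq (.assign rx val) p) (.assign ri (.reg ri + .const 1))))

@[simp] theorem regs_loopOver (ri rx : ℕ) (bound val : Expr) (p : Stmt) :
    (loopOver ri rx bound val p).regs = insert ri (insert rx p.regs) := by
  ext i
  simp only [loopOver, Stmt.regs_seq, Stmt.regs_assign, Stmt.regs_while, Set.mem_union,
    Set.mem_singleton_iff, Set.mem_insert_iff]
  tauto

@[simp] theorem arrs_loopOver (ri rx : ℕ) (bound val : Expr) (p : Stmt) :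
    (loopOver ri rx bound val p).arrs = p.arrs := by
  simp [loopOver]

/-- The overhead of each round of a loop. -/
def loopCost (bound val : Expr) : ℕ := bound.cost + val.cost + 15

/-- Rule for a loop over the entries of a list `l`, with an invariant that depends on the entries
that have been visited. -/
theorem Wp.forIn {B T tb ri rx : ℕ} {bound val : Expr} {p : Stmt} {σ : State}
    {Q : State → Prop} (l : List ℕ) (I : List ℕ → State → Prop) (hl : l.length < B)
    (hri : ri ∉ p.regs) (hrx : ri ≠ rx)
    (hbound : ∀ τ, Agree (loopOver ri rx bound val p) σ τ →
      bound.Ok B τ ∧ bound.eval τ = l.length)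
    (hval : ∀ done x rest τ, l = done ++ x :: rest →
      Agree (loopOver ri rx bound val p) σ τ → τ.reg ri = done.length → I done τ →
      val.Ok B τ ∧ val.eval τ = x)
    (hI : ∀ i v l' τ, (i = ri ∨ i = rx) → I l' τ → I l' (τ.setReg i v))
    (h0 : I [] σ)
    (hstep : ∀ done x rest τ, l = done ++ x :: rest →
      Agree (loopOver ri rx bound val p) σ τ → τ.reg rx = x → τ.reg ri = done.length →
      I done τ → Wp B p tb τ (I (done ++ [x])))
    (hT : l.length * (tb + loopCost bound val) + loopCost bound val ≤ T)
    (hQ : ∀ τ, Agree (loopOver ri rx bound val p) σ τ → I l τ → Q τ) :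
    Wp B (loopOver ri rx bound val p) T σ Q := by
  have key : ∀ rest done τ, l = done ++ rest →
      Agree (loopOver ri rx bound val p) σ τ → τ.reg ri = done.length → I done τ →
      Wp B (.while (.lt (.reg ri) bound)
        (.seq (.seq (.assign rx val) p) (.assign ri (.reg ri + .const 1))))
        (rest.length * (tb + loopCost bound val) + (bound.cost + 4)) τ Q := by
    intro rest
    induction rest with
    | nil =>
      intro done τ hd hag hr hinv
      obtain ⟨hok, hev⟩ := hbound τ hag
      rw [List.append_nil] at hd
      subst hd
      refine Wp.while_done (by simpa using hok) ?_ ?_ (hQ τ hag hinv)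
      · simp [hev, hr]
      · simp only [Expr.cost]
        omega
    | cons x rest ih =>
      intro done τ hd hag hr hinv
      obtain ⟨hok, hev⟩ := hbound τ hag
      have hlen : l.length = done.length + (rest.length + 1) := by simp [hd]
      obtain ⟨hvok, hvev⟩ := hval done x rest τ hd hag hr hinv
      have ag1 : Agree (loopOver ri rx bound val p) σ (τ.setReg rx x) := by
        refine hag.trans ⟨fun i hi => ?_, fun k hk => rfl⟩
        simp only [regs_loopOver, Set.mem_insert_iff, not_or] at hi
        simp [hi.2.1]
      have body := hstep done x rest (τ.setReg rx x) hd ag1 (by simp) (by simp [hrx, hr])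
        (hI _ _ _ _ (Or.inr rfl) hinv)
      have round : Wp B (.seq (.seq (.assign rx val) p) (.assign ri (.reg ri + .const 1)))
          (val.cost + 2 + tb + 6) τ (fun τ' =>
            Agree (loopOver ri rx bound val p) σ τ' ∧
            τ'.reg ri = (done ++ [x]).length ∧ I (done ++ [x]) τ') := by
        refine Wp.seq (R := fun τ' => Agree (loopOver ri rx bound val p) σ τ' ∧
            τ'.reg ri = done.length ∧ I (done ++ [x]) τ')
          (Wp.seq (R := fun τ' => τ' = τ.setReg rx x) (T₁ := val.cost + 2)
            (Wp.assign hvok le_rfl (by rw [hvev])) (T₂ := tb) ?_ le_rfl)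
            (T₂ := 6) ?_ le_rfl
        · rintro τ' - rfl
          refine body.mono le_rfl fun τ' hag' hI' => ⟨ag1.trans (hag'.mono ?_ ?_), ?_, hI'⟩
          · rw [regs_loopOver]
            exact fun i hi => Or.inr (Or.inr hi)
          · rw [arrs_loopOver]
          · rw [hag'.reg ri hri]
            simp [hrx, hr]
        · rintro τ' - ⟨h1, h2, h3⟩
          refine Wp.assign (by simp [h2]; omega) le_rfl ⟨h1.trans ⟨fun i hi => ?_, fun k hk => rfl⟩,
            by simp [h2], hI _ _ _ _ (Or.inl rfl) h3⟩
          simp only [regs_loopOver, Set.mem_insert_iff, not_or] at hi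
          simp [hi.1]
      refine Wp.while_step (by simpa using hok) (by simp [hev, hr, hlen]) round
        (fun τ' _ h => ih (done ++ [x]) τ' (by simp [hd]) h.1 h.2.1 h.2.2) ?_
      simp only [List.length_cons, Expr.cost, loopCost]
      ring_nf
      omega
  refine Wp.seq (R := fun τ => τ = σ.setReg ri 0) (T₁ := 3)
    (Wp.assign (by simp) le_rfl rfl) (T₂ := l.length * (tb + loopCost bound val) + (bound.cost + 4))
    ?_ (by simp only [loopCost] at hT ⊢; omega)
  rintro τ - rfl
  refine key l [] _ rfl ⟨fun i hi => ?_, fun k hk => rfl⟩ (by simp) (hI _ _ _ _ (Or.inl rfl) h0)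
  simp only [regs_loopOver, Set.mem_insert_iff, not_or] at hi
  simp [hi.1]

/-! ### Loops over the input

Register `1` holds the number of vertices, register `2` the number of hyperedges, array `0` the
input. In a loop over the hyperedges, register `5` holds the position of the current hyperedge in
the input and register `7` its arity. -/

/-- Loop over the hyperedges of the input. -/
def loopEdges (p : Stmt) : Stmt :=
  .seq (.assign 5 (.const 2)) (loopOver 6 7 (.reg 2) (.arr 0 (.reg 5))
    (.seq p (.assign 5 (.reg 5 + .reg 7 + .const 1))))

/-- Loop over the vertices of the current hyperedge, with `rx` as the loop variable. -/
def loopElems (ri rx : ℕ) (p : Stmt) : Stmt :=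
  loopOver ri rx (.reg 7) (.arr 0 (.reg 5 + .const 1 + .reg ri)) p

@[simp] theorem regs_loopEdges (p : Stmt) : (loopEdges p).regs = {5, 6, 7} ∪ p.regs := by
  ext i
  simp only [loopEdges, Stmt.regs_seq, Stmt.regs_assign, regs_loopOver, Set.mem_union,
    Set.mem_singleton_iff, Set.mem_insert_iff]
  tauto

@[simp] theorem arrs_loopEdges (p : Stmt) : (loopEdges p).arrs = p.arrs := by
  simp [loopEdges]

@[simp] theorem regs_loopElems (ri rx : ℕ) (p : Stmt) :
    (loopElems ri rx p).regs = insert ri (insert rx p.regs) := by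
  simp [loopElems]

@[simp] theorem arrs_loopElems (ri rx : ℕ) (p : Stmt) : (loopElems ri rx p).arrs = p.arrs := by
  simp [loopElems]

/-- The part of the input that stores the hyperedges. -/
def edgeCode (L : List (List ℕ)) : List ℕ := L.flatMap fun a => a.length :: a

theorem encode_eq (n : ℕ) (L : List (List ℕ)) :
    Hypergraph.encode n L = n :: L.length :: edgeCode L := rfl

/-- Registers `5` and `7` describe the hyperedge `a` of the input. -/
structure AtEdge (B : ℕ) (a : List ℕ) (τ : State) : Prop where
  length : τ.reg 7 = a.length
  get : ∀ i (h : i < a.length), τ.arr 0 (τ.reg 5 + 1 + i) = a[i]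
  lt : τ.reg 5 + 1 + a.length < B

theorem Wp.forEdges {B T tb n : ℕ} {p : Stmt} {σ : State} {Q : State → Prop}
    (L : List (List ℕ)) (I : List (List ℕ) → State → Prop)
    (hin : ∀ i, σ.arr 0 i = (Hypergraph.encode n L).getD i 0) (hm : σ.reg 2 = L.length)
    (hB : (Hypergraph.encode n L).length + 1 < B)
    (hp0 : 0 ∉ p.arrs) (hp : 2 ∉ p.regs ∧ 5 ∉ p.regs ∧ 6 ∉ p.regs ∧ 7 ∉ p.regs)
    (hI : ∀ i v l' τ, (i = 5 ∨ i = 6 ∨ i = 7) → I l' τ → I l' (τ.setReg i v))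
    (h0 : I [] σ)
    (hstep : ∀ done a rest τ, L = done ++ a :: rest → Agree (loopEdges p) σ τ → AtEdge B a τ →
      I done τ → Wp B p tb τ (I (done ++ [a])))
    (hT : L.length * (tb + 40) + 40 ≤ T)
    (hQ : ∀ τ, Agree (loopEdges p) σ τ → I L τ → Q τ) :
    Wp B (loopEdges p) T σ Q := by
  have hlen : (Hypergraph.encode n L).length = 2 + (edgeCode L).length := by
    simp [encode_eq]
    omega
  have hregs : insert 6 (insert 7 (p.regs ∪ {5})) = {5, 6, 7} ∪ p.regs := by
    ext i
    simp only [Set.mem_union, Set.mem_singleton_iff, Set.mem_insert_iff]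
    tauto
  have hsub : ∀ {τ υ : State}, Agree (loopOver 6 7 (.reg 2) (.arr 0 (.reg 5))
      (.seq p (.assign 5 (.reg 5 + .reg 7 + .const 1)))) τ υ →
      Agree (loopEdges p) τ υ := fun h =>
    h.mono (by rw [regs_loopEdges, ← hregs]; simp) (by simp)
  refine Wp.seq (R := fun τ => τ = σ.setReg 5 2) (T₁ := 3)
    (T₂ := L.length * (tb + 40) + 30) (Wp.assign (by simp) le_rfl rfl) ?_ (by omega)
  rintro τ₀ ag₀ rfl
  have ag₀' : Agree (loopEdges p) σ (σ.setReg 5 2) :=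
    ag₀.mono (by simp) (by simp)
  have split : ∀ (done : List ℕ) x rest, L.map List.length = done ++ x :: rest →
      ∃ a rest', L = L.take done.length ++ a :: rest' ∧ x = a.length ∧
        L.take (done.length + 1) = L.take done.length ++ [a] := by
    intro done x rest h
    have hl : done.length < L.length := by
      have := congrArg List.length h
      simp at this
      omega
    refine ⟨L[done.length], L.drop (done.length + 1), ?_, ?_, ?_⟩
    · rw [← List.drop_eq_getElem_cons hl, List.take_append_drop]
    · have h1 : (L.map List.length)[done.length]'(by simpa using hl) = x := by
        simp [h]
      rw [← h1]
      simp
    · rw [List.take_succ_eq_append_getElem hl]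
  have code : ∀ (l₁ : List (List ℕ)) a l₂ i, L = l₁ ++ a :: l₂ → i ≤ a.length →
      (Hypergraph.encode n L).getD (2 + (edgeCode l₁).length + i) 0 = (a.length :: a).getD i 0 := by
    intro l₁ a l₂ i h hi
    have h1 : edgeCode L = edgeCode l₁ ++ ((a.length :: a) ++ edgeCode l₂) := by
      simp [edgeCode, h]
    have h2 : 2 + (edgeCode l₁).length + i = ((edgeCode l₁).length + i) + 1 + 1 := by ring
    rw [encode_eq, h2, List.getD_cons_succ, List.getD_cons_succ, h1,
      List.getD_append_right _ _ _ _ (by omega), Nat.add_sub_cancel_left,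
      List.getD_append _ _ _ _ (by simp; omega)]
  have size : ∀ (l₁ : List (List ℕ)) a l₂, L = l₁ ++ a :: l₂ →
      (edgeCode l₁).length + a.length + 1 ≤ (edgeCode L).length := by
    intro l₁ a l₂ h
    simp only [h, edgeCode, List.flatMap_append, List.flatMap_cons, List.length_append,
      List.length_cons]
    omega
  have cur : ∀ (τ : State) l₁ a l₂, Agree (loopEdges p) σ τ → L = l₁ ++ a :: l₂ →
      τ.reg 5 = 2 + (edgeCode l₁).length → τ.arr 0 (τ.reg 5) = a.length ∧
      (∀ i (h : i < a.length), τ.arr 0 (τ.reg 5 + 1 + i) = a[i]) ∧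
      τ.reg 5 + 1 + a.length + 1 < B := by
    intro τ l₁ a l₂ hag h h5
    have ha : τ.arr 0 = σ.arr 0 := hag.arr 0 (by simpa using hp0)
    rw [ha, h5]
    refine ⟨?_, fun i hi => ?_, ?_⟩
    · rw [hin]
      have := code l₁ a l₂ 0 h (by omega)
      simpa using this
    · rw [hin]
      have := code l₁ a l₂ (i + 1) h (by omega)
      rw [show 2 + (edgeCode l₁).length + 1 + i = 2 + (edgeCode l₁).length + (i + 1) by ring, this]
      simp [hi]
    · have := size l₁ a l₂ h
      omega
  refine Wp.forIn (tb := tb + 11) (L.map List.length)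
    (fun d τ => τ.reg 5 = 2 + (edgeCode (L.take d.length)).length ∧ I (L.take d.length) τ)
    ?_ ?_ (by norm_num) ?_ ?_ ?_ ?_ ?_ ?_ ?_
  · have : L.length ≤ (edgeCode L).length := by
      clear * -
      induction L with
      | nil => simp
      | cons a l ih =>
        simp only [edgeCode, List.flatMap_cons, List.length_append, List.length_cons] at ih ⊢
        omega
    simp
    omega
  · simp [hp.2.2.1]
  · intro τ hag
    refine ⟨by simp, ?_⟩
    simp only [Expr.eval_reg, List.length_map]
    rw [(hsub hag).reg 2 (by simp [hp.1])]
    simpa using hm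
  · rintro done x rest τ h hag - ⟨h5, -⟩
    obtain ⟨a, rest', h1, rfl, -⟩ := split done x rest h
    exact ⟨by simp, (cur τ _ a rest' (ag₀'.trans (hsub hag)) h1 h5).1⟩
  · rintro i v l' τ (rfl | rfl) ⟨h5, h⟩
    · exact ⟨by simpa using h5, hI _ _ _ _ (by simp) h⟩
    · exact ⟨by simpa using h5, hI _ _ _ _ (by simp) h⟩
  · exact ⟨by simp [edgeCode], hI _ _ _ _ (by simp) (by simpa using h0)⟩
  · rintro done x rest τ h hag h7 - ⟨h5, hinv⟩
    obtain ⟨a, rest', h1, rfl, h2⟩ := split done x rest h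
    obtain ⟨-, c2, c3⟩ := cur τ _ a rest' (ag₀'.trans (hsub hag)) h1 h5
    have := hstep _ a rest' τ h1 (ag₀'.trans (hsub hag)) ⟨h7, c2, by omega⟩ hinv
    refine Wp.seq (T₂ := 11) this ?_ le_rfl
    intro τ' hag' hI'
    have e5 : τ'.reg 5 = τ.reg 5 := hag'.reg 5 hp.2.1
    have e7 : τ'.reg 7 = a.length := by rw [hag'.reg 7 hp.2.2.2, h7]
    refine Wp.assign ?_ (by simp) ?_
    · simp only [Expr.ok_add, Expr.ok_reg, Expr.ok_const, Expr.eval_add, Expr.eval_reg,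
        Expr.eval_const, e5, e7, true_and]
      omega
    · simp only [List.length_append, List.length_singleton, h2]
      refine ⟨?_, hI _ _ _ _ (by simp) hI'⟩
      simp [e5, e7, h5, edgeCode]
      ring
  · simp only [List.length_map, loopCost, Expr.cost]
    ring_nf
    ring_nf at hT
    omega
  · rintro τ hag ⟨-, h⟩
    refine hQ τ (ag₀'.trans (hsub hag)) ?_
    simpa using h

theorem Wp.forElems {B T tb ri rx : ℕ} {p : Stmt} {σ : State} {Q : State → Prop} {a : List ℕ}
    (hσ : AtEdge B a σ) (I : List ℕ → State → Prop) (hri : ri ∉ p.regs) (hrx : ri ≠ rx)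
    (hp0 : 0 ∉ p.arrs) (hp : 5 ∉ p.regs ∧ 7 ∉ p.regs)
    (hr : ri ≠ 5 ∧ ri ≠ 7 ∧ rx ≠ 5 ∧ rx ≠ 7)
    (hI : ∀ i v l' τ, (i = ri ∨ i = rx) → I l' τ → I l' (τ.setReg i v))
    (h0 : I [] σ)
    (hstep : ∀ done x rest τ, a = done ++ x :: rest → Agree (loopElems ri rx p) σ τ →
      AtEdge B a τ → τ.reg rx = x → I done τ → Wp B p tb τ (I (done ++ [x])))
    (hT : a.length * (tb + 40) + 40 ≤ T)
    (hQ : ∀ τ, Agree (loopElems ri rx p) σ τ → I a τ → Q τ) :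
    Wp B (loopElems ri rx p) T σ Q := by
  have at' : ∀ τ, Agree (loopElems ri rx p) σ τ → AtEdge B a τ := by
    intro τ hag
    have h5 : τ.reg 5 = σ.reg 5 := hag.reg 5 (by simp [hp.1, hr.1.symm, hr.2.2.1.symm])
    have h7 : τ.reg 7 = σ.reg 7 := hag.reg 7 (by simp [hp.2, hr.2.1.symm, hr.2.2.2.symm])
    have ha : τ.arr 0 = σ.arr 0 := hag.arr 0 (by simpa using hp0)
    exact ⟨by rw [h7, hσ.length], by rw [h5, ha]; exact hσ.get, by rw [h5]; exact hσ.lt⟩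
  refine Wp.forIn (tb := tb) a I (by have := hσ.lt; omega) hri hrx
    (fun τ hag => ⟨by simp, by simpa using (at' τ hag).length⟩) ?_ hI h0 ?_ ?_ hQ
  · intro done x rest τ h hag hr' _
    have hl : done.length < a.length := by simp [h]
    have hat := at' τ hag
    have := hat.lt
    refine ⟨?_, ?_⟩
    · simp only [Expr.ok_arr, Expr.ok_add, Expr.ok_reg, Expr.ok_const, Expr.eval_add, Expr.eval_reg,
        Expr.eval_const, true_and, hr']
      omega
    · simp only [Expr.eval_arr, Expr.eval_add, Expr.eval_reg, Expr.eval_const, hr',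
        hat.get _ hl]
      simp [h]
  · intro done x rest τ h hag hx _ hinv
    exact hstep done x rest τ h hag (at' τ hag) hx hinv
  · refine le_trans ?_ hT
    have : loopCost (.reg 7) (.arr 0 (.reg 5 + .const 1 + .reg ri)) ≤ 40 := by
      simp [loopCost]
    gcongr

end ArrayMachine

/-! ### Tables of close later vertices -/

namespace ArrayMachine

/-- The vertex `y` shares a hyperedge with `x` that has at most `l` vertices of greater key than
`x`, and the key of `y` is not greater. When the keys are those of an ordering, with greater keys
first, this says that there is an arc from `x` to `y`, or a loop, in the `l`-skeleton. -/
def Close (key : ℕ → ℕ) (l : ℕ∞) (L : List (List ℕ)) (x y : ℕ) : Prop :=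
  ∃ a ∈ L, x ∈ a ∧ y ∈ a ∧ ¬ key x < key y ∧
    ((a.countP fun z => key x < key z : ℕ) : ℕ∞) ≤ l

/-- Register `4` holds the number `ρ` of the current round, register `3` the base `N` of all
address computations; vertex `x` has the slot `ρ * N + x` in round `ρ`. -/
def slot (x : Expr) : Expr := .reg 4 * .reg 3 + x

/-- The address for the pair `(x, y)` in the current round. -/
def pair (x y : Expr) : Expr := slot x * .reg 3 + y

/-- The test whether `y` has a greater key than `x`. -/
def precedes : Expr := .lt (.arr 1 (.reg 10)) (.arr 1 (.reg 11))

/-- Insertion of `y` in the list of `x`, unless `y` has a greater key or is marked already. -/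
def insertPair : Stmt :=
  .ite (precedes + .arr 2 (pair (.reg 10) (.reg 11))) .skip
    (.seq (.store 2 (pair (.reg 10) (.reg 11)) (.const 1))
    (.seq (.store 4 (pair (.reg 10) (.arr 3 (slot (.reg 10)))) (.reg 11))
      (.store 3 (slot (.reg 10)) (.arr 3 (slot (.reg 10)) + .const 1))))

/-- The test whether register `12` is at most `l`. -/
noncomputable def light (l : ℕ∞) : Expr :=
  if l = ⊤ then .const 1 else .lt (.reg 12) (.const (l.toNat + 1))

/-- Insertion of all suitable vertices of the current hyperedge in the list of its vertex `x`. -/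
noncomputable def scanVertex (l : ℕ∞) : Stmt :=
  .seq (.assign 12 (.const 0)) (.seq (loopElems 9 11 (.assign 12 (.reg 12 + precedes)))
    (.ite (light l) (loopElems 9 11 insertPair) .skip))

/-- Computation, for all vertices `x`, of the list of all `y` that are close to `x`. -/
noncomputable def scan (l : ℕ∞) : Stmt := loopEdges (loopElems 8 10 (scanVertex l))

/-- In round `ρ`, for each `x` the relation `P x` is tabulated by the entries of array `2`, and by
a list in array `4`, whose length is in array `3`. The tables are zero for later rounds. -/
structure Tabulates (N ρ : ℕ) (P : ℕ → ℕ → Prop) (nbr : ℕ → List ℕ) (τ : State) : Prop where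
  mem : ∀ x y, y ∈ nbr x ↔ P x y
  nodup : ∀ x, (nbr x).Nodup
  deg : ∀ x < N, τ.arr 3 (ρ * N + x) = (nbr x).length
  adj : ∀ x < N, ∀ i (h : i < (nbr x).length), τ.arr 4 ((ρ * N + x) * N + i) = (nbr x)[i]
  mark_one : ∀ x < N, ∀ y < N, P x y → τ.arr 2 ((ρ * N + x) * N + y) = 1
  mark_zero : ∀ x < N, ∀ y < N, ¬ P x y → τ.arr 2 ((ρ * N + x) * N + y) = 0
  deg_fresh : ∀ o, (ρ + 1) * N ≤ o → τ.arr 3 o = 0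
  mark_fresh : ∀ o, (ρ + 1) * N * N ≤ o → τ.arr 2 o = 0

/-- The tables for round `ρ` and later rounds are zero. -/
structure Fresh (N ρ : ℕ) (τ : State) : Prop where
  deg : ∀ o, ρ * N ≤ o → τ.arr 3 o = 0
  mark : ∀ o, ρ * N * N ≤ o → τ.arr 2 o = 0

theorem Fresh.tabulates {N ρ : ℕ} {τ : State} (h : Fresh N ρ τ) :
    Tabulates N ρ (fun _ _ => False) (fun _ => []) τ where
  mem := by simp
  nodup := by simp
  deg x _ := by simpa using h.deg _ (Nat.le_add_right _ _)
  adj x _ i hi := by simp at hi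
  mark_one x _ y _ := False.elim
  mark_zero x _ y _ _ := h.mark _ <| by
    calc ρ * N * N ≤ (ρ * N + x) * N := Nat.mul_le_mul_right _ (Nat.le_add_right _ _)
      _ ≤ _ := Nat.le_add_right _ _
  deg_fresh o ho := h.deg o (le_trans (Nat.mul_le_mul_right _ (Nat.le_succ _)) ho)
  mark_fresh o ho := h.mark o (le_trans
    (Nat.mul_le_mul_right _ (Nat.mul_le_mul_right _ (Nat.le_succ _))) ho)

theorem Tabulates.fresh {N ρ : ℕ} {P : ℕ → ℕ → Prop} {nbr : ℕ → List ℕ} {τ : State}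
    (h : Tabulates N ρ P nbr τ) : Fresh N (ρ + 1) τ :=
  ⟨h.deg_fresh, h.mark_fresh⟩

theorem Tabulates.congr {N ρ : ℕ} {P : ℕ → ℕ → Prop} {nbr : ℕ → List ℕ} {τ τ' : State}
    (h : Tabulates N ρ P nbr τ) (h2 : τ'.arr 2 = τ.arr 2) (h3 : τ'.arr 3 = τ.arr 3)
    (h4 : τ'.arr 4 = τ.arr 4) : Tabulates N ρ P nbr τ' where
  mem := h.mem
  nodup := h.nodup
  deg := by rw [h3]; exact h.deg
  adj := by rw [h4]; exact h.adj
  mark_one := by rw [h2]; exact h.mark_one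
  mark_zero := by rw [h2]; exact h.mark_zero
  deg_fresh := by rw [h3]; exact h.deg_fresh
  mark_fresh := by rw [h2]; exact h.mark_fresh

theorem slot_lt {N ρ x : ℕ} (hρ : ρ < N) (hx : x < N) : ρ * N + x < N * N := by
  nlinarith

theorem pair_inj {N u v x y : ℕ} (hx : x < N) (hy : y < N) (h : u * N + x = v * N + y) :
    u = v ∧ x = y := by
  have hN : 0 < N := by omega
  have h1 : (u * N + x) / N = u := by
    rw [mul_comm, Nat.mul_add_div hN, Nat.div_eq_of_lt hx, add_zero]
  have h2 : (v * N + y) / N = v := by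
    rw [mul_comm, Nat.mul_add_div hN, Nat.div_eq_of_lt hy, add_zero]
  have h3 : u = v := by rw [← h1, ← h2, h]
  subst h3
  exact ⟨rfl, by omega⟩

theorem Tabulates.length_lt {n N ρ : ℕ} {P : ℕ → ℕ → Prop} {nbr : ℕ → List ℕ} {τ : State}
    (h : Tabulates N ρ P nbr τ) (hP : ∀ x y, P x y → y < n) (hn : n < N) (x : ℕ) :
    (nbr x).length < N := by
  have h1 : (nbr x).toFinset ⊆ Finset.range n := by
    intro y hy
    rw [List.mem_toFinset, h.mem] at hy
    simpa using hP x y hy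
  have h2 := Finset.card_le_card h1
  rw [List.toFinset_card_of_nodup (h.nodup x), Finset.card_range] at h2
  omega

/-- Effect of marking the pair `(x, y)` and appending `y` to the list of `x`. -/
theorem Tabulates.insert {n N ρ : ℕ} {P : ℕ → ℕ → Prop} {nbr : ℕ → List ℕ} {τ τ' : State}
    (h : Tabulates N ρ P nbr τ) (hP : ∀ x y, P x y → y < n) (hn : n < N) {x y : ℕ}
    (hx : x < n) (hy : y < n) (hxy : ¬ P x y)
    (e2 : τ'.arr 2 = Function.update (τ.arr 2) ((ρ * N + x) * N + y) 1)
    (e3 : τ'.arr 3 = Function.update (τ.arr 3) (ρ * N + x) ((nbr x).length + 1))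
    (e4 : τ'.arr 4 = Function.update (τ.arr 4) ((ρ * N + x) * N + (nbr x).length) y) :
    Tabulates N ρ (fun a b => P a b ∨ a = x ∧ b = y) (Function.update nbr x (nbr x ++ [y])) τ' where
  mem a b := by
    rw [Function.update_apply]
    split_ifs with ha
    · subst ha
      simp [h.mem]
    · simp [h.mem, ha]
  nodup a := by
    rw [Function.update_apply]
    split_ifs with ha
    · rw [List.nodup_append]
      refine ⟨h.nodup x, by simp, ?_⟩
      rintro b hb c hc rfl
      rw [List.mem_singleton] at hc
      subst hc
      exact hxy ((h.mem x b).1 hb)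
    · exact h.nodup a
  deg a ha := by
    rw [e3, Function.update_apply, Function.update_apply]
    by_cases hax : a = x
    · simp [hax]
    · rw [if_neg (by omega), if_neg hax, h.deg a ha]
  adj a ha i hi := by
    have hl := h.length_lt hP hn a
    have hl' := h.length_lt hP hn x
    rw [e4, Function.update_apply]
    by_cases hax : a = x
    · subst hax
      simp only [Function.update_self, List.length_append, List.length_singleton] at hi
      by_cases hil : i = (nbr a).length
      · simp [hil]
      · have hi' : i < (nbr a).length := by omega
        simp [hil, h.adj a ha i hi', hi']
    · simp only [Function.update_of_ne hax] at hi ⊢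
      rw [if_neg, h.adj a ha i hi]
      intro he
      have := pair_inj (by omega) hl' he
      omega
  mark_one a ha b hb hab := by
    rw [e2, Function.update_apply]
    split_ifs with hne
    · rfl
    · rcases hab with hab | ⟨rfl, rfl⟩
      · exact h.mark_one a ha b hb hab
      · exact absurd rfl hne
  mark_zero a ha b hb hab := by
    simp only [not_or, not_and] at hab
    rw [e2, Function.update_apply, if_neg]
    · exact h.mark_zero a ha b hb hab.1
    · intro he
      obtain ⟨h1, h2⟩ := pair_inj hb (by omega) he
      exact hab.2 (by omega) h2
  deg_fresh o ho := by
    have : ρ * N + x < (ρ + 1) * N := by rw [add_mul]; omega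
    rw [e3, Function.update_apply, if_neg (by omega), h.deg_fresh o ho]
  mark_fresh o ho := by
    have : (ρ * N + x) * N + y < (ρ + 1) * N * N := by
      have h1 : ρ * N + x + 1 ≤ (ρ + 1) * N := by rw [add_mul]; omega
      have h2 := Nat.mul_le_mul_right N h1
      rw [add_mul] at h2
      omega
    rw [e2, Function.update_apply, if_neg (by omega), h.mark_fresh o ho]

/-- The standing values of the registers `3` and `4`, and the bounds that keep all addresses in
range. -/
structure Layout (B n N ρ : ℕ) (τ : State) : Prop where
  base : τ.reg 3 = N
  round : τ.reg 4 = ρ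
  lt : n < N
  round_lt : ρ < N
  bound : N * N * N < B

/-- `Tabulates` with some lists, for a relation on the vertices `0, …, n - 1`. -/
def HasTable (n N ρ : ℕ) (P : ℕ → ℕ → Prop) (τ : State) : Prop :=
  (∃ nbr, Tabulates N ρ P nbr τ) ∧ ∀ x y, P x y → y < n

theorem HasTable.setReg {n N ρ i v : ℕ} {P : ℕ → ℕ → Prop} {τ : State}
    (h : HasTable n N ρ P τ) : HasTable n N ρ P (τ.setReg i v) := by
  obtain ⟨⟨nbr, h1⟩, h2⟩ := h
  exact ⟨⟨nbr, h1.congr rfl rfl rfl⟩, h2⟩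

theorem HasTable.iff {n N ρ : ℕ} {P P' : ℕ → ℕ → Prop} {τ : State}
    (h : HasTable n N ρ P τ) (h' : ∀ x y, P x y ↔ P' x y) : HasTable n N ρ P' τ := by
  have : P = P' := by
    ext x y
    exact h' x y
  rwa [← this]

theorem Wp.insertPair {B n N ρ x y : ℕ} {P : ℕ → ℕ → Prop} {τ : State} (hL : Layout B n N ρ τ)
    (h : HasTable n N ρ P τ) (hx : τ.reg 10 = x) (hy : τ.reg 11 = y) (hxn : x < n)
    (hyn : y < n) :
    Wp B insertPair 120 τ
      (HasTable n N ρ fun a b => P a b ∨ a = x ∧ b = y ∧ ¬ τ.arr 1 x < τ.arr 1 y) := by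
  obtain ⟨⟨nbr, ht⟩, hP⟩ := h
  have hn := hL.lt
  have hN := hL.bound
  have hlen := ht.length_lt hP hn x
  have hdeg := ht.deg x (by omega)
  have h1 := slot_lt hL.round_lt (show x < N by omega)
  have h2 : (ρ * N + x) * N + N ≤ N * N * N := by nlinarith
  have h3 : N * N ≤ N * N * N := Nat.le_mul_of_pos_right _ (by omega)
  have h4 : ρ * N ≤ N * N := Nat.mul_le_mul_right _ hL.round_lt.le
  have hm : τ.arr 2 ((ρ * N + x) * N + y) ≤ 1 := by
    by_cases hxy : P x y
    · exact (ht.mark_one x (by omega) y (by omega) hxy).le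
    · exact (ht.mark_zero x (by omega) y (by omega) hxy).le.trans zero_le_one
  have hB8 : 8 ≤ N * N * N ∨ n = 0 := by
    rcases Nat.eq_zero_or_pos n with h | h
    · exact Or.inr h
    · left
      have : 2 ≤ N := by omega
      nlinarith
  refine Wp.ite (T := 76) ?_ ?_ ?_ ?_
  · simp only [precedes, pair, slot, Expr.ok_add, Expr.ok_lt, Expr.ok_arr, Expr.ok_reg,
      Expr.ok_mul, Expr.eval_add, Expr.eval_lt, Expr.eval_arr, Expr.eval_reg, Expr.eval_mul,
      hL.base, hL.round, hx, hy, true_and]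
    refine ⟨⟨⟨⟨by omega, by omega⟩, by omega⟩, by omega⟩, ?_⟩
    split_ifs <;> omega
  · intro hne
    refine Wp.skip (by norm_num) ?_
    refine HasTable.iff ⟨⟨nbr, ht⟩, hP⟩ fun a b => ⟨Or.inl, ?_⟩
    rintro (hab | ⟨rfl, rfl, hab⟩)
    · exact hab
    · by_contra hP'
      apply hne
      simp [precedes, pair, slot, hL.base, hL.round, hx, hy, hab,
        ht.mark_zero a (by omega) b (by omega) hP']
  · intro h0
    simp only [precedes, pair, slot, Expr.eval_add, Expr.eval_lt, Expr.eval_arr, Expr.eval_reg,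
      Expr.eval_mul, hL.base, hL.round, hx, hy, Nat.add_eq_zero_iff] at h0
    have hk : ¬ τ.arr 1 x < τ.arr 1 y := by
      intro hlt
      rw [if_pos hlt] at h0
      omega
    have hPxy : ¬ P x y := by
      intro hP'
      rw [ht.mark_one x (by omega) y (by omega) hP'] at h0
      omega
    refine Wp.seq (T₁ := 19) (R := fun τ' => τ' = τ.setArr 2 ((ρ * N + x) * N + y) 1)
      (Wp.store ?_ (by simp) (by simp [pair, slot]) ?_) (T₂ := 56) ?_ (by norm_num)
    · simp [pair, slot, hL.base, hL.round, hx, hy]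
      omega
    · simp [pair, slot, hL.base, hL.round, hx, hy]
    · rintro τ₁ - rfl
      refine Wp.seq (T₁ := 30) (R := fun τ' => τ' = (τ.setArr 2 ((ρ * N + x) * N + y) 1).setArr 4
        ((ρ * N + x) * N + (nbr x).length) y)
        (Wp.store ?_ (by simp) (by simp [pair, slot]) ?_) (T₂ := 26) ?_ (by norm_num)
      · simp [pair, slot, hL.base, hL.round, hx, hdeg]
        omega
      · simp [pair, slot, hL.base, hL.round, hx, hy, hdeg]
      · rintro τ₂ - rfl
        refine Wp.store ?_ ?_ (by simp [slot]) ?_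
        · simp [slot, hL.base, hL.round, hx]
          omega
        · simp [slot, hL.base, hL.round, hx, hdeg]
          omega
        · refine HasTable.iff ⟨⟨_, ht.insert hP hn hxn hyn hPxy (by simp) ?_ (by simp)⟩, ?_⟩ ?_
          · simp [slot, hL.base, hL.round, hx, hdeg]
          · rintro a b (hab | ⟨-, rfl⟩)
            · exact hP a b hab
            · exact hyn
          · intro a b
            constructor
            · rintro (hab | ⟨rfl, rfl⟩)
              · exact Or.inl hab
              · exact Or.inr ⟨rfl, rfl, hk⟩
            · rintro (hab | ⟨rfl, rfl, -⟩)
              · exact Or.inl hab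
              · exact Or.inr ⟨rfl, rfl⟩
  · simp [precedes, pair, slot]

theorem Layout.agree {B n N ρ : ℕ} {p : Stmt} {σ τ : State} (h : Layout B n N ρ σ)
    (hag : Agree p σ τ) (h3 : 3 ∉ p.regs) (h4 : 4 ∉ p.regs) : Layout B n N ρ τ :=
  ⟨by rw [hag.reg 3 h3, h.base], by rw [hag.reg 4 h4, h.round], h.lt, h.round_lt, h.bound⟩

theorem Layout.setReg {B n N ρ i v : ℕ} {σ : State} (h : Layout B n N ρ σ)
    (h3 : i ≠ 3) (h4 : i ≠ 4) : Layout B n N ρ (σ.setReg i v) :=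
  ⟨by simp [h3.symm, h.base], by simp [h4.symm, h.round], h.lt, h.round_lt, h.bound⟩

theorem AtEdge.setReg {B i v : ℕ} {a : List ℕ} {σ : State} (h : AtEdge B a σ)
    (h5 : i ≠ 5) (h7 : i ≠ 7) : AtEdge B a (σ.setReg i v) :=
  ⟨by simp [h7.symm, h.length], by simpa [h5.symm] using h.get, by simpa [h5.symm] using h.lt⟩

theorem AtEdge.agree {B : ℕ} {p : Stmt} {a : List ℕ} {σ τ : State} (h : AtEdge B a σ)
    (hag : Agree p σ τ) (h5 : 5 ∉ p.regs) (h7 : 7 ∉ p.regs) (h0 : 0 ∉ p.arrs) : AtEdge B a τ :=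
  ⟨by rw [hag.reg 7 h7, h.length], by rw [hag.reg 5 h5, hag.arr 0 h0]; exact h.get,
    by rw [hag.reg 5 h5]; exact h.lt⟩

theorem eval_light {l : ℕ∞} {τ : State} :
    (light l).eval τ ≠ 0 ↔ ((τ.reg 12 : ℕ) : ℕ∞) ≤ l := by
  unfold light
  split_ifs with h
  · simp [h]
  · simp only [Expr.eval_lt, Expr.eval_reg, Expr.eval_const]
    rw [← ENat.natCast_toNat h, Nat.cast_le]
    simp

theorem ok_light {B : ℕ} {l : ℕ∞} {τ : State} : (light l).Ok B τ := by
  unfold light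
  split_ifs <;> simp

theorem cost_light {l : ℕ∞} : (light l).cost ≤ 4 := by
  unfold light
  split_ifs <;> simp

@[simp] theorem regs_insertPair : insertPair.regs = ∅ := by simp [insertPair]

@[simp] theorem arrs_insertPair : insertPair.arrs = {2, 4, 3} := by
  ext
  simp [insertPair]
  tauto

@[simp] theorem regs_scanVertex (l : ℕ∞) : (scanVertex l).regs = {12, 9, 11} := by
  ext
  simp [scanVertex]
  omega

@[simp] theorem arrs_scanVertex (l : ℕ∞) : (scanVertex l).arrs = {2, 4, 3} := by
  simp [scanVertex]

@[simp] theorem regs_scan (l : ℕ∞) : (scan l).regs = {5, 6, 7, 8, 10, 12, 9, 11} := by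
  ext
  simp [scan]
  tauto

@[simp] theorem arrs_scan (l : ℕ∞) : (scan l).arrs = {2, 4, 3} := by
  simp [scan]

/-- `Close` is defined by an existential over the hyperedges and their vertices; one call accounts for
the hyperedge `a` and its vertex `x`. -/
theorem Wp.scanVertex {B n N ρ x : ℕ} {l : ℕ∞} {P : ℕ → ℕ → Prop} {τ : State} {a : List ℕ}
    (hL : Layout B n N ρ τ) (h : HasTable n N ρ P τ) (hat : AtEdge B a τ) (hx : τ.reg 10 = x)
    (hxn : x < n) (ha : ∀ y ∈ a, y < n) :
    Wp B (scanVertex l) (a.length * 220 + 100) τ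
      (HasTable n N ρ fun b c => P b c ∨ b = x ∧ c ∈ a ∧ ¬ τ.arr 1 x < τ.arr 1 c ∧
        ((a.countP fun z => τ.arr 1 x < τ.arr 1 z : ℕ) : ℕ∞) ≤ l) := by
  set key := τ.arr 1 with hkey
  have hB := hat.lt
  refine Wp.seq (T₁ := 3) (T₂ := a.length * 220 + 97) (R := fun τ' => τ' = τ.setReg 12 0)
    (Wp.assign (by simp) le_rfl rfl) ?_ (by omega)
  rintro τ₁ - rfl
  refine Wp.seq (T₁ := a.length * 60 + 40) (T₂ := a.length * 160 + 50)
    (R := fun τ' => HasTable n N ρ P τ' ∧ Layout B n N ρ τ' ∧ AtEdge B a τ' ∧ τ'.reg 10 = x ∧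
      τ'.arr 1 = key ∧ τ'.reg 12 = a.countP fun z => key x < key z) ?_ ?_ (by omega)
  · refine Wp.forElems (tb := 20) (a := a) (hat.setReg (by norm_num) (by norm_num))
      (fun d τ' => τ'.reg 12 = d.countP fun z => key x < key z) (by simp) (by norm_num)
      (by simp) (by simp) (by norm_num) ?_ (by simp) ?_ (by omega) ?_
    · rintro i v l' τ' (rfl | rfl) h <;> simpa using h
    · intro done y rest τ' hd hag hat' hy hc
      have e10 : τ'.reg 10 = x := by
        rw [hag.reg 10 (by simp)]
        simpa using hx
      have e1 : τ'.arr 1 = key := hag.arr 1 (by simp)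
      have hlen : done.length < a.length := by simp [hd]
      have hcl : done.countP (fun z => decide (key x < key z)) ≤ done.length :=
        List.countP_le_length
      refine Wp.assign ?_ (by simp [precedes]) ?_
      · simp only [precedes, Expr.ok_add, Expr.ok_lt, Expr.ok_arr, Expr.ok_reg, Expr.eval_reg,
          Expr.eval_lt, Expr.eval_arr, true_and, hc]
        refine lt_of_le_of_lt (Nat.add_le_add hcl (?_ : _ ≤ 1)) (by omega)
        exact WordRAM.Op.eval_lt_le_one _ _
      · simp [precedes, hc, e10, hy, e1, List.countP_append, List.countP_cons]
    · intro τ' hag hc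
      refine ⟨?_, ?_, ?_, ?_, ?_, hc⟩
      · obtain ⟨⟨nbr, h1⟩, h2⟩ := h
        exact ⟨⟨nbr, h1.congr (hag.arr 2 (by simp)) (hag.arr 3 (by simp))
          (hag.arr 4 (by simp))⟩, h2⟩
      · exact (hL.setReg (by norm_num) (by norm_num)).agree hag (by simp) (by simp)
      · exact (hat.setReg (by norm_num) (by norm_num)).agree hag (by simp) (by simp) (by simp)
      · rw [hag.reg 10 (by simp)]
        simpa using hx
      · exact hag.arr 1 (by simp)
  · rintro τ₂ - ⟨ht, hL₂, hat₂, hx₂, hk₂, hc⟩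
    refine Wp.ite (T := a.length * 160 + 40) ok_light ?_ ?_
      (by have := cost_light (l := l); omega)
    · intro hne
      rw [eval_light, hc] at hne
      refine Wp.forElems (tb := 120) (a := a) hat₂
        (fun d => HasTable n N ρ fun b c => P b c ∨ b = x ∧ c ∈ d ∧ ¬ key x < key c)
        (by simp) (by norm_num) (by simp) (by simp) (by norm_num)
        (fun i v l' τ' _ h => h.setReg) (ht.iff (by simp)) ?_ (by omega) ?_
      · intro done y rest τ' hd hag hat' hy hinv
        have hyn : y < n := ha y (by simp [hd])
        have e10 : τ'.reg 10 = x := by rw [hag.reg 10 (by simp), hx₂]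
        have e1 : τ'.arr 1 = key := by rw [hag.arr 1 (by simp), hk₂]
        refine (Wp.insertPair (hL₂.agree hag (by simp) (by simp)) hinv e10 hy hxn hyn).mono le_rfl
          fun υ _ hυ => hυ.iff fun b c => ?_
        rw [e1]
        simp only [List.mem_append, List.mem_singleton]
        constructor
        · rintro ((h | ⟨rfl, h1, h2⟩) | ⟨rfl, rfl, h⟩)
          · exact Or.inl h
          · exact Or.inr ⟨rfl, Or.inl h1, h2⟩
          · exact Or.inr ⟨rfl, Or.inr rfl, h⟩
        · rintro (h | ⟨rfl, h1 | rfl, h2⟩)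
          · exact Or.inl (Or.inl h)
          · exact Or.inl (Or.inr ⟨rfl, h1, h2⟩)
          · exact Or.inr ⟨rfl, rfl, h2⟩
      · intro τ' hag hinv
        exact hinv.iff fun b c => by simp [hne]
    · intro h0
      have hl : ¬ ((a.countP fun z => key x < key z : ℕ) : ℕ∞) ≤ l := by
        rw [← hc, ← eval_light, not_not]
        exact h0
      exact Wp.skip (by omega) (ht.iff fun b c => by simp [hl])

/-- Specification of the scan: starting from zeroed tables, it tabulates the relation `Close` of the
current keys. -/
theorem Wp.scan {B n N ρ r : ℕ} {l : ℕ∞} {σ : State} {L : List (List ℕ)}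
    (hL : Layout B n N ρ σ) (hf : Fresh N ρ σ)
    (hin : ∀ i, σ.arr 0 i = (Hypergraph.encode n L).getD i 0) (hm : σ.reg 2 = L.length)
    (hB : (Hypergraph.encode n L).length + 1 < B) (ha : ∀ a ∈ L, ∀ y ∈ a, y < n)
    (hr : ∀ a ∈ L, a.length ≤ r) :
    Wp B (scan l) (L.length * (r * (r * 220 + 140) + 80) + 40) σ
      (HasTable n N ρ (Close (σ.arr 1) l L)) := by
  set key := σ.arr 1 with hkey
  refine Wp.forEdges (tb := r * (r * 220 + 140) + 40) L
    (fun d => HasTable n N ρ (Close key l d)) hin hm hB (by simp) (by simp)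
    (fun i v l' τ _ h => h.setReg) ?_ ?_ (by ring_nf; omega) (fun τ _ h => h)
  · have h0 : HasTable n N ρ (fun _ _ => False) σ := ⟨⟨_, hf.tabulates⟩, by simp⟩
    exact h0.iff fun x y => by simp [Close]
  · intro done a rest τ hd hag hat hinv
    have haL : a ∈ L := by simp [hd]
    have hra := hr a haL
    refine Wp.forElems (tb := r * 220 + 100) hat
      (fun d => HasTable n N ρ fun x y => Close key l done x y ∨ x ∈ d ∧ y ∈ a ∧
        ¬ key x < key y ∧ ((a.countP fun z => key x < key z : ℕ) : ℕ∞) ≤ l)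
      (by simp) (by norm_num) (by simp) (by simp) (by norm_num)
      (fun i v l' τ' _ h => h.setReg) (hinv.iff (by simp)) ?_ ?_ ?_
    · intro dx x rx τ' hd' hag' hat' hx hinv'
      have hL' : Layout B n N ρ τ' := (hL.agree hag (by simp) (by simp)).agree hag' (by simp)
        (by simp)
      have e1 : τ'.arr 1 = key := by rw [hag'.arr 1 (by simp), hag.arr 1 (by simp)]
      have := Wp.scanVertex (l := l) hL' hinv' hat' hx (ha a haL x (by simp [hd'])) (ha a haL)
      refine this.mono (by gcongr) fun υ _ hυ => hυ.iff fun b c => ?_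
      rw [e1]
      simp only [List.mem_append, List.mem_singleton]
      constructor
      · rintro ((h | ⟨h1, h2⟩) | ⟨rfl, h⟩)
        · exact Or.inl h
        · exact Or.inr ⟨Or.inl h1, h2⟩
        · exact Or.inr ⟨Or.inr rfl, h⟩
      · rintro (h | ⟨h1 | rfl, h2⟩)
        · exact Or.inl (Or.inl h)
        · exact Or.inl (Or.inr ⟨h1, h2⟩)
        · exact Or.inr ⟨rfl, h2⟩
    · rw [add_assoc]
      exact Nat.add_le_add_right (Nat.mul_le_mul_right _ hra) 40
    · intro τ' _ h
      refine h.iff fun x y => ?_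
      simp only [Close, List.mem_append, List.mem_singleton]
      constructor
      · rintro (⟨b, hb, h⟩ | h)
        · exact ⟨b, Or.inl hb, h⟩
        · exact ⟨a, Or.inr rfl, h⟩
      · rintro ⟨b, hb | rfl, hc⟩
        · exact Or.inl ⟨b, hb, hc⟩
        · exact Or.inr hc

end ArrayMachine

/-! ### Degeneracy -/

open scoped Hypergraph

namespace Hypergraph

/-- A degenerate hypergraph has few trimmed hyperedges on every vertex set. -/
theorem IsDegenerate.encard_inducedTrimmed_le {α : Type*} [DecidableEq α] {G : Hypergraph α}
    {l : ℕ∞} {κ : ℕ} (h : G.IsDegenerate l κ) (S : Finset α) (hS : (S : Set α) ⊆ V(G)) :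
    E(G.inducedTrimmed l S).encard ≤ (κ * S.card : ℕ) := by
  induction S using Finset.strongInduction with
  | H S ih =>
    rcases S.eq_empty_or_nonempty with rfl | hne
    · have : E(G.inducedTrimmed l (∅ : Finset α)) = ∅ := by
        ext f
        simp only [inducedTrimmed, Finset.coe_empty, Set.inter_empty, Set.mem_ofPred_eq,
          Set.mem_empty_iff_false, iff_false, not_and]
        rintro hf ⟨e, -, -, rfl⟩
        simp at hf
      rw [this]
      simp
    · obtain ⟨v, hv, hdeg⟩ := h S hS (by simpa using hne)
      have hv' : v ∈ S := by simpa using hv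
      have hsub : E(G.inducedTrimmed l S) ⊆
          {e | e ∈ E(G.inducedTrimmed l S) ∧ v ∈ e} ∪ E(G.inducedTrimmed l (S.erase v)) := by
        rintro f hf
        by_cases hvf : v ∈ f
        · exact Or.inl ⟨hf, hvf⟩
        · right
          obtain ⟨hfn, e, he, hle, rfl⟩ := hf
          have hve : v ∉ e := fun hve => hvf ⟨hve, hv⟩
          have hd : e \ ↑(S.erase v) = e \ ↑S := by
            ext x
            simp only [Finset.coe_erase, Set.mem_sdiff, Finset.mem_coe, Set.mem_singleton_iff]
            constructor
            · rintro ⟨h1, h2⟩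
              exact ⟨h1, fun h3 => h2 ⟨h3, fun h4 => hve (h4 ▸ h1)⟩⟩
            · rintro ⟨h1, h2⟩
              exact ⟨h1, fun h3 => h2 h3.1⟩
          refine ⟨hfn, e, he, by rwa [hd], ?_⟩
          ext x
          simp only [Finset.coe_erase, Set.mem_inter_iff, Set.mem_sdiff, Finset.mem_coe,
            Set.mem_singleton_iff]
          constructor
          · rintro ⟨h1, h2⟩
            exact ⟨h1, h2, fun h4 => hve (h4 ▸ h1)⟩
          · rintro ⟨h1, h2, -⟩
            exact ⟨h1, h2⟩
      have ih' := ih (S.erase v) (Finset.erase_ssubset hv')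
        (fun x hx => hS (Finset.mem_of_mem_erase hx))
      calc E(G.inducedTrimmed l S).encard ≤ _ := Set.encard_le_encard hsub
        _ ≤ _ := Set.encard_union_le _ _
        _ ≤ (κ : ℕ∞) + (κ * (S.erase v).card : ℕ) := add_le_add hdeg ih'
        _ = (κ * S.card : ℕ) := by
          rw [← Finset.card_erase_add_one hv']
          push_cast
          ring

theorem isDegenerate_degeneracy {α : Type*} {G : Hypergraph α} (hE : E(G).Finite) (l : ℕ∞) :
    G.IsDegenerate l (G.degeneracy l) := by
  have : {κ : ℕ | G.IsDegenerate l κ}.Nonempty := by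
    refine ⟨E(G).ncard, fun S hS ⟨v, hv⟩ => ⟨v, hv, ?_⟩⟩
    have hsub : {e | e ∈ E(G.inducedTrimmed l S) ∧ v ∈ e} ⊆ (fun e => e ∩ S) '' E(G) := by
      rintro f ⟨⟨-, e, he, -, rfl⟩, -⟩
      exact ⟨e, he, rfl⟩
    calc _ ≤ _ := Set.encard_le_encard hsub
      _ ≤ _ := Set.encard_image_le _ _
      _ = _ := (hE.cast_ncard_eq).symm
  exact Nat.sInf_mem this

namespace IsListing

variable {G : Hypergraph ℕ} {n : ℕ} {L : List (List ℕ)}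

theorem mem_edgeSet (h : G.IsListing n L) {a : List ℕ} (ha : a ∈ L) : {v | v ∈ a} ∈ E(G) := by
  rw [h.edgeSet_eq]
  exact ⟨a, ha, rfl⟩

theorem lt_of_mem (h : G.IsListing n L) : ∀ a ∈ L, ∀ v ∈ a, v < n := by
  intro a ha v hv
  have := G.subset_vertexSet_of_mem_edgeSet (h.mem_edgeSet ha) (a := v) hv
  rw [h.vertexSet_eq] at this
  exact this

theorem edgeSet_eq_coe (h : G.IsListing n L) :
    E(G) = (fun a : List ℕ => {v | v ∈ a}) '' {a | a ∈ L} := by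
  rw [h.edgeSet_eq]
  ext e
  simp [eq_comm]

theorem finite (h : G.IsListing n L) : E(G).Finite := by
  rw [h.edgeSet_eq_coe]
  exact (List.finite_toSet L).image _

theorem length_eq (h : G.IsListing n L) : L.length = E(G).ncard := by
  have hnd : L.Nodup := by
    refine h.pairwise_ne.imp ?_
    rintro a b hab rfl
    exact hab rfl
  have hinj : Set.InjOn (fun a : List ℕ => {v | v ∈ a}) {a | a ∈ L} := by
    intro a ha b hb hab
    by_contra hne
    have : Std.Symm fun a b : List ℕ => {v | v ∈ a} ≠ {v | v ∈ b} := ⟨fun _ _ => Ne.symm⟩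
    exact h.pairwise_ne.forall ha hb hne hab
  rw [h.edgeSet_eq_coe, hinj.ncard_image]
  have : {a | a ∈ L} = (L.toFinset : Set (List ℕ)) := by
    ext
    simp
  rw [this, Set.ncard_coe_finset, List.toFinset_card_of_nodup hnd]

theorem length_le_of_rank_le (h : G.IsListing n L) {r : ℕ} (hr : G.rank ≤ r) :
    ∀ a ∈ L, a.length ≤ r := by
  intro a ha
  have h1 : {v | v ∈ a}.encard ≤ G.rank :=
    le_iSup₂ (f := fun e (_ : e ∈ E(G)) => e.encard) _ (h.mem_edgeSet ha)
  have h2 : {v | v ∈ a} = (a.toFinset : Set ℕ) := by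
    ext
    simp
  rw [h2, Set.encard_coe_eq_coe_finsetCard, List.toFinset_card_of_nodup (h.edge_nodup a ha)] at h1
  exact_mod_cast h1.trans hr

/-- The number of hyperedges of a degenerate hypergraph is linear in the number of vertices. -/
theorem length_le (h : G.IsListing n L) (hne : ∅ ∉ E(G)) (l : ℕ∞) :
    L.length ≤ G.degeneracy l * n := by
  have h1 := (isDegenerate_degeneracy h.finite l).encard_inducedTrimmed_le (Finset.range n)
    (by rw [h.vertexSet_eq]; intro x; simp)
  have h2 : E(G) ⊆ E(G.inducedTrimmed l (Finset.range n)) := by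
    intro e he
    have hsub : e ⊆ ↑(Finset.range n) := by
      intro x hx
      have := G.subset_vertexSet_of_mem_edgeSet he hx
      rw [h.vertexSet_eq] at this
      simpa using this
    refine ⟨Set.nonempty_iff_ne_empty.2 fun h0 => hne (h0 ▸ he), e, he, ?_, ?_⟩
    · rw [Set.sdiff_eq_empty.2 hsub]
      simp
    · rw [Set.inter_eq_left.2 hsub]
  have h3 := (Set.encard_le_encard h2).trans h1
  rw [Finset.card_range, ← h.finite.cast_ncard_eq, ← h.length_eq] at h3
  exact_mod_cast h3

end IsListing

end Hypergraph

namespace ArrayMachine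

open Hypergraph

open scoped Classical in
/-- The vertices that are close to `x`. -/
noncomputable def closeSet (key : ℕ → ℕ) (l : ℕ∞) (L : List (List ℕ)) (n x : ℕ) : Finset ℕ :=
  {y ∈ Finset.range n | Close key l L x y}

theorem mem_closeSet {key : ℕ → ℕ} {l : ℕ∞} {L : List (List ℕ)} {n x y : ℕ}
    (hL : ∀ a ∈ L, ∀ v ∈ a, v < n) : y ∈ closeSet key l L n x ↔ Close key l L x y := by
  simp only [closeSet, Finset.mem_filter, Finset.mem_range, and_iff_right_iff_imp]
  rintro ⟨a, ha, -, hy, -⟩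
  exact hL a ha y hy

/-- If the vertices of key `0` are those of `S`, the vertices of `S` are close to few vertices on
average. -/
theorem sum_card_closeSet_le {G : Hypergraph ℕ} {n r : ℕ} {L : List (List ℕ)}
    (h : G.IsListing n L) (hr : ∀ a ∈ L, a.length ≤ r) (l : ℕ∞) {key : ℕ → ℕ} {S : Finset ℕ}
    (hS : ∀ v < n, v ∈ S ↔ key v = 0) (hSn : ∀ v ∈ S, v < n) :
    ∑ v ∈ S, (closeSet key l L n v).card ≤ r * r * G.degeneracy l * S.card := by
  classical
  set F : Finset (Finset ℕ) := (L.toFinset.filter fun a =>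
    (a.toFinset ∩ S).Nonempty ∧ ((a.countP fun z => 0 < key z : ℕ) : ℕ∞) ≤ l).image
      fun a => a.toFinset ∩ S with hF
  have hFcard : F.card ≤ G.degeneracy l * S.card := by
    have h1 := (isDegenerate_degeneracy h.finite l).encard_inducedTrimmed_le S
      (by rw [h.vertexSet_eq]; intro x hx; exact hSn x hx)
    have h2 : (fun f : Finset ℕ => (f : Set ℕ)) '' (F : Set (Finset ℕ)) ⊆
        E(G.inducedTrimmed l S) := by
      rintro _ ⟨f, hf, rfl⟩
      simp only [hF, Finset.coe_image, Set.mem_image, Finset.mem_coe, Finset.mem_filter,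
        List.mem_toFinset] at hf
      obtain ⟨a, ⟨haL, hne, hle⟩, rfl⟩ := hf
      refine ⟨by exact_mod_cast hne, _, h.mem_edgeSet haL, ?_, ?_⟩
      · have : {v | v ∈ a} \ (S : Set ℕ) =
            ((a.filter fun z => 0 < key z).toFinset : Set ℕ) := by
          ext v
          simp only [Set.mem_sdiff, Set.mem_ofPred_eq, Finset.mem_coe, List.coe_toFinset,
            List.mem_filter, decide_eq_true_eq]
          refine and_congr_right fun hv => ?_
          rw [hS v (h.lt_of_mem a haL v hv)]
          omega
        rw [this, Set.encard_coe_eq_coe_finsetCard,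
          List.toFinset_card_of_nodup ((h.edge_nodup a haL).filter _), ← List.countP_eq_length_filter]
        exact hle
      · ext v
        simp
    have h3 := (Set.encard_le_encard h2).trans h1
    rw [(Finset.coe_injective.injOn).encard_image, Set.encard_coe_eq_coe_finsetCard] at h3
    exact_mod_cast h3
  have hsub : S.sigma (fun v => closeSet key l L n v) ⊆
      (F.biUnion fun f => f ×ˢ f).image fun p => (⟨p.1, p.2⟩ : Σ _ : ℕ, ℕ) := by
    rintro ⟨v, y⟩ hvy
    simp only [Finset.mem_sigma, mem_closeSet h.lt_of_mem] at hvy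
    obtain ⟨hv, a, ha, hva, hya, hk, hle⟩ := hvy
    have hv0 : key v = 0 := (hS v (hSn v hv)).1 hv
    rw [hv0] at hk hle
    have hy : y ∈ S := (hS y (h.lt_of_mem a ha y hya)).2 (by omega)
    simp only [Finset.mem_image, Finset.mem_biUnion, Finset.mem_product]
    refine ⟨(v, y), ⟨a.toFinset ∩ S, ?_, by simp [hva, hv], by simp [hya, hy]⟩, rfl⟩
    simp only [hF, Finset.mem_image, Finset.mem_filter, List.mem_toFinset]
    exact ⟨a, ⟨ha, ⟨v, by simp [hva, hv]⟩, hle⟩, rfl⟩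
  calc ∑ v ∈ S, (closeSet key l L n v).card = (S.sigma fun v => closeSet key l L n v).card :=
        (Finset.card_sigma _ _).symm
    _ ≤ _ := Finset.card_le_card hsub
    _ ≤ (F.biUnion fun f => f ×ˢ f).card := Finset.card_image_le
    _ ≤ F.card * (r * r) := by
      refine Finset.card_biUnion_le_card_mul _ _ _ fun f hf => ?_
      simp only [hF, Finset.mem_image, Finset.mem_filter, List.mem_toFinset] at hf
      obtain ⟨a, ⟨haL, -⟩, rfl⟩ := hf
      have h1 : (a.toFinset ∩ S).card ≤ r :=
        (Finset.card_le_card Finset.inter_subset_left).trans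
          ((List.toFinset_card_le a).trans (hr a haL))
      rw [Finset.card_product]
      exact Nat.mul_le_mul h1 h1
    _ ≤ G.degeneracy l * S.card * (r * r) := Nat.mul_le_mul_right _ hFcard
    _ = _ := by ring

end ArrayMachine

/-! ### Peeling off vertices of small degree -/

namespace ArrayMachine

/-- Rule for a loop over `0, …, n - 1`. -/
theorem Wp.forRange {B T tb ri rx n : ℕ} {bound : Expr} {p : Stmt} {σ : State}
    {Q : State → Prop} (I : ℕ → State → Prop) (hn : n < B)
    (hri : ri ∉ p.regs) (hrx : ri ≠ rx)
    (hbound : ∀ τ, Agree (loopOver ri rx bound (.reg ri) p) σ τ →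
      bound.Ok B τ ∧ bound.eval τ = n)
    (hI : ∀ i v k τ, (i = ri ∨ i = rx) → I k τ → I k (τ.setReg i v))
    (h0 : I 0 σ)
    (hstep : ∀ k < n, ∀ τ, Agree (loopOver ri rx bound (.reg ri) p) σ τ →
      τ.reg rx = k → I k τ → Wp B p tb τ (I (k + 1)))
    (hT : n * (tb + (bound.cost + 17)) + (bound.cost + 17) ≤ T)
    (hQ : ∀ τ, Agree (loopOver ri rx bound (.reg ri) p) σ τ → I n τ → Q τ) :
    Wp B (loopOver ri rx bound (.reg ri) p) T σ Q := by
  have hx : ∀ done x rest, List.range n = done ++ x :: rest → x = done.length ∧ x < n := by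
    intro done x rest h
    have hl : done.length < n := by
      have := congrArg List.length h
      simp at this
      omega
    have h1 : (List.range n)[done.length]'(by simpa using hl) = x := by simp [h]
    rw [List.getElem_range] at h1
    omega
  refine Wp.forIn (tb := tb) (List.range n) (fun d => I d.length) (by simpa using hn) hri hrx
    (by simpa using hbound) ?_ (fun i v d τ h h' => hI i v _ τ h h') h0 ?_
    (by simpa [loopCost] using hT) (by simpa using hQ)
  · rintro done x rest τ h - hr -
    exact ⟨by simp, by simp [hr, (hx done x rest h).1]⟩
  · intro done x rest τ h hag hrx' hr hinv
    obtain ⟨h1, h2⟩ := hx done x rest h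
    subst h1
    simpa using hstep _ h2 τ hag hrx' hinv

/-- One round of the peeling. The vertices of key `0` whose degree is at most twice the average get
keys that are positive, but less than all keys given in earlier rounds. Register `15` is the number
of vertices of key `0`. -/
noncomputable def peelRound (l : ℕ∞) : Stmt :=
  .seq (.assign 14 (.const 0))
  (.seq (loopOver 8 13 (.reg 1) (.reg 8) (.ite (.arr 1 (.reg 13)) .skip
    (.assign 14 (.reg 14 + .arr 3 (slot (.reg 13))))))
  (.seq (.assign 16 (.const 0))
  (.seq (loopOver 8 13 (.reg 1) (.reg 8) (.ite (.arr 1 (.reg 13)) .skip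
    (.ite (.lt (.reg 14 + .reg 14) (.arr 3 (slot (.reg 13)) * .reg 15)) .skip
      (.seq (.store 1 (.reg 13) ((.reg 3 - .reg 4) * .reg 3 + .reg 13))
        (.assign 16 (.reg 16 + .const 1))))))
  (.seq (.assign 15 (.reg 15 - .reg 16))
  (.seq (.assign 4 (.reg 4 + .const 1)) (scan l))))))

/-- Computation of an approximate degeneracy ordering and of its tables of close vertices. -/
noncomputable def peel (l : ℕ∞) : Stmt :=
  .seq (.assign 4 (.const 1)) (.seq (.assign 15 (.reg 1))
    (.seq (scan l) (.while (.reg 15) (peelRound l))))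

@[simp] theorem regs_peelRound (l : ℕ∞) :
    (peelRound l).regs = {14, 16, 15, 4, 13, 5, 6, 7, 8, 10, 12, 9, 11} := by
  ext
  simp [peelRound]
  tauto

@[simp] theorem arrs_peelRound (l : ℕ∞) : (peelRound l).arrs = {1, 2, 4, 3} := by
  ext
  simp [peelRound]
  tauto

@[simp] theorem regs_peel (l : ℕ∞) :
    (peel l).regs = {14, 16, 15, 4, 13, 5, 6, 7, 8, 10, 12, 9, 11} := by
  ext
  simp [peel]
  tauto

@[simp] theorem arrs_peel (l : ℕ∞) : (peel l).arrs = {1, 2, 4, 3} := by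
  ext
  simp [peel]

/-- At the start of round `ρ`, the vertices of `S` remain. The removed vertices have distinct keys,
which are large enough for later keys to be less, and are close to at most `D` vertices. -/
structure Peeling (key : ℕ → ℕ) (l : ℕ∞) (L : List (List ℕ)) (n N ρ D : ℕ) (S : Finset ℕ) :
    Prop where
  lt : ∀ v ∈ S, v < n
  key_eq : ∀ v ∈ S, key v = 0
  le_key : ∀ v < n, v ∉ S → (N - ρ + 1) * N ≤ key v
  key_lt : ∀ v < n, key v < N * N
  inj : ∀ u < n, ∀ v < n, u ∉ S → v ∉ S → key u = key v → u = v
  few : ∀ v < n, v ∉ S → (closeSet key l L n v).card ≤ D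
  pos : 1 ≤ ρ
  round_le : ρ + S.card ≤ n + 1

/-- Removing more vertices, with keys less than all earlier ones, makes no vertex close to another one
that was not before, so the bounds for vertices removed earlier persist. -/
theorem Peeling.step {key : ℕ → ℕ} {l : ℕ∞} {L : List (List ℕ)} {n N ρ D : ℕ} {S T : Finset ℕ}
    (h : Peeling key l L n N ρ D S) (hL : ∀ a ∈ L, ∀ v ∈ a, v < n) (hT : T ⊆ S)
    (hne : T.Nonempty) (hn : n < N) (hρ : ρ < N)
    (hD : ∀ v ∈ T, (closeSet key l L n v).card ≤ D) :
    Peeling (fun v => if v ∈ T then (N - ρ) * N + v else key v) l L n N (ρ + 1) D (S \ T) := by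
  have hpos := h.pos
  have e : N - (ρ + 1) + 1 = N - ρ := by omega
  have old : ∀ v < n, v ∉ S → ∀ u < n, (N - ρ) * N + u < key v := by
    intro v hv hvS u hu
    have := h.le_key v hv hvS
    rw [add_mul] at this
    omega
  have hmono : ∀ v < n, v ∉ S \ T →
      closeSet (fun v => if v ∈ T then (N - ρ) * N + v else key v) l L n v ⊆
        closeSet key l L n v := by
    intro v hv hvS y
    rw [mem_closeSet hL, mem_closeSet hL]
    rintro ⟨a, ha, hva, hya, hk, hle⟩
    -- a vertex that precedes `v` for the old keys does so for the new ones
    have hz : ∀ z < n, key v < key z →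
        (if v ∈ T then (N - ρ) * N + v else key v) < if z ∈ T then (N - ρ) * N + z else key z := by
      intro z hz hlt
      have hzS : z ∉ S := fun hzS => by
        rw [h.key_eq z hzS] at hlt
        omega
      rw [if_neg fun hzT => hzS (hT hzT)]
      split_ifs with hvT
      · exact old z hz hzS v hv
      · exact hlt
    refine ⟨a, ha, hva, hya, fun hlt => hk (hz y (hL a ha y hya) hlt), le_trans ?_ hle⟩
    have := List.countP_mono_left (l := a) (p := fun z => decide (key v < key z))
      (q := fun z => decide ((if v ∈ T then (N - ρ) * N + v else key v) <
        if z ∈ T then (N - ρ) * N + z else key z)) (fun z hza hlt => by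
          simp only [decide_eq_true_eq] at hlt ⊢
          exact hz z (hL a ha z hza) hlt)
    exact_mod_cast this
  have split : ∀ v, v ∉ S \ T → v ∈ T ∨ v ∉ S := by
    intro v hv
    simp only [Finset.mem_sdiff, not_and, not_not] at hv
    by_cases hvS : v ∈ S
    · exact Or.inl (hv hvS)
    · exact Or.inr hvS
  constructor
  · intro v hv
    exact h.lt v (Finset.sdiff_subset hv)
  · intro v hv
    rw [Finset.mem_sdiff] at hv
    simp only [hv.2, if_false]
    exact h.key_eq v hv.1
  · intro v hv hvS
    rw [e]
    split_ifs with hvT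
    · omega
    · exact (le_of_lt (lt_of_le_of_lt (Nat.le_add_right _ _)
        (old v hv ((split v hvS).resolve_left hvT) v hv)))
  · intro v hv
    split_ifs with hvT
    · have : (N - ρ + 1) * N ≤ N * N := Nat.mul_le_mul_right _ (by omega)
      rw [add_mul] at this
      omega
    · exact h.key_lt v hv
  · intro u hu v hv huS hvS
    split_ifs with huT hvT hvT
    · omega
    · intro heq
      have := old v hv ((split v hvS).resolve_left hvT) u hu
      omega
    · intro heq
      have := old u hu ((split u huS).resolve_left huT) v hv
      omega
    · exact h.inj u hu v hv ((split u huS).resolve_left huT) ((split v hvS).resolve_left hvT)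
  · intro v hv hvS
    refine (Finset.card_le_card (hmono v hv hvS)).trans ?_
    rcases split v hvS with hvT | hvS'
    · exact hD v hvT
    · exact h.few v hv hvS'
  · omega
  · have h1 := Finset.card_sdiff_add_card_eq_card hT
    have h2 := hne.card_pos
    have h3 := h.round_le
    omega

/-- Markov's inequality: at most half of the terms exceed twice the average. -/
theorem two_mul_card_filter_le (S : Finset ℕ) (f : ℕ → ℕ) :
    2 * (S.filter fun v => ∑ u ∈ S, f u + ∑ u ∈ S, f u < f v * S.card).card ≤ S.card := by
  set s := ∑ u ∈ S, f u with hs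
  set b := S.filter fun v => s + s < f v * S.card with hb
  have h1 : b.card * (s + s + 1) ≤ s * S.card := by
    calc b.card * (s + s + 1) = ∑ v ∈ b, (s + s + 1) := by simp
      _ ≤ ∑ v ∈ b, f v * S.card := Finset.sum_le_sum fun v hv => by
        rw [hb, Finset.mem_filter] at hv
        exact hv.2
      _ ≤ ∑ v ∈ S, f v * S.card := Finset.sum_le_sum_of_subset (Finset.filter_subset _ _)
      _ = s * S.card := by rw [Finset.sum_mul]
  rcases Nat.eq_zero_or_pos s with h0 | hpos
  · rw [h0] at h1
    omega
  · have h2 : (2 * b.card) * s ≤ S.card * s := by nlinarith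
    exact Nat.le_of_mul_le_mul_right h2 hpos

/-- The invariant of the peeling. -/
structure PeelState (B : ℕ) (l : ℕ∞) (L : List (List ℕ)) (n N ρ D : ℕ) (S : Finset ℕ)
    (τ : State) : Prop where
  layout : Layout B n N ρ τ
  table : HasTable n N ρ (Close (τ.arr 1) l L) τ
  peeling : Peeling (τ.arr 1) l L n N ρ D S
  alive : τ.reg 15 = S.card
  vertices : τ.reg 1 = n
  edges : τ.reg 2 = L.length
  input : ∀ i, τ.arr 0 i = (Hypergraph.encode n L).getD i 0

theorem HasTable.deg_eq {n N ρ : ℕ} {key : ℕ → ℕ} {l : ℕ∞} {L : List (List ℕ)} {τ : State}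
    (h : HasTable n N ρ (Close key l L) τ) (hL : ∀ a ∈ L, ∀ v ∈ a, v < n) {x : ℕ} (hx : x < N) :
    τ.arr 3 (ρ * N + x) = (closeSet key l L n x).card := by
  obtain ⟨⟨nbr, ht⟩, -⟩ := h
  rw [ht.deg x hx, ← List.toFinset_card_of_nodup (ht.nodup x)]
  congr 1
  ext y
  rw [List.mem_toFinset, ht.mem, mem_closeSet hL]

theorem card_closeSet_le {key : ℕ → ℕ} {l : ℕ∞} {L : List (List ℕ)} {n x : ℕ} :
    (closeSet key l L n x).card ≤ n := by
  classical
  refine (Finset.card_le_card (Finset.filter_subset _ _)).trans ?_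
  simp

set_option maxHeartbeats 1000000 in
/-- A round removes at least half of the vertices, as at most half of them exceed twice the average
degree, and it removes all vertices that are in no hyperedge, as their degree is zero. -/
theorem Wp.peelRound {G : Hypergraph ℕ} {B n N ρ r : ℕ} {l : ℕ∞} {L : List (List ℕ)}
    {S : Finset ℕ} {σ : State} (hG : G.IsListing n L) (hr : ∀ a ∈ L, a.length ≤ r)
    (hB : (Hypergraph.encode n L).length + 1 < B) (hN : n + 1 < N)
    (h : PeelState B l L n N ρ (2 * (r * r * G.degeneracy l)) S σ) (hS : S.Nonempty) :
    Wp B (peelRound l) (n * 128 + L.length * (r * (r * 220 + 140) + 80) + 110) σ fun τ =>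
      ∃ S', 2 * S'.card ≤ S.card ∧ S'.card ≤ r * L.length ∧
        PeelState B l L n N (ρ + 1) (2 * (r * r * G.degeneracy l)) S' τ := by
  set key := σ.arr 1 with hkey
  set c := fun v => (closeSet key l L n v).card with hc
  have hLn := hG.lt_of_mem
  have hbd := h.layout.bound
  have hρ := h.layout.round_lt
  have hcn : ∀ v, c v ≤ n := fun v => card_closeSet_le
  have hdeg : ∀ v < n, σ.arr 3 (ρ * N + v) = c v := fun v hv => h.table.deg_eq hLn (by omega)
  have hS0 : ∀ v < n, v ∈ S ↔ key v = 0 := by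
    intro v hv
    refine ⟨h.peeling.key_eq v, fun h0 => ?_⟩
    by_contra hvS
    have h1 := h.peeling.le_key v hv hvS
    have h2 : 1 * N ≤ (N - ρ + 1) * N := Nat.mul_le_mul_right _ (by omega)
    rw [hkey] at h0
    omega
  have hScard : S.card ≤ n := by
    have := h.peeling.round_le
    have := h.peeling.pos
    omega
  have hn1 : 1 ≤ n := by
    have := hS.card_pos
    omega
  have hB1 : N * N + N * N < B := by nlinarith
  have hρN : ρ * N + N ≤ N * N := by nlinarith
  set s := ∑ v ∈ S, c v with hs
  have hsn : s ≤ n * n := by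
    calc s ≤ ∑ v ∈ S, n := Finset.sum_le_sum fun v _ => hcn v
      _ = S.card * n := by simp
      _ ≤ n * n := Nat.mul_le_mul_right _ hScard
  have hNN : N ≤ N * N := Nat.le_mul_self N
  have hnN : n * n ≤ N * N := Nat.mul_le_mul (by omega) (by omega)
  set T := S.filter fun v => ¬ s + s < c v * S.card with hT
  have hTS : T ⊆ S := Finset.filter_subset _ _
  have hbad : S \ T = S.filter fun v => s + s < c v * S.card := by
    rw [hT, Finset.filter_not, Finset.sdiff_sdiff_eq_self (Finset.filter_subset _ _)]
  have hhalf : 2 * (S \ T).card ≤ S.card := by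
    rw [hbad]
    exact two_mul_card_filter_le S c
  refine Wp.seq (T₁ := 3) (T₂ := n * 128 + L.length * (r * (r * 220 + 140) + 80) + 107)
    (R := fun τ => τ = σ.setReg 14 0) (Wp.assign (by simp) le_rfl rfl) ?_ (by omega)
  rintro τ₀ - rfl
  refine Wp.seq (T₁ := n * 49 + 19)
    (T₂ := n * 79 + L.length * (r * (r * 220 + 140) + 80) + 88)
    (R := fun τ => τ.reg 14 = s) ?_ ?_ (by omega)
  · refine Wp.forRange (tb := 30) (n := n) (fun k τ => τ.reg 14 = ∑ v ∈ S.filter (· < k), c v)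
      (by omega) (by simp) (by norm_num) ?_ ?_ (by simp) ?_ (by simp) ?_
    · intro τ hag
      refine ⟨by simp, ?_⟩
      have := hag.reg 1 (by simp)
      simpa [h.vertices] using this
    · rintro i v k τ (rfl | rfl) h <;> simpa using h
    · intro k hk τ hag hx hinv
      have e1 : τ.arr 1 = key := hag.arr 1 (by simp)
      have e3 : τ.arr 3 = σ.arr 3 := hag.arr 3 (by simp)
      have hl : Layout B n N ρ τ := (h.layout.setReg (by norm_num) (by norm_num)).agree hag
        (by simp) (by simp)
      have hsplit : S.filter (· < k + 1) = if k ∈ S then insert k (S.filter (· < k))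
          else S.filter (· < k) := by
        ext v
        split_ifs with hkS
        · simp only [Finset.mem_filter, Finset.mem_insert]
          constructor
          · rintro ⟨h1, h2⟩
            by_cases hvk : v = k
            · exact Or.inl hvk
            · exact Or.inr ⟨h1, by omega⟩
          · rintro (rfl | ⟨h1, h2⟩)
            · exact ⟨hkS, by omega⟩
            · exact ⟨h1, by omega⟩
        · simp only [Finset.mem_filter]
          refine and_congr_right fun h1 => ?_
          have : v ≠ k := fun hvk => hkS (hvk ▸ h1)
          omega
      have hle : ∑ v ∈ S.filter (· < k), c v ≤ s :=
        Finset.sum_le_sum_of_subset (Finset.filter_subset _ _)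
      refine Wp.ite (T := 17) (by simp) ?_ ?_ (by simp)
      · intro hne
        refine Wp.skip (by norm_num) ?_
        have hkS : k ∉ S := by
          rw [hS0 k hk]
          simpa [hx, e1] using hne
        rw [hsplit, if_neg hkS, hinv]
      · intro h0
        have hkS : k ∈ S := by
          rw [hS0 k hk]
          simpa [hx, e1] using h0
        have hck := hcn k
        refine Wp.assign ?_ (by simp [slot]) ?_
        · simp only [slot, Expr.ok_add, Expr.ok_reg, Expr.ok_arr, Expr.ok_mul, Expr.eval_mul,
            Expr.eval_reg, Expr.eval_add, Expr.eval_arr, true_and, hl.base, hl.round, hx, e3,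
            hdeg k hk, hinv]
          refine ⟨⟨by omega, by omega⟩, by omega⟩
        · rw [hsplit, if_pos hkS, Finset.sum_insert (by simp)]
          simp [slot, hl.base, hl.round, hx, e3, hdeg k hk, hinv, add_comm (c k)]
    · intro τ hag hinv
      rw [hinv, Finset.filter_true_of_mem h.peeling.lt]
  intro τ₁ ag₁ h14
  refine Wp.seq (T₁ := 3) (T₂ := n * 79 + L.length * (r * (r * 220 + 140) + 80) + 85)
    (R := fun τ => τ = τ₁.setReg 16 0) (Wp.assign (by simp) le_rfl rfl) ?_ (by omega)
  rintro τ₂ - rfl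
  have hl₁ : Layout B n N ρ τ₁ := (h.layout.setReg (by norm_num) (by norm_num)).agree ag₁
        (by simp) (by simp)
  have a1 : τ₁.arr 1 = key := ag₁.arr 1 (by simp)
  have a3 : τ₁.arr 3 = σ.arr 3 := ag₁.arr 3 (by simp)
  have r15 : τ₁.reg 15 = S.card := by
    have := ag₁.reg 15 (by simp)
    simpa [h.alive] using this
  set key' := fun v => if v ∈ T then (N - ρ) * N + v else key v with hkey'
  refine Wp.seq (T₁ := n * 79 + 19)
    (T₂ := L.length * (r * (r * 220 + 140) + 80) + 66)
    (R := fun τ => τ.arr 1 = key' ∧ τ.reg 16 = T.card) ?_ ?_ (by omega)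
  · refine Wp.forRange (tb := 60) (n := n) (fun k τ =>
        (τ.arr 1 = fun v => if v ∈ T ∧ v < k then (N - ρ) * N + v else key v) ∧
        τ.reg 16 = (T.filter (· < k)).card)
      (by omega) (by simp) (by norm_num) ?_ ?_ ?_ ?_ (by simp) ?_
    · intro τ hag
      refine ⟨by simp, ?_⟩
      have h1 := hag.reg 1 (by simp)
      have h2 := ag₁.reg 1 (by simp)
      simp only [Expr.eval_reg, h1, State.setReg_reg]
      simpa [h.vertices] using h2
    · rintro i v k τ (rfl | rfl) h <;> simpa using h
    · simp [a1]
    · rintro k hk τ hag hx ⟨hinv, hcnt⟩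
      have e3 : τ.arr 3 = σ.arr 3 := by rw [hag.arr 3 (by simp), State.setReg_arr, a3]
      have hl : Layout B n N ρ τ := (hl₁.setReg (by norm_num) (by norm_num)).agree hag
        (by simp) (by simp)
      have e15 : τ.reg 15 = S.card := by
        have := hag.reg 15 (by simp)
        simpa [r15] using this
      have e14 : τ.reg 14 = s := by
        have := hag.reg 14 (by simp)
        simpa [h14] using this
      have hkk : τ.arr 1 k = key k := by simp [hinv]
      have hnot : k ∉ T → ((τ.arr 1 = fun v => if v ∈ T ∧ v < k + 1 then (N - ρ) * N + v else key v) ∧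
          τ.reg 16 = (T.filter (· < k + 1)).card) := by
        intro hkT
        have hiff : ∀ v, v ∈ T ∧ v < k + 1 ↔ v ∈ T ∧ v < k := by
          refine fun v => and_congr_right fun h1 => ?_
          have : v ≠ k := fun hvk => hkT (hvk ▸ h1)
          omega
        refine ⟨by simp only [hinv, hiff], ?_⟩
        rw [hcnt, Finset.filter_congr (q := (· < k + 1)) fun v hv => ?_]
        have := hiff v
        tauto
      have hck := hcn k
      have hmul : c k * S.card ≤ n * n := Nat.mul_le_mul hck hScard
      have hNρ : (N - ρ) * N + N ≤ N * N := by
        have : (N - ρ + 1) * N ≤ N * N :=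
          Nat.mul_le_mul_right _ (by have := h.peeling.pos; omega)
        rwa [add_mul, one_mul] at this
      have hTn : (T.filter (· < k)).card ≤ n :=
        (Finset.card_le_card ((Finset.filter_subset _ _).trans hTS)).trans hScard
      refine Wp.ite (T := 50) (by simp) ?_ ?_ (by simp)
      · intro hne
        refine Wp.skip (by norm_num) (hnot fun hkT => ?_)
        have := (hS0 k hk).1 (hTS hkT)
        simp [hx, hkk, this] at hne
      · intro h0
        have hkS : k ∈ S := by
          rw [hS0 k hk]
          simpa [hx, hkk] using h0
        refine Wp.ite (T := 24) ?_ ?_ ?_ (by simp [slot])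
        · simp only [slot, Expr.ok_add, Expr.ok_reg, Expr.ok_arr, Expr.ok_mul, Expr.eval_mul,
            Expr.eval_reg, Expr.eval_add, Expr.eval_arr, true_and, hl.base, hl.round, hx, e3,
            hdeg k hk, Expr.ok_lt, e14, e15]
          refine ⟨by omega, ⟨by omega, by omega⟩, by omega⟩
        · intro hne
          refine Wp.skip (by norm_num) (hnot fun hkT => ?_)
          rw [hT, Finset.mem_filter] at hkT
          apply hne
          simp only [slot, Expr.eval_mul, Expr.eval_reg, Expr.eval_add, Expr.eval_arr, hl.base,
            hl.round, hx, e3, hdeg k hk, e14, e15, Expr.eval_lt]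
          exact if_neg hkT.2
        · intro h0
          have hkT : k ∈ T := by
            rw [hT, Finset.mem_filter]
            refine ⟨hkS, fun hlt => ?_⟩
            simp only [slot, Expr.eval_mul, Expr.eval_reg, Expr.eval_add, Expr.eval_arr, hl.base,
              hl.round, hx, e3, hdeg k hk, e14, e15, Expr.eval_lt] at h0
            rw [if_pos hlt] at h0
            omega
          refine Wp.seq (T₁ := 17) (T₂ := 7)
            (R := fun τ' => τ' = τ.setArr 1 k ((N - ρ) * N + k)) (Wp.store (by simp) ?_
              (by simp) ?_) ?_ le_rfl
          · simp only [Expr.ok_add, Expr.ok_reg, Expr.ok_mul, Expr.ok_sub, Expr.eval_mul,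
              Expr.eval_reg, Expr.eval_sub, true_and, hl.base, hl.round, hx]
            exact ⟨by omega, by omega⟩
          · simp [hl.base, hl.round, hx]
          · rintro τ' - rfl
            refine Wp.assign ?_ (by simp) ⟨?_, ?_⟩
            · simp only [Expr.ok_add, Expr.ok_reg, Expr.ok_const, Expr.eval_reg, Expr.eval_const,
                true_and, State.setArr_reg, hcnt]
              omega
            · ext v
              simp only [State.setReg_arr, State.setArr_arr, if_true, hinv, Function.update_apply]
              by_cases hvk : v = k
              · subst hvk
                simp [hkT]
              · have : v < k + 1 ↔ v < k := by omega
                simp [hvk, this]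
            · simp only [State.setReg_reg, if_true, Expr.eval_add, Expr.eval_reg, State.setArr_reg,
                hcnt, Expr.eval_const]
              have : T.filter (· < k + 1) = insert k (T.filter (· < k)) := by
                ext v
                simp only [Finset.mem_filter, Finset.mem_insert]
                constructor
                · rintro ⟨h1, h2⟩
                  by_cases hvk : v = k
                  · exact Or.inl hvk
                  · exact Or.inr ⟨h1, by omega⟩
                · rintro (rfl | ⟨h1, h2⟩)
                  · exact ⟨hkT, by omega⟩
                  · exact ⟨h1, by omega⟩
              rw [this, Finset.card_insert_of_notMem (by simp)]
    · rintro τ hag ⟨h1, h2⟩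
      have hTn : ∀ v ∈ T, v < n := fun v hv => h.peeling.lt v (hTS hv)
      refine ⟨?_, ?_⟩
      · rw [h1]
        ext v
        have : v ∈ T ∧ v < n ↔ v ∈ T := and_iff_left_of_imp (hTn v)
        simp only [this, hkey']
      · rw [h2, Finset.filter_true_of_mem hTn]
  rintro τ₃ ag₃ ⟨b1, b16⟩
  have hcard := Finset.card_sdiff_add_card_eq_card hTS
  have hSpos := hS.card_pos
  have hTne : T.Nonempty := by
    rw [← Finset.card_pos]
    omega
  have hl₃ : Layout B n N ρ τ₃ := (hl₁.setReg (by norm_num) (by norm_num)).agree ag₃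
        (by simp) (by simp)
  have c15 : τ₃.reg 15 = S.card := by
    have := ag₃.reg 15 (by simp)
    simpa [r15] using this
  have hρ1 : ρ + 1 < N := by
    have := h.peeling.round_le
    omega
  refine Wp.seq (T₁ := 7) (T₂ := L.length * (r * (r * 220 + 140) + 80) + 50)
    (R := fun τ => τ = τ₃.setReg 15 (S \ T).card) (Wp.assign (by simp) (by simp) ?_) ?_ (by omega)
  · simp only [Expr.eval_sub, Expr.eval_reg, c15, b16]
    congr 1
    omega
  rintro τ₄ - rfl
  refine Wp.seq (T₁ := 6) (T₂ := L.length * (r * (r * 220 + 140) + 80) + 40)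
    (R := fun τ => τ = (τ₃.setReg 15 (S \ T).card).setReg 4 (ρ + 1)) (Wp.assign ?_ (by simp) ?_)
    ?_ (by omega)
  · simp only [Expr.ok_add, Expr.ok_reg, Expr.ok_const, Expr.eval_reg, Expr.eval_const,
      true_and, State.setReg_reg]
    norm_num
    rw [hl₃.round]
    omega
  · simp [hl₃.round]
  rintro τ₅ - rfl
  set τ₅ := (τ₃.setReg 15 (S \ T).card).setReg 4 (ρ + 1) with hτ₅
  have d2 : τ₅.reg 2 = L.length := by
    have h1 := ag₃.reg 2 (by simp)
    have h2 := ag₁.reg 2 (by simp)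
    simp only [State.setReg_reg] at h1 h2
    simp only [hτ₅, State.setReg_reg]
    simpa [h1, h2] using h.edges
  have d1 : τ₅.reg 1 = n := by
    have h1 := ag₃.reg 1 (by simp)
    have h2 := ag₁.reg 1 (by simp)
    simp only [State.setReg_reg] at h1 h2
    simp only [hτ₅, State.setReg_reg]
    simpa [h1, h2] using h.vertices
  have dk : ∀ k, k ≠ 1 → τ₅.arr k = σ.arr k := by
    intro k hk
    have h1 := ag₃.arr k (by simp [hk])
    have h2 := ag₁.arr k (by simp)
    simp only [State.setReg_arr] at h1 h2
    simp only [hτ₅, State.setReg_arr, h1, h2]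
  have hl₅ : Layout B n N (ρ + 1) τ₅ := ⟨by simp [hτ₅, hl₃.base], by simp [hτ₅], h.layout.lt, hρ1, hbd⟩
  have hfresh : Fresh N (ρ + 1) τ₅ := by
    obtain ⟨⟨nbr, ht⟩, -⟩ := h.table
    have := ht.fresh
    exact ⟨by rw [dk 3 (by norm_num)]; exact this.deg, by rw [dk 2 (by norm_num)]; exact this.mark⟩
  have hin : ∀ i, τ₅.arr 0 i = (Hypergraph.encode n L).getD i 0 := by
    rw [dk 0 (by norm_num)]
    exact h.input
  refine (Wp.scan (l := l) hl₅ hfresh hin d2 hB hLn hr).mono le_rfl fun τ hag ht => ?_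
  have f1 : τ.arr 1 = τ₅.arr 1 := hag.arr 1 (by simp)
  have g1 : τ₅.arr 1 = key' := by simp [hτ₅, b1]
  refine ⟨S \ T, hhalf, ?_, ?_⟩
  · -- a remaining vertex has positive degree, so it is in some hyperedge
    have hsub : S \ T ⊆ L.toFinset.biUnion List.toFinset := by
      rw [hbad]
      intro v hv
      rw [Finset.mem_filter] at hv
      have hpos : 0 < c v := by
        by_contra h0
        have : c v = 0 := by omega
        rw [this] at hv
        omega
      obtain ⟨y, hy⟩ := Finset.card_pos.1 hpos
      rw [mem_closeSet hLn] at hy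
      obtain ⟨a, ha, hva, -⟩ := hy
      simp only [Finset.mem_biUnion, List.mem_toFinset]
      exact ⟨a, ha, hva⟩
    calc (S \ T).card ≤ _ := Finset.card_le_card hsub
      _ ≤ L.toFinset.card * r := Finset.card_biUnion_le_card_mul _ _ _ fun a ha =>
          (List.toFinset_card_le a).trans (hr a (List.mem_toFinset.1 ha))
      _ ≤ L.length * r := Nat.mul_le_mul_right _ (List.toFinset_card_le L)
      _ = _ := mul_comm _ _
  · refine ⟨hl₅.agree hag (by simp) (by simp), by rwa [f1], ?_, ?_, ?_, ?_, ?_⟩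
    · rw [f1, g1]
      refine h.peeling.step hLn hTS hTne h.layout.lt hρ fun v hv => ?_
      rw [hT, Finset.mem_filter] at hv
      have h1 := sum_card_closeSet_le hG hr l hS0 h.peeling.lt
      have h2 : c v * S.card ≤ (2 * (r * r * G.degeneracy l)) * S.card := by
        calc c v * S.card ≤ s + s := by omega
          _ ≤ _ := add_le_add h1 h1
          _ = _ := by ring
      exact Nat.le_of_mul_le_mul_right h2 hSpos
    · rw [hag.reg 15 (by simp)]
      simp [hτ₅]
    · rw [hag.reg 1 (by simp), d1]
    · rw [hag.reg 2 (by simp), d2]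
    · rw [hag.arr 0 (by simp)]
      exact hin

/-- Specification of the peeling. The number of rounds is logarithmic in the number of vertices that
remain after the first round, hence in the number of hyperedges. -/
theorem Wp.peel {G : Hypergraph ℕ} {B n N r : ℕ} {l : ℕ∞} {L : List (List ℕ)} {σ : State}
    (hG : G.IsListing n L) (hr : ∀ a ∈ L, a.length ≤ r)
    (hB : (Hypergraph.encode n L).length + 1 < B) (hN : n + 1 < N) (hNB : N * N * N < B)
    (h1 : σ.reg 1 = n) (h2 : σ.reg 2 = L.length) (h3 : σ.reg 3 = N)
    (hin : ∀ i, σ.arr 0 i = (Hypergraph.encode n L).getD i 0)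
    (hz : ∀ k, 1 ≤ k → σ.arr k = fun _ => 0) :
    Wp B (peel l) ((r + Nat.log 2 L.length + 3) *
      (n * 128 + L.length * (r * (r * 220 + 140) + 80) + 120)) σ fun τ =>
      ∃ ρ, PeelState B l L n N ρ (2 * (r * r * G.degeneracy l)) ∅ τ := by
  set m := L.length with hm
  set X := n * 128 + m * (r * (r * 220 + 140) + 80) + 110 with hX
  have loop : ∀ j S ρ σ, (S.card < 2 ^ j ∨ ∃ i, j = i + 1 ∧ r * m < 2 ^ i) →
      PeelState B l L n N ρ (2 * (r * r * G.degeneracy l)) S σ →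
      Wp B (.while (.reg 15) (ArrayMachine.peelRound l)) (j * (X + 3) + 3) σ fun τ =>
        ∃ ρ, PeelState B l L n N ρ (2 * (r * r * G.degeneracy l)) ∅ τ := by
    intro j
    induction j with
    | zero =>
      intro S ρ σ hS h
      have hS0 : S = ∅ := by
        rcases hS with hS | ⟨i, hi, -⟩
        · rw [← Finset.card_eq_zero]
          simpa using hS
        · omega
      subst hS0
      exact Wp.while_done (by simp) (by simp [h.alive]) (by simp) ⟨ρ, h⟩
    | succ j ih =>
      intro S ρ σ hS h
      rcases S.eq_empty_or_nonempty with rfl | hne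
      · exact Wp.while_done (by simp) (by simp [h.alive]) (by simp) ⟨ρ, h⟩
      · refine Wp.while_step (by simp) (by simp [h.alive, hne.ne_empty])
          (Wp.peelRound hG hr hB hN h hne) ?_ (T₂ := j * (X + 3) + 3)
          (by
            rw [Expr.cost_reg, add_mul, one_mul]
            change 2 + (X + (j * (X + 3) + 3) + 1) ≤ _
            omega)
        rintro τ - ⟨S', hS', hS'm, h'⟩
        refine ih S' _ τ (Or.inl ?_) h'
        rcases hS with hS | ⟨i, hi, him⟩
        · rw [pow_succ] at hS
          omega
        · have : i = j := by omega
          subst this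
          exact lt_of_le_of_lt hS'm him
  have hz' : ∀ k, 1 ≤ k → ∀ o, σ.arr k o = 0 := fun k hk o => by rw [hz k hk]
  refine Wp.seq (T₁ := 3) (T₂ := 4 + (m * (r * (r * 220 + 140) + 80) + 40 +
    ((r + Nat.log 2 m + 2) * (X + 3) + 3))) (R := fun τ => τ = σ.setReg 4 1)
    (Wp.assign (by simp) le_rfl rfl) ?_ ?_
  · rintro τ₁ - rfl
    refine Wp.seq (T₁ := 4) (T₂ := m * (r * (r * 220 + 140) + 80) + 40 +
      ((r + Nat.log 2 m + 2) * (X + 3) + 3)) (R := fun τ => τ = (σ.setReg 4 1).setReg 15 n)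
      (Wp.assign (by simp) (by simp) (by simp [h1])) ?_ le_rfl
    rintro τ₂ - rfl
    have hl : Layout B n N 1 ((σ.setReg 4 1).setReg 15 n) :=
      ⟨by simp [h3], by simp, by omega, by omega, hNB⟩
    refine Wp.seq (Wp.scan (l := l) (r := r) hl
      ⟨fun o _ => by simp [hz'], fun o _ => by simp [hz']⟩ (by simpa using hin) (by simp [h2, hm]) hB
      hG.lt_of_mem hr) (T₂ := (r + Nat.log 2 m + 2) * (X + 3) + 3) ?_ le_rfl
    intro τ hag ht
    have e1 : τ.arr 1 = fun _ => 0 := by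
      rw [hag.arr 1 (by simp)]
      simp [hz]
    refine loop _ (Finset.range n) 1 τ (Or.inr ⟨r + Nat.log 2 m + 1, by ring, ?_⟩) ?_
    · rcases Nat.eq_zero_or_pos r with rfl | hr0
      · simp
      · have a1 := Nat.lt_two_pow_self (n := r)
        have a2 := Nat.lt_pow_succ_log_self (b := 2) one_lt_two m
        calc r * m ≤ r * 2 ^ (Nat.log 2 m + 1) := Nat.mul_le_mul_left _ a2.le
          _ < 2 ^ r * 2 ^ (Nat.log 2 m + 1) := by gcongr
          _ = _ := by ring
    · refine ⟨hl.agree hag (by simp) (by simp), ?_, ?_, ?_, ?_, ?_, ?_⟩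
      · rwa [e1, show (fun _ => 0) = ((σ.setReg 4 1).setReg 15 n).arr 1 by simp [hz]]
      · rw [e1]
        refine ⟨by simp, by simp, fun v hv hv' => absurd (by simpa using hv) hv', ?_,
          fun u hu v hv hu' => absurd (by simpa using hu) hu',
          fun v hv hv' => absurd (by simpa using hv) hv', le_rfl, by simp; omega⟩
        intro v _
        have : 0 < N := by omega
        positivity
      · rw [hag.reg 15 (by simp)]
        simp
      · rw [hag.reg 1 (by simp)]
        simp [h1]
      · rw [hag.reg 2 (by simp)]
        simp [h2, hm]
      · rw [hag.arr 0 (by simp)]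
        simpa using hin
  · have e : n * 128 + m * (r * (r * 220 + 140) + 80) + 120 = X + 10 := by omega
    rw [e]
    have e2 : m * (r * (r * 220 + 140) + 80) ≤ X := by omega
    have : (r + Nat.log 2 m + 3) * (X + 10) = (r + Nat.log 2 m + 2) * (X + 3) +
      7 * (r + Nat.log 2 m + 2) + (X + 10) := by ring
    omega

end ArrayMachine

/-! ### Nested loops over assignments -/

namespace ArrayMachine

variable {V : Type*}

/-- The register that holds the value assigned to `v`, where `ix` numbers the elements of `V`. -/
def vreg (ix : V → ℕ) (v : V) : ℕ := 100 + 2 * ix v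

/-- The register that holds the loop index for `v`. -/
def ireg (ix : V → ℕ) (v : V) : ℕ := 101 + 2 * ix v

/-- A level of nested loops, which assigns values to `v`: those of `val` for the first `bound`
values of the loop index. -/
structure Level (V : Type*) where
  v : V
  /-- The element of `V` on whose value the values for `v` depend, if there is one. -/
  src : Option V
  bound : Expr
  val : Expr

/-- Nested loops with innermost statement `b`. -/
def nest (ix : V → ℕ) : List (Level V) → Stmt → Stmt
  | [], b => b
  | lv :: ls, b => loopOver (ireg ix lv.v) (vreg ix lv.v) lv.bound lv.val (nest ix ls b)

theorem vreg_ne_ireg (ix : V → ℕ) (u v : V) : vreg ix u ≠ ireg ix v := by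
  unfold vreg ireg
  omega

theorem vreg_inj {ix : V → ℕ} (hix : ix.Injective) {u v : V} : vreg ix u = vreg ix v ↔ u = v := by
  unfold vreg
  exact ⟨fun h => hix (by omega), fun h => by rw [h]⟩

theorem ireg_inj {ix : V → ℕ} (hix : ix.Injective) {u v : V} : ireg ix u = ireg ix v ↔ u = v := by
  unfold ireg
  exact ⟨fun h => hix (by omega), fun h => by rw [h]⟩

theorem mem_regs_nest {ix : V → ℕ} {ls : List (Level V)} {b : Stmt} (hb : b.regs = ∅) {i : ℕ} :
    i ∈ (nest ix ls b).regs ↔ ∃ lv ∈ ls, i = vreg ix lv.v ∨ i = ireg ix lv.v := by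
  induction ls with
  | nil => simp [nest, hb]
  | cons lv ls ih =>
    simp only [nest, regs_loopOver, Set.mem_insert_iff, ih, List.mem_cons, exists_eq_or_imp]
    rw [← or_assoc, or_comm (a := i = ireg ix lv.v)]

theorem le_of_mem_regs_nest {ix : V → ℕ} {ls : List (Level V)} {b : Stmt} (hb : b.regs = ∅)
    {i : ℕ} (hi : i ∈ (nest ix ls b).regs) : 100 ≤ i := by
  obtain ⟨lv, -, rfl | rfl⟩ := (mem_regs_nest hb).1 hi
  · unfold vreg
    omega
  · unfold ireg
    omega

@[simp] theorem arrs_nest (ix : V → ℕ) (ls : List (Level V)) (b : Stmt) :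
    (nest ix ls b).arrs = b.arrs := by
  induction ls with
  | nil => rfl
  | cons lv ls ih => simp [nest, ih]

/-- The assignments visited by nested loops, in order, where `c lv f` lists the values visited at
the level `lv` when the outer levels have assigned the values of `f`. -/
def enum [DecidableEq V] (c : Level V → (V → ℕ) → List ℕ) : List (Level V) → (V → ℕ) → List (V → ℕ)
  | [], f => [f]
  | lv :: ls, f => (c lv f).flatMap fun x => enum c ls (Function.update f lv.v x)

/-- The bound and the values of each level evaluate to the list given by `c`, in all states with
the property `P` in which the elements of `ds` and of the outer levels have been assigned values
less than `n`. The length of the list for the level `lv` is at most `β lv`. -/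
def LevelsOk (B n : ℕ) (ix : V → ℕ) (P : State → Prop) (c : Level V → (V → ℕ) → List ℕ)
    (β : Level V → ℕ) : List V → List (Level V) → Prop
  | _, [] => True
  | ds, lv :: ls => (∀ τ f, P τ → (∀ u ∈ ds, τ.reg (vreg ix u) = f u ∧ f u < n) →
      lv.bound.Ok B τ ∧ lv.bound.eval τ = (c lv f).length ∧ (c lv f).length < B ∧
      (c lv f).length ≤ β lv ∧ (∀ x ∈ c lv f, x < n) ∧
      ∀ i (h : i < (c lv f).length), τ.reg (ireg ix lv.v) = i →
        lv.val.Ok B τ ∧ lv.val.eval τ = (c lv f)[i]) ∧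
    LevelsOk B n ix P c β (lv.v :: ds) ls

/-- Running time of nested loops whose body takes `tb` steps. -/
def nestTime (β : Level V → ℕ) (tb : ℕ) : List (Level V) → ℕ
  | [] => tb
  | lv :: ls => β lv * (nestTime β tb ls + loopCost lv.bound lv.val) + loopCost lv.bound lv.val

theorem nestTime_le (β : Level V → ℕ) (tb : ℕ) (ls : List (Level V)) :
    nestTime β tb ls ≤ (ls.map fun lv => β lv + 1).prod *
      (tb + (ls.map fun lv => loopCost lv.bound lv.val).sum) := by
  induction ls with
  | nil => simp [nestTime]
  | cons lv ls ih =>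
    simp only [nestTime, List.map_cons, List.prod_cons, List.sum_cons]
    set P := (ls.map fun lv => β lv + 1).prod with hP
    set S := (ls.map fun lv => loopCost lv.bound lv.val).sum
    set k := loopCost lv.bound lv.val
    have hP1 : 1 ≤ P := by
      rw [hP, Nat.succ_le_iff]
      exact List.prod_pos (by simp)
    calc β lv * (nestTime β tb ls + k) + k ≤ β lv * (P * (tb + S) + k) + k := by gcongr
      _ = β lv * P * (tb + S) + (β lv + 1) * 1 * k := by ring
      _ ≤ (β lv + 1) * P * (tb + S) + (β lv + 1) * P * k := by
        gcongr
        omega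
      _ = _ := by ring

/-- Rule for nested loops, with an invariant that depends on the assignments visited so far. -/
theorem Wp.nest [DecidableEq V] {B n tb : ℕ} {ix : V → ℕ} (hix : ix.Injective) {b : Stmt} (hb : b.regs = ∅)
    {P : State → Prop} {c : Level V → (V → ℕ) → List ℕ} {β : Level V → ℕ}
    (I : List (V → ℕ) → (ℕ → ℕ → ℕ) → Prop) (ls : List (Level V)) (ds : List V)
    (hnd : (ds ++ ls.map Level.v).Nodup) (hls : LevelsOk B n ix P c β ds ls)
    (hP : ∀ τ τ', P τ → Agree (nest ix ls b) τ τ' → P τ')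
    (done : List (V → ℕ)) (f : V → ℕ) (σ : State) (hσ : P σ)
    (hstep : ∀ d g rest τ, done ++ enum c ls f = d ++ g :: rest → P τ →
      (∀ u ∈ ds ++ ls.map Level.v, τ.reg (vreg ix u) = g u ∧ g u < n) → I d τ.arr →
      Wp B b tb τ fun τ' => I (d ++ [g]) τ'.arr)
    (hf : ∀ u ∈ ds, σ.reg (vreg ix u) = f u ∧ f u < n) (h0 : I done σ.arr) :
    Wp B (nest ix ls b) (nestTime β tb ls) σ fun τ => I (done ++ enum c ls f) τ.arr := by
  induction ls generalizing ds done f σ with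
  | nil => exact hstep done f [] σ rfl hσ (by simpa using hf) h0
  | cons lv ls ih =>
    obtain ⟨h1, h2⟩ := hls
    obtain ⟨hbok, hbev, hlB, hlβ, hcn, hval⟩ := h1 σ f hσ hf
    have hnd' : ((lv.v :: ds) ++ ls.map Level.v).Nodup := by
      refine (List.Perm.nodup_iff ?_).1 hnd
      simp only [List.map_cons, List.cons_append]
      exact List.perm_middle
    have hvnd : lv.v ∉ ds ∧ lv.v ∉ ls.map Level.v := by
      simp only [List.cons_append, List.nodup_cons, List.mem_append, not_or] at hnd'
      exact hnd'.1
    have hkeep : ∀ τ, Agree (ArrayMachine.nest ix (lv :: ls) b) σ τ → P τ ∧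
        ∀ u ∈ ds, τ.reg (vreg ix u) = f u ∧ f u < n := by
      intro τ hag
      refine ⟨hP σ τ hσ hag, fun u hu => ⟨?_, (hf u hu).2⟩⟩
      rw [hag.reg, (hf u hu).1]
      rw [mem_regs_nest hb]
      rintro ⟨lw, hlw, h | h⟩
      · rw [vreg_inj hix] at h
        subst h
        exact (List.disjoint_of_nodup_append hnd) hu (List.mem_map_of_mem hlw)
      · exact vreg_ne_ireg _ _ _ h
    refine Wp.forIn (tb := nestTime β tb ls) (c lv f)
      (fun d τ => I (done ++ d.flatMap fun x => enum c ls (Function.update f lv.v x)) τ.arr)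
      hlB ?_ (vreg_ne_ireg _ _ _).symm ?_ ?_ (fun i v d τ _ h => h) (by simpa using h0) ?_ ?_
      (fun τ _ h => h)
    · rw [mem_regs_nest hb]
      rintro ⟨lw, hlw, h | h⟩
      · exact vreg_ne_ireg _ _ _ h.symm
      · rw [ireg_inj hix] at h
        exact hvnd.2 (h ▸ List.mem_map_of_mem hlw)
    · intro τ hag
      obtain ⟨a1, a2⟩ := hkeep τ hag
      exact ⟨(h1 τ f a1 a2).1, (h1 τ f a1 a2).2.1⟩
    · intro d x rest τ hd hag hr _
      obtain ⟨a1, a2⟩ := hkeep τ hag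
      have := (h1 τ f a1 a2).2.2.2.2.2 d.length (by simp [hd]) hr
      refine ⟨this.1, ?_⟩
      rw [this.2]
      simp [hd]
    · intro d x rest τ hd hag hx hr hinv
      obtain ⟨a1, a2⟩ := hkeep τ hag
      have hxn : x < n := hcn x (by simp [hd])
      have := ih (lv.v :: ds) hnd' h2 (fun τ τ' hτ hag' => hP τ τ' hτ (hag'.mono ?_ ?_))
        _ (Function.update f lv.v x) τ a1 ?_ ?_ hinv
      · refine this.mono le_rfl fun υ _ hυ => ?_
        simpa [List.flatMap_append, ← List.append_assoc] using hυ
      · intro i hi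
        simp only [ArrayMachine.nest, regs_loopOver]
        exact Or.inr (Or.inr hi)
      · simp
      · intro d' g rest' τ' hgx hτ' hg hinv'
        refine hstep d' g (rest' ++ rest.flatMap fun x => enum c ls (Function.update f lv.v x)) τ'
          ?_ hτ' (fun u hu => hg u ?_) hinv'
        · simp only [enum, hd, List.flatMap_append, List.flatMap_cons]
          rw [← List.append_assoc, ← List.append_assoc, hgx]
          simp
        simp only [List.map_cons, List.mem_append, List.mem_cons, List.cons_append] at hu ⊢
        tauto
      · intro u hu
        rw [List.mem_cons] at hu
        rcases hu with rfl | hu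
        · simpa using ⟨hx, hxn⟩
        · have : u ≠ lv.v := fun h => hvnd.1 (h ▸ hu)
          rw [Function.update_of_ne this]
          exact a2 u hu
    · simp only [nestTime]
      gcongr

/-! ### Codes of tuples -/

/-- The address of a tuple in a table: a positional code with base `N`, and with a leading `1` that
makes it injective for tuples of different lengths. -/
def tupleCode (N : ℕ) : List ℕ → ℕ
  | [] => 1
  | x :: xs => tupleCode N xs * N + x

theorem tupleCode_pos {N : ℕ} (hN : 0 < N) (xs : List ℕ) : 1 ≤ tupleCode N xs := by
  induction xs with
  | nil => exact le_rfl
  | cons x xs ih =>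
    have : 1 ≤ tupleCode N xs * N := Nat.mul_pos ih hN
    simp only [tupleCode]
    omega

theorem tupleCode_inj {N : ℕ} (hN : 2 ≤ N) {xs ys : List ℕ} (hx : ∀ x ∈ xs, x < N)
    (hy : ∀ y ∈ ys, y < N) (h : tupleCode N xs = tupleCode N ys) : xs = ys := by
  induction xs generalizing ys with
  | nil =>
    cases ys with
    | nil => rfl
    | cons y ys =>
      have : 1 * N ≤ tupleCode N ys * N := Nat.mul_le_mul_right _ (tupleCode_pos (by omega) ys)
      simp only [tupleCode] at h
      omega
  | cons x xs ih =>
    cases ys with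
    | nil =>
      have : 1 * N ≤ tupleCode N xs * N := Nat.mul_le_mul_right _ (tupleCode_pos (by omega) xs)
      simp only [tupleCode] at h
      omega
    | cons y ys =>
      obtain ⟨h1, h2⟩ := pair_inj (hx x (by simp)) (hy y (by simp)) h
      rw [ih (fun z hz => hx z (by simp [hz])) (fun z hz => hy z (by simp [hz])) h1, h2]

theorem tupleCode_lt {N : ℕ} (hN : 2 ≤ N) {xs : List ℕ} (hx : ∀ x ∈ xs, x < N) :
    tupleCode N xs < N ^ (xs.length + 1) := by
  have : tupleCode N xs + 1 ≤ 2 * N ^ xs.length := by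
    induction xs with
    | nil => simp [tupleCode]
    | cons x xs ih =>
      have h1 := ih fun z hz => hx z (by simp [hz])
      have h2 := hx x (by simp)
      have h3 := Nat.mul_le_mul_right N h1
      simp only [tupleCode, List.length_cons, pow_succ]
      rw [add_mul] at h3
      calc _ ≤ tupleCode N xs * N + 1 * N := by omega
        _ ≤ _ := h3
        _ = _ := by ring
  have h2 : 2 * N ^ xs.length ≤ N ^ (xs.length + 1) := by
    rw [pow_succ']
    gcongr
  omega

/-- Expression for the code of the values assigned to `us`. -/
def codeExpr (ix : V → ℕ) : List V → Expr
  | [] => .const 1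
  | u :: us => codeExpr ix us * .reg 3 + .reg (vreg ix u)

theorem eval_codeExpr {ix : V → ℕ} {us : List V} {N : ℕ} {f : V → ℕ} {τ : State}
    (h3 : τ.reg 3 = N) (hf : ∀ u ∈ us, τ.reg (vreg ix u) = f u) :
    (codeExpr ix us).eval τ = tupleCode N (us.map f) := by
  induction us with
  | nil => rfl
  | cons u us ih =>
    simp only [codeExpr, Expr.eval_add, Expr.eval_mul, Expr.eval_reg, h3,
      ih fun w hw => hf w (by simp [hw]), hf u (by simp), tupleCode, List.map_cons]

theorem ok_codeExpr {ix : V → ℕ} {us : List V} {B N : ℕ} {f : V → ℕ} {τ : State}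
    (h3 : τ.reg 3 = N) (hN : 2 ≤ N) (hf : ∀ u ∈ us, τ.reg (vreg ix u) = f u ∧ f u < N)
    (hB : N ^ (us.length + 1) ≤ B) : (codeExpr ix us).Ok B τ := by
  induction us with
  | nil => trivial
  | cons u us ih =>
    have h1 := tupleCode_lt hN (xs := (u :: us).map f) (by
      intro x hx
      obtain ⟨w, hw, rfl⟩ := List.mem_map.1 hx
      exact (hf w hw).2)
    rw [List.length_map] at h1
    have h2 := eval_codeExpr (ix := ix) h3 (us := us) fun w hw => (hf w (by simp [hw])).1
    simp only [List.map_cons, tupleCode] at h1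
    simp only [codeExpr, Expr.ok_add, Expr.ok_mul, Expr.ok_reg, Expr.eval_mul, Expr.eval_reg, h3,
      h2, (hf u (by simp)).1, true_and]
    refine ⟨⟨ih (fun w hw => hf w (by simp [hw])) (le_trans ?_ hB), by omega⟩, by omega⟩
    exact Nat.pow_le_pow_right (by omega) (by simp)

end ArrayMachine

/-! ### The dictionary of hyperedges -/

namespace ArrayMachine

variable {V : Type*}

/-- The number of distinct values among those assigned to `us`. -/
def distinctExpr (ix : V → ℕ) : List V → Expr
  | [] => .const 0
  | u :: us => us.foldr (fun w e => (.const 1 - .eq (.reg (vreg ix u)) (.reg (vreg ix w))) * e)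
      (.const 1) + distinctExpr ix us

theorem eval_distinctExpr {ix : V → ℕ} {us : List V} {f : V → ℕ} {τ : State} {B : ℕ}
    (hf : ∀ u ∈ us, τ.reg (vreg ix u) = f u) (hB : us.length + 1 < B) :
    (distinctExpr ix us).Ok B τ ∧ (distinctExpr ix us).eval τ = (us.map f).toFinset.card := by
  induction us with
  | nil => simp [distinctExpr]
  | cons u us ih =>
    obtain ⟨h1, h2⟩ := ih (fun w hw => hf w (by simp [hw])) (by simp at hB; omega)
    have key : ∀ ws : List V, (∀ w ∈ ws, τ.reg (vreg ix w) = f w) →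
        (ws.foldr (fun w e => (.const 1 - .eq (.reg (vreg ix u)) (.reg (vreg ix w))) * e)
          (Expr.const 1)).Ok B τ ∧
        (ws.foldr (fun w e => (.const 1 - .eq (.reg (vreg ix u)) (.reg (vreg ix w))) * e)
          (Expr.const 1)).eval τ = if f u ∈ ws.map f then 0 else 1 := by
      intro ws hws
      induction ws with
      | nil => simp
      | cons w ws ihw =>
        obtain ⟨k1, k2⟩ := ihw fun z hz => hws z (by simp [hz])
        simp only [List.foldr_cons, Expr.ok_mul, Expr.ok_sub, Expr.ok_const, Expr.ok_eq,
          Expr.ok_reg, Expr.eval_mul, Expr.eval_sub, Expr.eval_const, Expr.eval_eq, Expr.eval_reg,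
          hf u (by simp), hws w (by simp), k1, k2, true_and, List.map_cons, List.mem_cons]
        by_cases hw : f u = f w
        · simp only [hw, if_true, true_or]
          simp
          omega
        · simp only [hw, if_false, false_or]
          split_ifs <;> simp <;> omega
    obtain ⟨k1, k2⟩ := key us fun w hw => hf w (by simp [hw])
    have hle : (us.map f).toFinset.card ≤ us.length := by
      simpa using List.toFinset_card_le (us.map f)
    simp only [List.length_cons] at hB
    simp only [distinctExpr, Expr.ok_add, Expr.eval_add, k1, k2, h1, h2, true_and, List.map_cons,
      List.toFinset_cons]
    by_cases hu : f u ∈ us.map f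
    · rw [if_pos hu, Finset.insert_eq_of_mem (by simpa using hu)]
      omega
    · rw [if_neg hu, Finset.card_insert_of_notMem (by simpa using hu)]
      omega

/-- If the values assigned to `us` are as many as the vertices of the current hyperedge, record
their tuple. -/
def recordTuple (ix : V → ℕ) (us : List V) : Stmt :=
  .ite (.eq (distinctExpr ix us) (.reg 7)) (.store 5 (codeExpr ix us) (.const 1)) .skip

/-- Loops over the vertices of the current hyperedge. -/
def edgeLevels (ix : V → ℕ) (us : List V) : List (Level V) :=
  us.map fun u => ⟨u, none, .reg 7, .arr 0 (.reg 5 + .const 1 + .reg (ireg ix u))⟩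

/-- Record all tuples, with positions `us`, whose sets of entries are hyperedges. -/
def recordTuples (ix : V → ℕ) (us : List V) : Stmt :=
  loopEdges (nest ix (edgeLevels ix us) (recordTuple ix us))

/-- Record all tuples, of the lengths of the lists in `Es`, whose sets of entries are
hyperedges. -/
def recordAll (ix : V → ℕ) : List (List V) → Stmt
  | [] => .skip
  | us :: Es => .seq (recordTuples ix us) (recordAll ix Es)

/-- The predicate `P` on tuples is tabulated by array `5`. -/
def HasDict (N : ℕ) (P : List ℕ → Prop) (A : ℕ → ℕ → ℕ) : Prop :=
  ∀ xs, (∀ x ∈ xs, x < N) →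
    (P xs → A 5 (tupleCode N xs) = 1) ∧ (¬ P xs → A 5 (tupleCode N xs) = 0)

theorem HasDict.iff {N : ℕ} {P P' : List ℕ → Prop} {A : ℕ → ℕ → ℕ} (h : HasDict N P A)
    (h' : ∀ xs, P xs ↔ P' xs) : HasDict N P' A := by
  have : P = P' := by
    ext xs
    exact h' xs
  rwa [← this]

theorem HasDict.insert {N : ℕ} {P : List ℕ → Prop} {σ : State} {ys : List ℕ}
    (h : HasDict N P σ.arr) (hN : 2 ≤ N) (hy : ∀ y ∈ ys, y < N) :
    HasDict N (fun xs => P xs ∨ xs = ys) (σ.setArr 5 (tupleCode N ys) 1).arr := by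
  intro xs hx
  simp only [State.setArr_arr, if_true, Function.update_apply]
  split_ifs with heq
  · exact ⟨fun _ => rfl, fun hn => absurd (Or.inr (tupleCode_inj hN hx hy heq)) hn⟩
  · refine ⟨?_, fun hn => (h xs hx).2 fun hp => hn (Or.inl hp)⟩
    rintro (hp | rfl)
    · exact (h xs hx).1 hp
    · exact absurd rfl heq

@[simp] theorem regs_recordTuple (ix : V → ℕ) (us : List V) : (recordTuple ix us).regs = ∅ := by
  simp [recordTuple]

@[simp] theorem arrs_recordTuple (ix : V → ℕ) (us : List V) : (recordTuple ix us).arrs = {5} := by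
  simp [recordTuple]

@[simp] theorem arrs_recordTuples (ix : V → ℕ) (us : List V) :
    (recordTuples ix us).arrs = {5} := by
  simp [recordTuples]

theorem regs_recordTuples (ix : V → ℕ) (us : List V) :
    (recordTuples ix us).regs ⊆ {5, 6, 7} ∪ {i | 100 ≤ i} := by
  simp only [recordTuples, regs_loopEdges]
  exact Set.union_subset_union_right _ fun i hi => le_of_mem_regs_nest (by simp) hi

theorem regs_recordAll (ix : V → ℕ) (Es : List (List V)) :
    (recordAll ix Es).regs ⊆ {5, 6, 7} ∪ {i | 100 ≤ i} := by
  induction Es with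
  | nil => simp [recordAll]
  | cons us Es ih => exact Set.union_subset (regs_recordTuples ix us) ih

theorem arrs_recordAll (ix : V → ℕ) (Es : List (List V)) : (recordAll ix Es).arrs ⊆ {5} := by
  induction Es with
  | nil => simp [recordAll]
  | cons us Es ih =>
    simp only [recordAll, Stmt.arrs_seq, arrs_recordTuples]
    exact Set.union_subset subset_rfl ih

theorem mem_enum_const [DecidableEq V] (a : List ℕ) (ls : List (Level V))
    (hnd : (ls.map Level.v).Nodup) (f g : V → ℕ) (hg : ∀ v ∈ ls.map Level.v, g v ∈ a)
    (hfg : ∀ v, v ∉ ls.map Level.v → g v = f v) : g ∈ enum (fun _ _ => a) ls f := by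
  induction ls generalizing f with
  | nil =>
    simp only [enum, List.mem_singleton]
    ext v
    exact hfg v (by simp)
  | cons lv ls ih =>
    simp only [List.map_cons, List.nodup_cons] at hnd
    simp only [enum, List.mem_flatMap]
    refine ⟨g lv.v, hg _ (by simp), ih hnd.2 _ (fun v hv => hg v (by simp [hv])) fun v hv => ?_⟩
    rw [Function.update_apply]
    split_ifs with h
    · rw [h]
    · exact hfg v (by simp [h, hv])

theorem mem_of_mem_enum_const [DecidableEq V] (a : List ℕ) (ls : List (Level V)) (f g : V → ℕ)
    (h : g ∈ enum (fun _ _ => a) ls f) : ∀ v ∈ ls.map Level.v, g v ∈ a := by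
  have key : ∀ (ls : List (Level V)) (f : V → ℕ), g ∈ enum (fun _ _ => a) ls f →
      ∀ v, g v ∈ a ∨ v ∉ ls.map Level.v ∧ g v = f v := by
    intro ls
    induction ls with
    | nil =>
      intro f h v
      simp only [enum, List.mem_singleton] at h
      exact Or.inr ⟨by simp, by rw [h]⟩
    | cons lv ls ih =>
      intro f h v
      simp only [enum, List.mem_flatMap] at h
      obtain ⟨x, hx, h⟩ := h
      rcases ih _ h v with h | ⟨h1, h2⟩
      · exact Or.inl h
      · by_cases hv : v = lv.v
        · subst hv
          left
          rw [h2]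
          simpa using hx
        · right
          rw [h2, Function.update_of_ne hv]
          exact ⟨by simp [hv, h1], rfl⟩
  intro v hv
  rcases key ls f h v with h | h
  · exact h
  · exact absurd hv h.1

theorem levelsOk_edgeLevels {B n : ℕ} {ix : V → ℕ} {a : List ℕ} (ha : ∀ x ∈ a, x < n)
    {P : State → Prop} (hP : ∀ τ, P τ → AtEdge B a τ) (ds us : List V) :
    LevelsOk B n ix P (fun _ _ => a) (fun _ => a.length) ds (edgeLevels ix us) := by
  induction us generalizing ds with
  | nil => trivial
  | cons u us ih =>
    refine ⟨fun τ f hτ _ => ?_, ih _⟩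
    have hat := hP τ hτ
    have hlt := hat.lt
    have hlen : a.length < B := by omega
    refine ⟨trivial, hat.length, hlen, le_rfl, ha, fun i (hi : i < a.length) hr => ?_⟩
    replace hr : τ.reg (ireg ix u) = i := hr
    refine ⟨?_, ?_⟩
    · simp only [Expr.ok_arr, Expr.ok_add, Expr.ok_reg, Expr.ok_const, Expr.eval_add,
        Expr.eval_reg, Expr.eval_const, true_and, hr]
      omega
    · simp only [Expr.eval_arr, Expr.eval_add, Expr.eval_reg, Expr.eval_const, hr, hat.get i hi]

theorem AtEdge.agree_nest {B : ℕ} {ix : V → ℕ} {ls : List (Level V)} {b : Stmt} {a : List ℕ}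
    {σ τ : State} (hb : b.regs = ∅) (h0 : 0 ∉ b.arrs) (h : AtEdge B a σ)
    (hag : Agree (nest ix ls b) σ τ) : AtEdge B a τ := by
  refine h.agree hag (fun h => ?_) (fun h => ?_) (by simpa using h0) <;>
  · have := le_of_mem_regs_nest hb h
    omega

theorem Wp.recordTuple {B N n : ℕ} {ix : V → ℕ} {us : List V} {a : List ℕ} {τ : State}
    {P : List ℕ → Prop} {f : V → ℕ} (h3 : τ.reg 3 = N) (hN : 2 ≤ N) (hn : n < N)
    (hB : N ^ (us.length + 1) ≤ B) (hB' : us.length + 1 < B) (hat : AtEdge B a τ) (ha : a.Nodup)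
    (hf : ∀ u ∈ us, τ.reg (vreg ix u) = f u ∧ f u < n) (hfa : ∀ u ∈ us, f u ∈ a)
    (hP : HasDict N P τ.arr) :
    Wp B (recordTuple ix us) ((distinctExpr ix us).cost + (codeExpr ix us).cost + 10) τ fun τ' =>
      HasDict N (fun xs => P xs ∨ xs = us.map f ∧ ∀ x, x ∈ xs ↔ x ∈ a) τ'.arr := by
  obtain ⟨h1, h2⟩ := eval_distinctExpr (B := B) (fun u hu => (hf u hu).1) hB'
  have h4 := eval_codeExpr (ix := ix) h3 (us := us) fun u hu => (hf u hu).1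
  have hfN : ∀ u ∈ us, τ.reg (vreg ix u) = f u ∧ f u < N := fun u hu =>
    ⟨(hf u hu).1, lt_trans (hf u hu).2 hn⟩
  have hiff : (us.map f).toFinset.card = a.length ↔ ∀ x, x ∈ us.map f ↔ x ∈ a := by
    have hsub : (us.map f).toFinset ⊆ a.toFinset := by
      intro x hx
      rw [List.mem_toFinset, List.mem_map] at hx
      obtain ⟨u, hu, rfl⟩ := hx
      simpa using hfa u hu
    rw [← List.toFinset_card_of_nodup ha]
    constructor
    · intro hc x
      rw [← List.mem_toFinset, Finset.eq_of_subset_of_card_le hsub hc.ge, List.mem_toFinset]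
    · intro hx
      congr 1
      ext x
      rw [List.mem_toFinset, hx, List.mem_toFinset]
  refine Wp.ite (T := (codeExpr ix us).cost + 5) (by simpa using h1) ?_ ?_
    (by simp only [Expr.cost_op, Expr.cost_reg]; omega)
  · intro hne
    simp only [Expr.eval_eq, h2, Expr.eval_reg, hat.length] at hne
    have heq := hiff.1 (by by_contra hc; exact hne (if_neg hc))
    refine Wp.store (ok_codeExpr h3 hN hfN hB) trivial (by simp) ?_
    rw [h4]
    refine (hP.insert hN ?_).iff fun xs => ?_
    · intro y hy
      obtain ⟨u, hu, rfl⟩ := List.mem_map.1 hy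
      exact (hfN u hu).2
    · refine or_congr Iff.rfl ⟨?_, fun h => h.1⟩
      rintro rfl
      exact ⟨rfl, heq⟩
  · intro h0
    simp only [Expr.eval_eq, h2, Expr.eval_reg, hat.length] at h0
    have hne : ¬ ∀ x, x ∈ us.map f ↔ x ∈ a := by
      intro h
      rw [if_pos (hiff.2 h)] at h0
      omega
    refine Wp.skip (by omega) (hP.iff fun xs => ⟨Or.inl, ?_⟩)
    rintro (h | ⟨rfl, h⟩)
    · exact h
    · exact absurd h hne

theorem Wp.recordTuples {B N n r : ℕ} {ix : V → ℕ} (hix : ix.Injective) {us : List V}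
    (hus : us.Nodup) {L : List (List ℕ)} {σ : State} {P : List ℕ → Prop}
    (hin : ∀ i, σ.arr 0 i = (Hypergraph.encode n L).getD i 0) (hm : σ.reg 2 = L.length)
    (h3 : σ.reg 3 = N) (hB : (Hypergraph.encode n L).length + 1 < B) (hN : 2 ≤ N) (hn : n < N)
    (hNB : N ^ (us.length + 1) ≤ B) (hB' : us.length + 1 < B)
    (hLn : ∀ a ∈ L, ∀ v ∈ a, v < n) (hLnd : ∀ a ∈ L, a.Nodup) (hr : ∀ a ∈ L, a.length ≤ r)
    (hP : HasDict N P σ.arr) :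
    Wp B (recordTuples ix us) (L.length * ((r + 1) ^ us.length *
      ((distinctExpr ix us).cost + (codeExpr ix us).cost + 10 + us.length * 40) + 40) + 40) σ
      fun τ => HasDict N (fun xs => P xs ∨ xs.length = us.length ∧
        ∃ a ∈ L, ∀ x, x ∈ xs ↔ x ∈ a) τ.arr := by
  classical
  set C := (distinctExpr ix us).cost + (codeExpr ix us).cost + 10 with hC
  have hlow : ∀ i < 100, i ∉ (ArrayMachine.nest ix (edgeLevels ix us) (ArrayMachine.recordTuple ix us)).regs := by
    intro i hi h
    have := le_of_mem_regs_nest (by simp) h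
    omega
  have hlev : (edgeLevels ix us).map Level.v = us := by
    simp [edgeLevels, Function.comp_def]
  refine Wp.forEdges (tb := (r + 1) ^ us.length * (C + us.length * 40)) L
    (fun d τ => HasDict N (fun xs => P xs ∨ xs.length = us.length ∧
      ∃ a ∈ d, ∀ x, x ∈ xs ↔ x ∈ a) τ.arr) hin hm hB (by simp)
    ⟨hlow _ (by norm_num), hlow _ (by norm_num), hlow _ (by norm_num), hlow _ (by norm_num)⟩
    (fun i v l' τ _ h => h) (hP.iff (by simp)) ?_ le_rfl (fun τ _ h => h)
  intro done a rest τ hd hag hat hinv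
  have haL : a ∈ L := by simp [hd]
  have e3 : τ.reg 3 = N := by
    rw [hag.reg 3, h3]
    simp only [regs_loopEdges, Set.mem_union, not_or]
    exact ⟨by simp, hlow _ (by norm_num)⟩
  have := Wp.nest hix (b := ArrayMachine.recordTuple ix us) (by simp) (n := n) (tb := C)
    (P := fun τ => AtEdge B a τ ∧ τ.reg 3 = N) (c := fun _ _ => a) (β := fun _ => a.length)
    (fun d A => HasDict N (fun xs => (P xs ∨ xs.length = us.length ∧
      ∃ a ∈ done, ∀ x, x ∈ xs ↔ x ∈ a) ∨ ∃ f ∈ d, (∀ u ∈ us, f u ∈ a) ∧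
        xs = us.map f ∧ ∀ x, x ∈ xs ↔ x ∈ a) A)
    (edgeLevels ix us) [] (by simpa [hlev] using hus)
    (levelsOk_edgeLevels (hLn a haL) (fun _ h => h.1) _ _) ?_ [] (fun _ => 0) τ ⟨hat, e3⟩ ?_ (by simp)
    (hinv.iff (by simp))
  · refine this.mono ?_ fun υ _ hυ => hυ.iff fun xs => ?_
    · refine (nestTime_le _ _ _).trans ?_
      simp only [edgeLevels, List.map_map, Function.comp_def, List.map_const', List.prod_replicate]
      have hcost : ∀ u : V, loopCost (.reg 7)
          (.arr 0 (.reg 5 + .const 1 + .reg (ireg ix u))) ≤ 40 := fun u => by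
        simp [loopCost]
      have hsum : (us.map fun u => loopCost (.reg 7)
          (.arr 0 (.reg 5 + .const 1 + .reg (ireg ix u)))).sum ≤ us.length * 40 := by
        refine (List.sum_le_card_nsmul _ 40 ?_).trans (by simp)
        intro x hx
        obtain ⟨u, -, rfl⟩ := List.mem_map.1 hx
        exact hcost u
      have := hr a haL
      gcongr
    · simp only [List.nil_append, List.mem_append, List.mem_singleton]
      constructor
      · rintro ((h | ⟨h1, b, hb, h2⟩) | ⟨f, -, -, rfl, h⟩)
        · exact Or.inl h
        · exact Or.inr ⟨h1, b, Or.inl hb, h2⟩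
        · exact Or.inr ⟨by simp, a, Or.inr rfl, h⟩
      · rintro (h | ⟨h1, b, hb | rfl, h2⟩)
        · exact Or.inl (Or.inl h)
        · exact Or.inl (Or.inr ⟨h1, b, hb, h2⟩)
        · right
          set f : V → ℕ := fun v => if v ∈ us then xs.getD (us.idxOf v) 0 else 0 with hf
          have hmap : us.map f = xs := by
            refine List.ext_getElem (by simp [h1]) fun i hi hi' => ?_
            have hi'' : i < us.length := by simpa using hi
            simp only [List.getElem_map, hf]
            rw [if_pos (List.getElem_mem _), hus.idxOf_getElem]
            simp [hi']
          have hfb : ∀ u ∈ us, f u ∈ b := fun u hu => by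
            rw [← h2, ← hmap]
            exact List.mem_map_of_mem hu
          refine ⟨f, mem_enum_const b _ (by rwa [hlev]) _ _ (by rwa [hlev]) ?_, hfb, hmap.symm, h2⟩
          rw [hlev]
          intro v hv
          simp [hf, hv]
  · rintro τ₁ τ₂ ⟨k1, k2⟩ hag'
    refine ⟨k1.agree_nest (by simp) (by simp) hag', ?_⟩
    rw [hag'.reg 3 (hlow _ (by norm_num)), k2]
  · rintro d f rest' τ₁ hfe ⟨k1, k2⟩ hf hd'
    simp only [hlev, List.nil_append] at hf
    have hfa : ∀ u ∈ us, f u ∈ a := by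
      have := mem_of_mem_enum_const a (edgeLevels ix us) (fun _ => 0) f (by
        rw [List.nil_append] at hfe
        simp [hfe])
      rwa [hlev] at this
    refine (Wp.recordTuple k2 hN hn hNB hB' k1 (hLnd a haL) hf hfa hd').mono le_rfl
      fun υ _ hυ => hυ.iff fun xs => ?_
    simp only [List.mem_append, List.mem_singleton]
    constructor
    · rintro ((h | ⟨g, hg, h⟩) | h)
      · exact Or.inl h
      · exact Or.inr ⟨g, Or.inl hg, h⟩
      · exact Or.inr ⟨f, Or.inr rfl, hfa, h⟩
    · rintro (h | ⟨g, hg | rfl, h⟩)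
      · exact Or.inl (Or.inl h)
      · exact Or.inl (Or.inr ⟨g, hg, h⟩)
      · exact Or.inr h.2

/-- The running time of `recordAll`, with `m` hyperedges of at most `r` vertices. -/
def recordTime (ix : V → ℕ) (r m : ℕ) : List (List V) → ℕ
  | [] => 1
  | us :: Es => (m * ((r + 1) ^ us.length *
      ((distinctExpr ix us).cost + (codeExpr ix us).cost + 10 + us.length * 40) + 40) + 40) +
      recordTime ix r m Es

theorem recordTime_le (ix : V → ℕ) (r : ℕ) (Es : List (List V)) :
    ∃ C, ∀ m, recordTime ix r m Es ≤ C * (m + 1) := by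
  induction Es with
  | nil => exact ⟨1, fun m => by simp [recordTime]⟩
  | cons us Es ih =>
    obtain ⟨C, hC⟩ := ih
    refine ⟨C + ((r + 1) ^ us.length *
      ((distinctExpr ix us).cost + (codeExpr ix us).cost + 10 + us.length * 40) + 40), fun m => ?_⟩
    have := hC m
    simp only [recordTime]
    set X := (r + 1) ^ us.length *
      ((distinctExpr ix us).cost + (codeExpr ix us).cost + 10 + us.length * 40)
    calc _ ≤ (m * (X + 40) + 40) + C * (m + 1) := by gcongr
      _ ≤ (m * (X + 40) + (X + 40)) + C * (m + 1) := by gcongr; omega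
      _ = _ := by ring

theorem Wp.recordAll {B N n r : ℕ} {ix : V → ℕ} (hix : ix.Injective) (Es : List (List V))
    (hEs : ∀ us ∈ Es, us.Nodup) {L : List (List ℕ)} {σ : State} {P : List ℕ → Prop}
    (hin : ∀ i, σ.arr 0 i = (Hypergraph.encode n L).getD i 0) (hm : σ.reg 2 = L.length)
    (h3 : σ.reg 3 = N) (hB : (Hypergraph.encode n L).length + 1 < B) (hN : 2 ≤ N) (hn : n < N)
    (hNB : ∀ us ∈ Es, N ^ (us.length + 1) ≤ B ∧ us.length + 1 < B)
    (hLn : ∀ a ∈ L, ∀ v ∈ a, v < n) (hLnd : ∀ a ∈ L, a.Nodup) (hr : ∀ a ∈ L, a.length ≤ r)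
    (hP : HasDict N P σ.arr) :
    Wp B (recordAll ix Es) (recordTime ix r L.length Es) σ
      fun τ => HasDict N (fun xs => P xs ∨ (∃ us ∈ Es, xs.length = us.length) ∧
        ∃ a ∈ L, ∀ x, x ∈ xs ↔ x ∈ a) τ.arr := by
  induction Es generalizing σ P with
  | nil => exact Wp.skip le_rfl (hP.iff (by simp))
  | cons us Es ih =>
    refine Wp.seq (Wp.recordTuples hix (hEs us (by simp)) hin hm h3 hB hN hn
      (hNB us (by simp)).1 (hNB us (by simp)).2 hLn hLnd hr hP)
      (T₂ := recordTime ix r L.length Es) ?_ le_rfl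
    intro τ hag hτ
    have hreg : ∀ i, i < 5 → τ.reg i = σ.reg i := by
      intro i hi
      refine hag.reg i fun h => ?_
      have := regs_recordTuples ix us h
      simp only [Set.mem_union, Set.mem_insert_iff, Set.mem_singleton_iff, Set.mem_ofPred_eq] at this
      omega
    have := ih (fun us hus => hEs us (by simp [hus])) (σ := τ)
      (by rw [hag.arr 0 (by simp)]; exact hin) (by rw [hreg 2 (by norm_num), hm])
      (by rw [hreg 3 (by norm_num), h3]) (fun us hus => hNB us (by simp [hus])) hτ
    refine this.mono le_rfl fun υ _ hυ => hυ.iff fun xs => ?_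
    simp only [List.mem_cons, exists_eq_or_imp]
    rw [or_and_right, or_assoc]

end ArrayMachine

/-! ### Partial sums over assignments -/

namespace ArrayMachine

variable {V : Type*} [Fintype V] [DecidableEq V]

/-- The sum of `W` over all assignments with values less than `n` on `S`, and equal to `f`
elsewhere. -/
def marginal (n : ℕ) (S : Finset V) (W : (V → ℕ) → ℕ) (f : V → ℕ) : ℕ :=
  ∑ φ ∈ Fintype.piFinset fun v => if v ∈ S then Finset.range n else {f v}, W φ

theorem mem_box {n : ℕ} {S : Finset V} {f φ : V → ℕ} :
    (φ ∈ Fintype.piFinset fun v => if v ∈ S then Finset.range n else {f v}) ↔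
      (∀ v ∈ S, φ v < n) ∧ ∀ v, v ∉ S → φ v = f v := by
  rw [Fintype.mem_piFinset]
  constructor
  · intro h
    refine ⟨fun v hv => ?_, fun v hv => ?_⟩
    · simpa [hv] using h v
    · simpa [hv] using h v
  · rintro ⟨h1, h2⟩ v
    split_ifs with hv
    · simpa using h1 v hv
    · simpa using h2 v hv

theorem marginal_congr {n : ℕ} {S : Finset V} {W W' : (V → ℕ) → ℕ} {f : V → ℕ}
    (h : ∀ φ, (∀ v ∈ S, φ v < n) → (∀ v, v ∉ S → φ v = f v) → W φ = W' φ) :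
    marginal n S W f = marginal n S W' f :=
  Finset.sum_congr rfl fun φ hφ => h φ (mem_box.1 hφ).1 (mem_box.1 hφ).2

theorem marginal_empty (n : ℕ) (W : (V → ℕ) → ℕ) (f : V → ℕ) : marginal n ∅ W f = W f := by
  unfold marginal
  have : (Fintype.piFinset fun v => if v ∈ (∅ : Finset V) then Finset.range n else {f v}) = {f} := by
    ext φ
    rw [mem_box, Finset.mem_singleton]
    simp [funext_iff]
  rw [this, Finset.sum_singleton]

theorem marginal_insert (n : ℕ) {S : Finset V} {v : V} (hv : v ∉ S) (W : (V → ℕ) → ℕ)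
    (f : V → ℕ) :
    marginal n (insert v S) W f = ∑ x ∈ Finset.range n, marginal n S W (Function.update f v x) := by
  unfold marginal
  rw [← Finset.sum_fiberwise_of_maps_to (t := Finset.range n) (g := fun φ : V → ℕ => φ v)]
  · refine Finset.sum_congr rfl fun x hx => Finset.sum_congr ?_ fun _ _ => rfl
    rw [Finset.mem_range] at hx
    ext φ
    rw [Finset.mem_filter, mem_box, mem_box]
    constructor
    · rintro ⟨⟨h1, h2⟩, h3⟩
      refine ⟨fun u hu => h1 u (Finset.mem_insert_of_mem hu), fun u hu => ?_⟩
      by_cases huv : u = v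
      · subst huv
        simpa using h3
      · rw [Function.update_of_ne huv]
        exact h2 u (by simp [huv, hu])
    · rintro ⟨h1, h2⟩
      have h3 : φ v = x := by simpa using h2 v hv
      refine ⟨⟨fun u hu => ?_, fun u hu => ?_⟩, h3⟩
      · rcases Finset.mem_insert.1 hu with rfl | hu
        · rwa [h3]
        · exact h1 u hu
      · simp only [Finset.mem_insert, not_or] at hu
        rw [h2 u hu.2, Function.update_of_ne hu.1]
  · intro φ hφ
    exact Finset.mem_range.2 ((mem_box.1 hφ).1 v (Finset.mem_insert_self _ _))

theorem marginal_union (n : ℕ) {S S' : Finset V} (h : Disjoint S S') (W : (V → ℕ) → ℕ)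
    (f : V → ℕ) : marginal n (S ∪ S') W f = marginal n S' (marginal n S W) f := by
  induction S' using Finset.induction_on generalizing f with
  | empty => rw [Finset.union_empty, marginal_empty]
  | insert v S' hv ih =>
    rw [Finset.disjoint_insert_right] at h
    rw [Finset.union_insert, marginal_insert n (by simp [h.1, hv]), marginal_insert n hv]
    exact Finset.sum_congr rfl fun x _ => ih h.2 _

theorem marginal_mul (n : ℕ) {S : Finset V} {W W' : (V → ℕ) → ℕ} (f : V → ℕ)
    (h : ∀ φ, (∀ v, v ∉ S → φ v = f v) → W' φ = W' f) :
    marginal n S (fun φ => W φ * W' φ) f = marginal n S W f * W' f := by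
  unfold marginal
  rw [Finset.sum_mul]
  refine Finset.sum_congr rfl fun φ hφ => ?_
  beta_reduce
  rw [h φ (mem_box.1 hφ).2]

theorem marginal_local (n : ℕ) {S R : Finset V} {W : (V → ℕ) → ℕ}
    (hW : ∀ φ ψ, (∀ v ∈ R, φ v = ψ v) → W φ = W ψ) {f g : V → ℕ}
    (hfg : ∀ v ∈ R, v ∉ S → f v = g v) : marginal n S W f = marginal n S W g := by
  induction S using Finset.induction_on generalizing f g with
  | empty =>
    rw [marginal_empty, marginal_empty]
    exact hW f g fun v hv => hfg v hv (by simp)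
  | insert v S hv ih =>
    rw [marginal_insert n hv, marginal_insert n hv]
    refine Finset.sum_congr rfl fun x _ => ih fun u hu huS => ?_
    by_cases huv : u = v
    · subst huv
      simp
    · rw [Function.update_of_ne huv, Function.update_of_ne huv]
      exact hfg u hu (by simp [huv, huS])

/-- Summation against the indicator function of an assignment `g` evaluates the weight at `g`. -/
theorem marginal_indicator (n : ℕ) {S : Finset V} {W : (V → ℕ) → ℕ} {f g : V → ℕ}
    (hg : ∀ v ∈ S, g v < n) :
    marginal n S (fun φ => if ∀ v ∈ S, φ v = g v then W φ else 0) f =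
      W fun v => if v ∈ S then g v else f v := by
  unfold marginal
  rw [Finset.sum_eq_single fun v => if v ∈ S then g v else f v]
  · rw [if_pos fun v hv => by simp [hv]]
  · intro φ hφ hne
    refine if_neg fun h => hne ?_
    ext v
    split_ifs with hv
    · exact h v hv
    · exact (mem_box.1 hφ).2 v hv
  · intro h
    refine absurd (mem_box.2 ⟨fun v hv => ?_, fun v hv => ?_⟩) h
    · simpa [hv] using hg v hv
    · simp [hv]

theorem marginal_le (n : ℕ) {S : Finset V} {W : (V → ℕ) → ℕ} {f : V → ℕ} {M : ℕ}
    (h : ∀ φ, (∀ v ∈ S, φ v < n) → (∀ v, v ∉ S → φ v = f v) → W φ ≤ M) :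
    marginal n S W f ≤ n ^ S.card * M := by
  unfold marginal
  refine (Finset.sum_le_card_nsmul _ _ M fun φ hφ => h φ (mem_box.1 hφ).1 (mem_box.1 hφ).2).trans ?_
  rw [Fintype.card_piFinset, smul_eq_mul]
  refine Nat.mul_le_mul_right _ (le_of_eq ?_)
  rw [← Finset.prod_subset (Finset.subset_univ S), Finset.prod_congr rfl (g := fun _ => n)]
  · simp
  · intro v hv
    simp [hv]
  · intro v _ hv
    simp [hv]

end ArrayMachine

namespace ArrayMachine

variable {V : Type*}

/-- At each level the list of values is duplicate-free, is determined by the values at outer levels,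
and contains the value at that level of every assignment with nonzero weight. -/
def ValuesOk (n : ℕ) (c : Level V → (V → ℕ) → List ℕ) (W : (V → ℕ) → ℕ) :
    List V → List (Level V) → Prop
  | _, [] => True
  | ds, lv :: ls => (∀ f g, (∀ u ∈ ds, f u = g u) → c lv f = c lv g) ∧
    (∀ f, (c lv f).Nodup) ∧ (∀ f, ∀ x ∈ c lv f, x < n) ∧
    (∀ f, f lv.v ∉ c lv f → W f = 0) ∧ ValuesOk n c W (lv.v :: ds) ls

theorem ValuesOk.mono {n : ℕ} {c : Level V → (V → ℕ) → List ℕ} {W W' : (V → ℕ) → ℕ}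
    (hW : ∀ f, W f = 0 → W' f = 0) {ls : List (Level V)} {ds : List V}
    (h : ValuesOk n c W ds ls) : ValuesOk n c W' ds ls := by
  induction ls generalizing ds with
  | nil => trivial
  | cons lv ls ih =>
    obtain ⟨h1, h2, h3, h4, h5⟩ := h
    exact ⟨h1, h2, h3, fun f hf => hW f (h4 f hf), ih h5⟩

/-- Nested loops compute a marginal sum, because they reach every assignment of nonzero weight once. -/
theorem sum_enum [Fintype V] [DecidableEq V] {n : ℕ} {c : Level V → (V → ℕ) → List ℕ} {W : (V → ℕ) → ℕ}
    {ls : List (Level V)} {ds : List V} (hnd : (ds ++ ls.map Level.v).Nodup)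
    (h : ValuesOk n c W ds ls) (f : V → ℕ) :
    ((enum c ls f).map W).sum = marginal n (ls.map Level.v).toFinset W f := by
  induction ls generalizing ds f with
  | nil => simp [enum, marginal_empty]
  | cons lv ls ih =>
    obtain ⟨h1, h2, h3, h4, h5⟩ := h
    have hnd' : ((lv.v :: ds) ++ ls.map Level.v).Nodup := by
      refine (List.Perm.nodup_iff ?_).1 hnd
      simp only [List.map_cons, List.cons_append]
      exact List.perm_middle
    have hv : lv.v ∉ (ls.map Level.v).toFinset := by
      simp only [List.cons_append, List.nodup_cons, List.mem_append, not_or] at hnd'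
      simpa using hnd'.1.2
    have hds : ∀ u ∈ ds, u ≠ lv.v ∧ u ∉ (ls.map Level.v).toFinset := by
      intro u hu
      have := List.disjoint_of_nodup_append hnd hu
      rw [List.map_cons, List.mem_cons] at this
      exact ⟨fun h => this (Or.inl h), fun h => this (Or.inr (by simpa using h))⟩
    rw [List.map_cons, List.toFinset_cons, marginal_insert n hv]
    have e1 : ((enum c (lv :: ls) f).map W).sum =
        ((c lv f).map fun x =>
          marginal n (ls.map Level.v).toFinset W (Function.update f lv.v x)).sum := by
      simp only [enum]
      generalize c lv f = xs
      induction xs with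
      | nil => rfl
      | cons x xs ihx =>
        rw [List.flatMap_cons, List.map_append, List.sum_append, ihx, ih hnd' h5, List.map_cons,
          List.sum_cons]
    rw [e1, ← List.sum_toFinset _ (h2 f)]
    refine Finset.sum_subset (fun x hx => ?_) fun x _ hx => ?_
    · rw [Finset.mem_range]
      exact h3 f x (by simpa using hx)
    · refine Finset.sum_eq_zero fun φ hφ => h4 φ fun hφc => hx ?_
      obtain ⟨-, hφ2⟩ := mem_box.1 hφ
      have e2 : φ lv.v = x := by simpa using hφ2 lv.v hv
      have e3 : c lv φ = c lv f := h1 φ f fun u hu => by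
        rw [hφ2 u (hds u hu).2, Function.update_of_ne (hds u hu).1]
      rw [e2, e3] at hφc
      simpa using hφc

end ArrayMachine

/-! ### Dynamic programming over a sequence of nodes -/

namespace ArrayMachine

variable {V : Type*}

/-- A node: nested loops over the assignments to its elements, and an expression for their weights,
which are at most `N ^ deg`. -/
structure Node (V : Type*) where
  levels : List (Level V)
  weight : Expr
  deg : ℕ

/-- The elements to which a node assigns values. -/
def Node.verts (nd : Node V) : List V := nd.levels.map Level.v

/-- Agreement outside the registers used for assignments and results, and on the arrays before
the `t`-th. -/
structure Static (σ : State) (t : ℕ) (τ : State) : Prop where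
  reg : ∀ i, 1 ≤ i → i < 100 → τ.reg i = σ.reg i
  arr : ∀ k < t, τ.arr k = σ.arr k

theorem Static.trans {σ τ υ : State} {t t' : ℕ} (h : Static σ t τ) (h' : Static τ t' υ)
    (ht : t ≤ t') : Static σ t υ :=
  ⟨fun i h1 h2 => (h'.reg i h1 h2).trans (h.reg i h1 h2),
    fun k hk => (h'.arr k (hk.trans_le ht)).trans (h.arr k hk)⟩

/-- The node `nd` enumerates all assignments for which the weight `w` is not zero, and computes
their weights. -/
structure NodeOk (B n N : ℕ) (ix : V → ℕ) (P : State → Prop) (c : Level V → (V → ℕ) → List ℕ)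
    (β : Level V → ℕ) (nd : Node V) (w : (V → ℕ) → ℕ) : Prop where
  nodup : nd.verts.Nodup
  levels : LevelsOk B n ix P c β [] nd.levels
  values : ValuesOk n c w [] nd.levels
  depends : ∀ f g, (∀ v ∈ nd.verts, f v = g v) → w f = w g
  weight : ∀ τ f, P τ → (∀ u ∈ nd.verts, τ.reg (vreg ix u) = f u ∧ f u < n) →
    nd.weight.Ok B τ ∧ nd.weight.eval τ = w f
  le : ∀ f, (∀ v ∈ nd.verts, f v < n) → w f ≤ N ^ nd.deg

theorem LevelsOk.mono {B n : ℕ} {ix : V → ℕ} {P P' : State → Prop}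
    {c : Level V → (V → ℕ) → List ℕ} {β : Level V → ℕ} (h : ∀ τ, P' τ → P τ) {ds : List V}
    {ls : List (Level V)} (hls : LevelsOk B n ix P c β ds ls) : LevelsOk B n ix P' c β ds ls := by
  induction ls generalizing ds with
  | nil => trivial
  | cons lv ls ih => exact ⟨fun τ f hτ hf => hls.1 τ f (h τ hτ) hf, ih hls.2⟩

theorem NodeOk.mono {B n N : ℕ} {ix : V → ℕ} {P P' : State → Prop}
    {c : Level V → (V → ℕ) → List ℕ} {β : Level V → ℕ} {nd : Node V} {w : (V → ℕ) → ℕ}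
    (h : ∀ τ, P' τ → P τ) (hnd : NodeOk B n N ix P c β nd w) : NodeOk B n N ix P' c β nd w :=
  { hnd with
    levels := hnd.levels.mono h
    weight := fun τ f hτ hf => hnd.weight τ f (h τ hτ) hf }

/-- Adds the weight of every assignment to the entry of the array `t` that belongs to the values
of `keys`. -/
def fill (ix : V → ℕ) (t : ℕ) (keys : List V) (nd : Node V) : Stmt :=
  nest ix nd.levels (.store t (codeExpr ix keys) (.arr t (codeExpr ix keys) + nd.weight))

/-- Running time of the innermost statement of `fill`. -/
def fillCost (ix : V → ℕ) (keys : List V) (nd : Node V) : ℕ :=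
  2 * (codeExpr ix keys).cost + nd.weight.cost + 9

/-- `fill` tabulates the sums of the weights of a node over the elements that are not keys. -/
theorem Wp.fill [Fintype V] [DecidableEq V] {B n N t : ℕ} {ix : V → ℕ} (hix : ix.Injective)
    {nd : Node V} {w : (V → ℕ) → ℕ} {keys : List V} {c : Level V → (V → ℕ) → List ℕ}
    {β : Level V → ℕ} {σ : State} (hN : 2 ≤ N) (hnN : n ≤ N)
    (hok : NodeOk B n N ix (Static σ t) c β nd w) (hkeys : ∀ v ∈ keys, v ∈ nd.verts)
    (hlen : keys.length ≤ nd.verts.length) (hB : N ^ (nd.deg + nd.verts.length + 1) ≤ B)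
    (h3 : σ.reg 3 = N) (h0 : ∀ a, σ.arr t a = 0) :
    Wp B (fill ix t keys nd) (nestTime β (fillCost ix keys nd) nd.levels) σ fun τ =>
      ∀ g : V → ℕ, (∀ v ∈ keys, g v < n) → τ.arr t (tupleCode N (keys.map g)) =
        marginal n (nd.verts.toFinset \ keys.toFinset) w g := by
  set W : ℕ → (V → ℕ) → ℕ := fun a g => if tupleCode N (keys.map g) = a then w g else 0 with hW
  have hsum : ∀ a, ((enum c nd.levels 0).map (W a)).sum = marginal n nd.verts.toFinset (W a) 0 :=
    fun a => sum_enum (ds := []) hok.nodup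
      (hok.values.mono fun f hf => by simp [hW, hf]) 0
  have hpow : N ^ (keys.length + 1) ≤ B := le_trans (Nat.pow_le_pow_right (by omega) (by omega)) hB
  have hmarg : ∀ a, marginal n nd.verts.toFinset (W a) 0 < B := by
    intro a
    have h1 : marginal n nd.verts.toFinset (W a) 0 ≤ n ^ nd.verts.toFinset.card * N ^ nd.deg := by
      refine marginal_le n fun φ hφ _ => ?_
      simp only [hW]
      split_ifs
      · exact hok.le φ fun v hv => hφ v (by simpa using hv)
      · exact Nat.zero_le _
    have h2 : n ^ nd.verts.toFinset.card ≤ N ^ nd.verts.length :=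
      (Nat.pow_le_pow_left hnN _).trans
        (Nat.pow_le_pow_right (by omega) (List.toFinset_card_le _))
    calc _ ≤ N ^ nd.verts.length * N ^ nd.deg := h1.trans (Nat.mul_le_mul_right _ h2)
      _ = N ^ (nd.deg + nd.verts.length) := by rw [← pow_add, add_comm]
      _ < N ^ (nd.deg + nd.verts.length + 1) := Nat.pow_lt_pow_right (by omega) (by omega)
      _ ≤ B := hB
  refine (Wp.nest (P := Static σ t) hix rfl
    (fun d arr => ∀ a, arr t a = (d.map (W a)).sum) nd.levels [] hok.nodup
    hok.levels ?_ [] 0 σ ⟨fun _ _ _ => rfl, fun _ _ => rfl⟩ ?_ (by simp) (by simpa using h0)).mono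
    le_rfl fun τ _ hτ g hg => ?_
  · intro τ τ' hτ hag
    refine ⟨fun i h1 h2 => ?_, fun k hk => ?_⟩
    · rw [hag.reg i fun hi => by have := le_of_mem_regs_nest rfl hi; omega]
      exact hτ.reg i h1 h2
    · rw [hag.arr k (by simp; omega)]
      exact hτ.arr k hk
  · intro d g rest τ hd hτ hg hI
    simp only [List.nil_append] at hd hg
    have k3 : τ.reg 3 = N := (hτ.reg 3 (by omega) (by omega)).trans h3
    have hgk : ∀ u ∈ keys, τ.reg (vreg ix u) = g u ∧ g u < N := fun u hu =>
      ⟨(hg u (hkeys u hu)).1, ((hg u (hkeys u hu)).2).trans_le hnN⟩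
    have ha := ok_codeExpr k3 hN hgk hpow
    have hev := eval_codeExpr (ix := ix) k3 fun u hu => (hgk u hu).1
    obtain ⟨hw, hwe⟩ := hok.weight τ g hτ hg
    refine Wp.store ha ?_ ?_ fun a => ?_
    · simp only [Expr.ok_add, Expr.ok_arr, Expr.eval_arr]
      refine ⟨ha, hw, ?_⟩
      rw [hev, hwe, hI]
      refine lt_of_le_of_lt ?_ (hmarg (tupleCode N (keys.map g)))
      rw [← hsum, hd]
      simp [hW]
    · simp only [fillCost, Expr.cost_add, Expr.cost_arr]
      omega
    · simp only [State.setArr_arr, if_true, hev, hwe, Expr.eval_add, Expr.eval_arr, hI,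
        Function.update_apply, List.map_append, List.sum_append, List.map_cons, List.map_nil,
        List.sum_cons, List.sum_nil, hW, add_zero]
      split_ifs with h1 h2 h2
      · rw [h1]
      · exact absurd h1.symm h2
      · exact absurd h2.symm h1
      · rfl
  · rw [hτ]
    simp only [List.nil_append]
    rw [hsum]
    have hsub : keys.toFinset ⊆ nd.verts.toFinset := fun v hv => by
      simpa using hkeys v (by simpa using hv)
    have e1 : marginal n nd.verts.toFinset (W (tupleCode N (keys.map g))) 0 =
        marginal n nd.verts.toFinset
          (fun φ => w φ * if ∀ v ∈ keys.toFinset, φ v = g v then 1 else 0) 0 := by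
      refine marginal_congr fun φ hφ _ => ?_
      simp only [hW]
      have : tupleCode N (keys.map φ) = tupleCode N (keys.map g) ↔
          ∀ v ∈ keys.toFinset, φ v = g v := by
        constructor
        · intro h v hv
          refine List.map_inj_left.1 (tupleCode_inj hN ?_ ?_ h) v (by simpa using hv)
          · intro x hx
            obtain ⟨u, hu, rfl⟩ := List.mem_map.1 hx
            exact (hφ u (by simpa using hkeys u hu)).trans_le hnN
          · intro x hx
            obtain ⟨u, hu, rfl⟩ := List.mem_map.1 hx
            exact (hg u hu).trans_le hnN
        · intro h
          rw [List.map_congr_left fun v hv => h v (by simpa using hv)]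
      simp only [this]
      split_ifs <;> simp
    have e0 := marginal_union n (Finset.sdiff_disjoint (s := keys.toFinset)
      (t := nd.verts.toFinset)) (fun φ => w φ * if ∀ v ∈ keys.toFinset, φ v = g v then 1 else 0) 0
    rw [Finset.sdiff_union_of_subset hsub] at e0
    have e2 : marginal n keys.toFinset (marginal n (nd.verts.toFinset \ keys.toFinset)
          fun φ => w φ * if ∀ v ∈ keys.toFinset, φ v = g v then 1 else 0) 0 =
        marginal n keys.toFinset (fun φ => if ∀ v ∈ keys.toFinset, φ v = g v then
          marginal n (nd.verts.toFinset \ keys.toFinset) w φ else 0) 0 := by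
      refine marginal_congr fun φ _ _ => ?_
      rw [marginal_mul]
      · split_ifs <;> simp
      · intro ψ hψ
        have : ∀ v ∈ keys.toFinset, ψ v = φ v := fun v hv => hψ v (by simp [hv])
        exact if_congr (forall₂_congr fun v hv => by rw [this v hv]) rfl rfl
    rw [e1, e0, e2, marginal_indicator (W := marginal n (nd.verts.toFinset \ keys.toFinset) w) n
      fun v hv => hg v (by simpa using hv)]
    have hloc : ∀ φ ψ : V → ℕ, (∀ v ∈ nd.verts.toFinset, φ v = ψ v) → w φ = w ψ :=
      fun φ ψ h => hok.depends φ ψ fun v hv => h v (List.mem_toFinset.2 hv)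
    refine marginal_local n hloc fun v hv hv' => ?_
    have : v ∈ keys.toFinset := by
      by_contra h
      exact hv' (Finset.mem_sdiff.2 ⟨hv, h⟩)
    rw [if_pos this]

end ArrayMachine

namespace ArrayMachine

variable {V : Type*}

/-- Multiplies the weight of the first node that contains `keys` by `e`, a factor of at most
`N ^ d`. -/
def attach [DecidableEq V] (keys : List V) (e : Expr) (d : ℕ) : List (Node V) → List (Node V)
  | [] => []
  | nd :: nds => if ∀ v ∈ keys, v ∈ nd.verts
      then { nd with weight := nd.weight * e, deg := nd.deg + d } :: nds
      else nd :: attach keys e d nds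

theorem map_verts_attach [DecidableEq V] (keys : List V) (e : Expr) (d : ℕ) (nds : List (Node V)) :
    (attach keys e d nds).map Node.verts = nds.map Node.verts := by
  induction nds with
  | nil => rfl
  | cons nd nds ih =>
    unfold attach
    split_ifs
    · rfl
    · simp [ih]

theorem map_levels_attach [DecidableEq V] (keys : List V) (e : Expr) (d : ℕ)
    (nds : List (Node V)) : (attach keys e d nds).map Node.levels = nds.map Node.levels := by
  induction nds with
  | nil => rfl
  | cons nd nds ih =>
    unfold attach
    split_ifs
    · rfl
    · simp [ih]

theorem length_attach [DecidableEq V] (keys : List V) (e : Expr) (d : ℕ) (nds : List (Node V)) :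
    (attach keys e d nds).length = nds.length := by
  rw [← List.length_map Node.verts, map_verts_attach, List.length_map]

/-- An exponent that bounds the values in the tables. -/
def budget (nds : List (Node V)) : ℕ := (nds.map fun nd => nd.deg + nd.verts.length).sum

theorem budget_attach [DecidableEq V] {keys : List V} (e : Expr) (d : ℕ) {nds : List (Node V)}
    (h : ∃ nd ∈ nds, ∀ v ∈ keys, v ∈ nd.verts) :
    budget (attach keys e d nds) = budget nds + d := by
  induction nds with
  | nil => simp at h
  | cons nd nds ih =>
    unfold attach
    split_ifs with h1
    · simp only [budget, List.map_cons, List.sum_cons, Node.verts]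
      omega
    · obtain ⟨nd', hnd', h2⟩ := h
      rcases List.mem_cons.1 hnd' with rfl | hnd'
      · exact absurd h2 h1
      · have := ih ⟨nd', hnd', h2⟩
        simp only [budget, List.map_cons, List.sum_cons] at this ⊢
        omega

/-- The elements of `nd` that also belong to one of the nodes `nds`. -/
def sharedKeys [DecidableEq V] (nd : Node V) (nds : List (Node V)) : List V :=
  nd.verts.filter fun v => ∃ nd' ∈ nds, v ∈ nd'.verts

/-- Dynamic programming. Each node in turn is summed over the elements that belong to no later node,
and the result is stored in a table, which becomes a factor of a later node. The sum over the last
node is added to the register `0`. The tables are the arrays from the `t`-th on. -/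
def sumNodes [DecidableEq V] (ix : V → ℕ) (t : ℕ) : List (Node V) → Stmt
  | [] => .skip
  | [nd] => .seq (fill ix t [] nd) (.assign 0 (.reg 0 + .arr t (.const 1)))
  | nd :: nd' :: nds => .seq (fill ix t (sharedKeys nd (nd' :: nds)) nd)
      (sumNodes ix (t + 1) (attach (sharedKeys nd (nd' :: nds))
        (.arr t (codeExpr ix (sharedKeys nd (nd' :: nds)))) (nd.deg + nd.verts.length)
        (nd' :: nds)))
termination_by nds => nds.length
decreasing_by simp [length_attach]

/-- The running intersection property: the common elements of each list and the later ones all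
belong to a single later list. -/
def RunningIntersection : List (List V) → Prop
  | [] => True
  | R :: Rs => (Rs = [] ∨ ∃ R' ∈ Rs, ∀ v ∈ R, (∃ R'' ∈ Rs, v ∈ R'') → v ∈ R') ∧
      RunningIntersection Rs

theorem frame_sumNodes [DecidableEq V] (ix : V → ℕ) (t : ℕ) (nds : List (Node V)) :
    (∀ i ∈ (sumNodes ix t nds).regs, i = 0 ∨ 100 ≤ i) ∧
      ∀ k ∈ (sumNodes ix t nds).arrs, t ≤ k ∧ k < t + nds.length := by
  induction h : nds.length generalizing t nds with
  | zero =>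
    rw [List.length_eq_zero_iff.1 h, sumNodes]
    simp
  | succ m ih =>
    match nds, h with
    | [nd], h =>
      rw [sumNodes]
      simp only [fill, Stmt.regs_seq, Stmt.arrs_seq, arrs_nest, Stmt.arrs_store, Stmt.regs_assign,
        Stmt.arrs_assign, Set.mem_union, Set.mem_singleton_iff, Set.mem_empty_iff_false, or_false]
      refine ⟨fun i hi => ?_, fun k hk => by omega⟩
      rcases hi with hi | rfl
      · exact Or.inr (le_of_mem_regs_nest rfl hi)
      · exact Or.inl rfl
    | nd :: nd' :: nds, h =>
      rw [sumNodes]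
      obtain ⟨h1, h2⟩ := ih (t + 1) (attach (sharedKeys nd (nd' :: nds))
        (.arr t (codeExpr ix (sharedKeys nd (nd' :: nds)))) (nd.deg + nd.verts.length)
        (nd' :: nds)) (by rw [length_attach]; simpa using h)
      simp only [Stmt.regs_seq, Stmt.arrs_seq, Set.mem_union]
      refine ⟨fun i hi => ?_, fun k hk => ?_⟩
      · rcases hi with hi | hi
        · exact Or.inr (le_of_mem_regs_nest rfl hi)
        · exact h1 i hi
      · rcases hk with hk | hk
        · simp only [fill, arrs_nest, Stmt.arrs_store, Set.mem_singleton_iff] at hk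
          omega
        · have := h2 k hk
          omega

/-- The weights of `attach keys e d nds`, when the value of `e` is `M`. -/
theorem exists_nodeOk_attach [DecidableEq V] {B n N d : ℕ} {ix : V → ℕ} {P : State → Prop}
    {c : Level V → (V → ℕ) → List ℕ} {β : Level V → ℕ} {keys : List V} {e : Expr}
    {M : (V → ℕ) → ℕ} (hMk : ∀ f g, (∀ v ∈ keys, f v = g v) → M f = M g)
    (hM : ∀ f, (∀ v ∈ keys, f v < n) → M f ≤ N ^ d)
    (he : ∀ τ f, P τ → (∀ u ∈ keys, τ.reg (vreg ix u) = f u ∧ f u < n) →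
      e.Ok B τ ∧ e.eval τ = M f)
    {nds : List (Node V)} {ws : List ((V → ℕ) → ℕ)} (hN : 2 ≤ N)
    (hB : N ^ (budget nds + d + 1) ≤ B)
    (h : List.Forall₂ (NodeOk B n N ix P c β) nds ws)
    (hk : ∃ nd ∈ nds, ∀ v ∈ keys, v ∈ nd.verts) :
    ∃ ws', List.Forall₂ (NodeOk B n N ix P c β) (attach keys e d nds) ws' ∧
      ∀ f, (ws'.map fun w => w f).prod = M f * (ws.map fun w => w f).prod := by
  induction h with
  | nil => simp at hk
  | @cons nd w nds ws hnd hnds ih =>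
    unfold attach
    split_ifs with h1
    · refine ⟨(fun f => w f * M f) :: ws, .cons ?_ hnds, fun f => ?_⟩
      · have hle : ∀ f, (∀ v ∈ nd.verts, f v < n) → w f * M f ≤ N ^ (nd.deg + d) := fun f hf => by
          rw [pow_add]
          exact Nat.mul_le_mul (hnd.le f hf) (hM f fun v hv => hf v (h1 v hv))
        refine ⟨hnd.nodup, hnd.levels, hnd.values.mono fun f hf => by simp [hf], fun f g hfg => ?_,
          fun τ f hτ hf => ?_, hle⟩
        · rw [hnd.depends f g hfg, hMk f g fun v hv => hfg v (h1 v hv)]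
        · obtain ⟨a1, a2⟩ := hnd.weight τ f hτ hf
          obtain ⟨b1, b2⟩ := he τ f hτ fun u hu => hf u (h1 u hu)
          simp only [Expr.ok_mul, Expr.eval_mul, a2, b2]
          refine ⟨⟨a1, b1, ?_⟩, trivial⟩
          refine (hle f fun v hv => (hf v hv).2).trans_lt (lt_of_lt_of_le ?_ hB)
          refine Nat.pow_lt_pow_right (by omega) ?_
          simp only [budget, List.map_cons, List.sum_cons]
          omega
      · simp only [List.map_cons, List.prod_cons]
        ring
    · have hk' : ∃ nd ∈ nds, ∀ v ∈ keys, v ∈ nd.verts := by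
        obtain ⟨nd', hnd', h2⟩ := hk
        rcases List.mem_cons.1 hnd' with rfl | hnd'
        · exact absurd h2 h1
        · exact ⟨nd', hnd', h2⟩
      obtain ⟨ws', h2, h3⟩ := ih (le_trans (Nat.pow_le_pow_right (by omega) (by
        simp only [budget, List.map_cons, List.sum_cons]
        omega)) hB) hk'
      refine ⟨w :: ws', .cons hnd h2, fun f => ?_⟩
      simp only [List.map_cons, List.prod_cons, h3]
      ring

/-- The elements of a sequence of nodes. -/
def allVerts [DecidableEq V] (nds : List (Node V)) : Finset V :=
  (nds.flatMap Node.verts).toFinset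

theorem mem_allVerts [DecidableEq V] {nds : List (Node V)} {v : V} :
    v ∈ allVerts nds ↔ ∃ nd ∈ nds, v ∈ nd.verts := by
  simp [allVerts]

theorem allVerts_attach [DecidableEq V] (keys : List V) (e : Expr) (d : ℕ) (nds : List (Node V)) :
    allVerts (attach keys e d nds) = allVerts nds := by
  unfold allVerts
  rw [List.flatMap, map_verts_attach, ← List.flatMap]

theorem prod_depends [DecidableEq V] {B n N : ℕ} {ix : V → ℕ} {P : State → Prop}
    {c : Level V → (V → ℕ) → List ℕ} {β : Level V → ℕ}
    {nds : List (Node V)} {ws : List ((V → ℕ) → ℕ)}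
    (h : List.Forall₂ (NodeOk B n N ix P c β) nds ws) {f g : V → ℕ}
    (hfg : ∀ v ∈ allVerts nds, f v = g v) :
    (ws.map fun w => w f).prod = (ws.map fun w => w g).prod := by
  induction h with
  | nil => rfl
  | @cons nd w nds ws hnd hnds ih =>
    simp only [List.map_cons, List.prod_cons]
    rw [ih fun v hv => hfg v ?_, hnd.depends f g fun v hv => hfg v ?_]
    · exact mem_allVerts.2 ⟨nd, by simp, hv⟩
    · obtain ⟨nd', h1, h2⟩ := mem_allVerts.1 hv
      exact mem_allVerts.2 ⟨nd', by simp [h1], h2⟩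

theorem nestTime_le_mul {β : Level V → ℕ} {ls : List (Level V)} {X : ℕ}
    (h : (ls.map fun lv => β lv + 1).prod ≤ X) (tb : ℕ) :
    nestTime β tb ls ≤ (tb + (ls.map fun lv => loopCost lv.bound lv.val).sum) * X := by
  rw [mul_comm]
  exact (nestTime_le β tb ls).trans (Nat.mul_le_mul_right _ h)

/-- The first node shares its keys with a single later node, by the running intersection property. The
elements that are not keys occur in no other node, so the sum over them can be taken first and
multiplied into the weight of that later node. -/
theorem exists_wp_sumNodes [Fintype V] [DecidableEq V] {ix : V → ℕ} (hix : ix.Injective) (t : ℕ)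
    (nds : List (Node V)) (hne : nds ≠ []) (hri : RunningIntersection (nds.map Node.verts)) :
    ∃ C, ∀ (B n N X : ℕ) (c : Level V → (V → ℕ) → List ℕ) (β : Level V → ℕ) (σ : State)
      (ws : List ((V → ℕ) → ℕ)), 2 ≤ N → n ≤ N → N ^ (budget nds + 1) ≤ B → σ.reg 3 = N →
      (∀ k, t ≤ k → k < t + nds.length → ∀ a, σ.arr k a = 0) →
      List.Forall₂ (NodeOk B n N ix (Static σ t) c β) nds ws →
      (∀ ls ∈ nds.map Node.levels, (ls.map fun lv => β lv + 1).prod ≤ X) → 1 ≤ X →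
      σ.reg 0 + marginal n (allVerts nds) (fun f => (ws.map fun w => w f).prod) 0 < B →
      Wp B (sumNodes ix t nds) (C * X) σ fun τ => τ.reg 0 =
        σ.reg 0 + marginal n (allVerts nds) (fun f => (ws.map fun w => w f).prod) 0 := by
  induction h : nds.length generalizing t nds with
  | zero => exact absurd (List.length_eq_zero_iff.1 h) hne
  | succ m ih =>
    match nds, h, hri with
    | [nd], h, hri =>
      refine ⟨fillCost ix [] nd + (nd.levels.map fun lv => loopCost lv.bound lv.val).sum + 10,
        fun B n N X c β σ ws hN hnN hB h3 h0 hok hX hX1 hans => ?_⟩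
      obtain _ | ⟨hnd, hnil⟩ := hok
      rename_i w ws
      obtain rfl := List.forall₂_nil_left_iff.1 hnil
      have e0 : allVerts [nd] = nd.verts.toFinset := by
        ext v
        simp [mem_allVerts]
      simp only [e0, List.map_cons, List.map_nil, List.prod_cons, List.prod_nil, mul_one]
        at hans ⊢
      rw [sumNodes]
      have hf := (Wp.fill hix hN hnN hnd (keys := []) (by simp) (by simp)
        (by simpa [budget] using hB) h3 (h0 t le_rfl (by simp))).mono
        (nestTime_le_mul (hX _ (by simp)) _) fun _ _ h => h
      refine Wp.seq (T₂ := 10 * X) hf (fun τ hag hτ => ?_) (by rw [← add_mul])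
      have h1 := hτ 0 (by simp)
      simp only [List.map_nil, tupleCode, List.toFinset_nil, Finset.sdiff_empty] at h1
      have h2 : τ.reg 0 = σ.reg 0 := hag.reg 0 fun hi => by
        have := le_of_mem_regs_nest rfl hi
        omega
      refine Wp.assign ?_ ?_ ?_
      · simpa [h1, h2] using hans
      · simp only [Expr.cost_add, Expr.cost_reg, Expr.cost_arr, Expr.cost_const]
        omega
      · simp [h1, h2]
    | nd :: nd' :: nds, h, hri =>
      set rest := nd' :: nds with hrest
      set keys := sharedKeys nd rest with hkeysdef
      set d := nd.deg + nd.verts.length with hd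
      set S := nd.verts.toFinset \ keys.toFinset with hS
      set e := Expr.arr t (codeExpr ix keys) with he
      have hkeys : ∀ v, v ∈ keys ↔ v ∈ nd.verts ∧ ∃ nd' ∈ rest, v ∈ nd'.verts := by
        simp [hkeysdef, sharedKeys]
      have hne' : attach keys e d rest ≠ [] := by
        intro h0
        have := length_attach keys e d rest
        rw [h0, hrest] at this
        simp at this
      have hex : ∃ nd ∈ rest, ∀ v ∈ keys, v ∈ nd.verts := by
        rw [List.map_cons] at hri
        rcases hri.1 with h0 | ⟨R, hR, h0⟩
        · simp [hrest] at h0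
        · obtain ⟨nd₁, hnd₁, rfl⟩ := List.mem_map.1 hR
          refine ⟨nd₁, hnd₁, fun v hv => ?_⟩
          obtain ⟨a1, nd₂, a2, a3⟩ := (hkeys v).1 hv
          exact h0 v a1 ⟨nd₂.verts, List.mem_map_of_mem a2, a3⟩
      have hlen : rest.length = m := by simpa using h
      obtain ⟨C, hC⟩ := ih (t + 1) (attach keys e d rest) hne'
        (by rw [map_verts_attach]; exact hri.2) (by rw [length_attach, hlen])
      refine ⟨fillCost ix keys nd + (nd.levels.map fun lv => loopCost lv.bound lv.val).sum + C,
        fun B n N X c β σ ws hN hnN hB h3 h0 hok hX hX1 hans => ?_⟩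
      obtain _ | ⟨hnd, hrok⟩ := hok
      rename_i w ws
      have hbud : budget (nd :: rest) = budget rest + d := by
        simp only [budget, List.map_cons, List.sum_cons, hd]
        omega
      have hklen : keys.length ≤ nd.verts.length := List.length_filter_le _ _
      have hdB : N ^ (d + 1) ≤ B :=
        le_trans (Nat.pow_le_pow_right (by omega) (by omega)) hB
      have hf := (Wp.fill hix hN hnN hnd (fun v hv => ((hkeys v).1 hv).1) hklen hdB h3
        (h0 t le_rfl (by simp))).mono (nestTime_le_mul (hX _ (by simp)) _) fun _ _ h => h
      set M := marginal n S w with hMdef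
      -- The sum over the remaining nodes, with the table as an additional factor.
      have hUS : allVerts (nd :: rest) = S ∪ allVerts rest := by
        ext v
        simp only [hS, mem_allVerts, Finset.mem_union, Finset.mem_sdiff, List.mem_toFinset, hkeys,
          List.mem_cons, exists_eq_or_imp]
        tauto
      have hdisj : Disjoint S (allVerts rest) := by
        rw [Finset.disjoint_left]
        intro v hv hv'
        simp only [hS, Finset.mem_sdiff, List.mem_toFinset, hkeys] at hv
        exact hv.2 ⟨hv.1, mem_allVerts.1 hv'⟩
      have hmarg : marginal n (allVerts (nd :: rest))
          (fun f => ((w :: ws).map fun w => w f).prod) 0 =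
          marginal n (allVerts rest) (fun f => M f * (ws.map fun w => w f).prod) 0 := by
        rw [hUS, marginal_union n hdisj]
        refine marginal_congr fun φ _ _ => ?_
        simp only [List.map_cons, List.prod_cons]
        exact marginal_mul n φ fun ψ hψ => prod_depends hrok fun v hv =>
          hψ v (Finset.disjoint_right.1 hdisj hv)
      have hMk : ∀ f g, (∀ v ∈ keys, f v = g v) → M f = M g := by
        intro f g hfg
        have hloc : ∀ φ ψ : V → ℕ, (∀ v ∈ nd.verts.toFinset, φ v = ψ v) → w φ = w ψ :=
          fun φ ψ h => hnd.depends φ ψ fun v hv => h v (List.mem_toFinset.2 hv)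
        refine marginal_local n hloc fun v hv hv' => hfg v ?_
        by_contra h
        exact hv' (Finset.mem_sdiff.2 ⟨hv, by simpa using h⟩)
      have hM : ∀ f, (∀ v ∈ keys, f v < n) → M f ≤ N ^ d := by
        intro f hf
        have h1 : M f ≤ n ^ S.card * N ^ nd.deg := by
          refine marginal_le n fun φ hφ hφ' => hnd.le φ fun v hv => ?_
          by_cases hvS : v ∈ S
          · exact hφ v hvS
          · rw [hφ' v hvS]
            refine hf v ?_
            by_contra h
            exact hvS (Finset.mem_sdiff.2 ⟨by simpa using hv, by simpa using h⟩)
        have h2 : n ^ S.card ≤ N ^ nd.verts.length :=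
          (Nat.pow_le_pow_left hnN _).trans (Nat.pow_le_pow_right (by omega)
            ((Finset.card_le_card Finset.sdiff_subset).trans (List.toFinset_card_le _)))
        calc _ ≤ N ^ nd.verts.length * N ^ nd.deg := h1.trans (Nat.mul_le_mul_right _ h2)
          _ = N ^ d := by rw [← pow_add, add_comm]
      rw [hmarg] at hans ⊢
      rw [hrest, sumNodes]
      refine Wp.seq (T₂ := C * X) hf (fun τ hag hτ => ?_) (by rw [← add_mul])
      have hreg : ∀ i < 100, τ.reg i = σ.reg i := fun i hi => hag.reg i fun hi => by
        have := le_of_mem_regs_nest rfl hi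
        omega
      have harr : ∀ k, k ≠ t → τ.arr k = σ.arr k := fun k hk => hag.arr k (by simpa [fill] using hk)
      have hst : Static σ t τ := ⟨fun i _ hi => hreg i hi, fun k hk => harr k (by omega)⟩
      have t3 : τ.reg 3 = N := (hreg 3 (by omega)).trans h3
      obtain ⟨ws', hws', hprod⟩ := exists_nodeOk_attach (P := Static τ (t + 1)) (e := e) hMk hM
        (B := B) (ix := ix) (by
          intro υ f hυ hf
          have u3 : υ.reg 3 = N := (hυ.reg 3 (by omega) (by omega)).trans t3
          refine ⟨ok_codeExpr u3 hN (fun u hu => ⟨(hf u hu).1, (hf u hu).2.trans_le hnN⟩)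
            (le_trans (Nat.pow_le_pow_right (by omega) (by omega)) hdB), ?_⟩
          rw [he, Expr.eval_arr, eval_codeExpr u3 fun u hu => (hf u hu).1, hυ.arr t (by omega)]
          exact hτ f fun v hv => (hf v hv).2)
        hN (hbud ▸ hB) (hrok.imp fun _ _ h => h.mono fun υ hυ => hst.trans hυ (by omega)) hex
      have hfun : (fun f => M f * (ws.map fun w => w f).prod) =
          fun f => (ws'.map fun w => w f).prod := funext fun f => (hprod f).symm
      rw [hfun, ← hreg 0 (by omega), ← allVerts_attach keys e d rest] at hans ⊢
      refine hC B n N X c β τ ws' hN hnN ?_ t3 ?_ hws' ?_ hX1 hans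
      · rw [budget_attach e d hex, ← hbud]
        exact hB
      · intro k hk hk' a
        rw [harr k (by omega)]
        exact h0 k (by omega) (by omega) a
      · rw [map_levels_attach]
        exact fun ls hls => hX ls (by simp [hls])

end ArrayMachine

/-! ### Nodes that enumerate partial homomorphisms -/

namespace ArrayMachine

variable {V : Type*}

open scoped Classical in
/-- The truth value of a proposition, as a number. -/
noncomputable def truth (p : Prop) : ℕ := if p then 1 else 0

theorem truth_of {p : Prop} (h : p) : truth p = 1 := if_pos h

theorem truth_of_not {p : Prop} (h : ¬ p) : truth p = 0 := if_neg h

theorem truth_le_one (p : Prop) : truth p ≤ 1 := by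
  by_cases h : p
  · rw [truth_of h]
  · rw [truth_of_not h]
    exact zero_le_one

theorem truth_and (p q : Prop) : truth (p ∧ q) = truth p * truth q := by
  by_cases hp : p <;> by_cases hq : q <;> simp [truth, hp, hq]

/-- Conditions on an assignment of vertices of `G` to elements of `V`. -/
inductive Test (V : Type*) where
  /-- The value of `v` is in the adjacency list of the value of `u`. -/
  | near (u v : V)
  /-- The value of `u` comes before that of `v`, by decreasing key and with ties broken by `ix`. -/
  | before (u v : V)
  /-- The values form a hyperedge. -/
  | edge (us : List V)

/-- The elements of `V` on which a condition depends. -/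
def Test.verts : Test V → List V
  | near u v => [u, v]
  | before u v => [u, v]
  | edge us => us

/-- An expression for the truth value of a condition. -/
def Test.expr (ix : V → ℕ) : Test V → Expr
  | near u v => .arr 2 (pair (.reg (vreg ix u)) (.reg (vreg ix v)))
  | before u v => if ix u < ix v
      then .const 1 - .lt (.arr 1 (.reg (vreg ix u))) (.arr 1 (.reg (vreg ix v)))
      else .lt (.arr 1 (.reg (vreg ix v))) (.arr 1 (.reg (vreg ix u)))
  | edge us => .arr 5 (codeExpr ix us)

/-- The order of the elements of `V` that is induced by an assignment `f`: by decreasing key of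
their values, with ties broken by `ix`. -/
def Precedes (ix : V → ℕ) (key : ℕ → ℕ) (f : V → ℕ) (u v : V) : Prop :=
  key (f v) < key (f u) ∨ key (f u) = key (f v) ∧ ix u < ix v

/-- The meaning of a condition. -/
def Test.Holds (ix : V → ℕ) (key : ℕ → ℕ) (close : ℕ → ℕ → Prop) (isEdge : List ℕ → Prop)
    (f : V → ℕ) : Test V → Prop
  | near u v => close (f u) (f v)
  | before u v => Precedes ix key f u v
  | edge us => isEdge (us.map f)

/-- The tables that are needed for the enumeration of partial homomorphisms. -/
structure Prepared (B n N ρ D : ℕ) (close : ℕ → ℕ → Prop) (nbr : ℕ → List ℕ)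
    (isEdge : List ℕ → Prop) (σ : State) : Prop where
  layout : Layout B n N ρ σ
  vertices : σ.reg 1 = n
  table : Tabulates N ρ close nbr σ
  lt : ∀ x y, close x y → y < n
  few : ∀ x < n, (nbr x).length ≤ D
  dict : HasDict N isEdge σ.arr

section

variable {B n N ρ D t : ℕ} {close : ℕ → ℕ → Prop} {nbr : ℕ → List ℕ} {isEdge : List ℕ → Prop}
  {σ : State} {ix : V → ℕ}

theorem Test.expr_ok (hσ : Prepared B n N ρ D close nbr isEdge σ) (hN : 2 ≤ N) (ht : 6 ≤ t)
    (T : Test V) (hT : N ^ (T.verts.length + 1) ≤ B) {τ : State} (hτ : Static σ t τ) {f : V → ℕ}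
    (hf : ∀ u ∈ T.verts, τ.reg (vreg ix u) = f u ∧ f u < n) :
    (T.expr ix).Ok B τ ∧
      (T.expr ix).eval τ = truth (T.Holds ix (σ.arr 1) close isEdge f) := by
  have hl := hσ.layout
  have hn := hl.lt
  have t3 : τ.reg 3 = N := (hτ.reg 3 (by omega) (by omega)).trans hl.base
  have t4 : τ.reg 4 = ρ := (hτ.reg 4 (by omega) (by omega)).trans hl.round
  cases T with
  | near u v =>
    obtain ⟨hu, hun⟩ := hf u (by simp [Test.verts])
    obtain ⟨hv, hvn⟩ := hf v (by simp [Test.verts])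
    have h1 := slot_lt hl.round_lt (show f u < N by omega)
    have h2 : (ρ * N + f u) * N + N ≤ N * N * N := by nlinarith
    have h3 : N * N ≤ N * N * N := Nat.le_mul_of_pos_right _ (by omega)
    have hb := hl.bound
    simp only [Test.expr, pair, slot, Expr.ok_arr, Expr.ok_add, Expr.ok_mul, Expr.ok_reg,
      Expr.eval_arr, Expr.eval_add, Expr.eval_mul, Expr.eval_reg, t3, t4, hu, hv,
      hτ.arr 2 (by omega), Test.Holds, true_and]
    refine ⟨⟨⟨⟨by omega, by omega⟩, by omega⟩, by omega⟩, ?_⟩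
    by_cases h : close (f u) (f v)
    · rw [truth_of h, hσ.table.mark_one _ (by omega) _ (by omega) h]
    · rw [truth_of_not h, hσ.table.mark_zero _ (by omega) _ (by omega) h]
  | before u v =>
    obtain ⟨hu, hun⟩ := hf u (by simp [Test.verts])
    obtain ⟨hv, hvn⟩ := hf v (by simp [Test.verts])
    simp only [Test.expr, Test.Holds, Precedes]
    split_ifs with h
    · simp only [Expr.ok_sub, Expr.ok_const, Expr.ok_lt, Expr.ok_arr, Expr.ok_reg, Expr.eval_sub,
        Expr.eval_const, Expr.eval_lt, Expr.eval_arr, Expr.eval_reg, hu, hv, hτ.arr 1 (by omega),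
        true_and, and_true, truth]
      split_ifs <;> omega
    · simp only [Expr.ok_lt, Expr.ok_arr, Expr.ok_reg,
        Expr.eval_lt, Expr.eval_arr, Expr.eval_reg, hu, hv, hτ.arr 1 (by omega),
        true_and, truth]
      split_ifs <;> omega
  | edge us =>
    have hus : ∀ u ∈ us, τ.reg (vreg ix u) = f u ∧ f u < N := fun u hu =>
      ⟨(hf u hu).1, (hf u hu).2.trans hn⟩
    refine ⟨ok_codeExpr t3 hN hus hT, ?_⟩
    simp only [Test.expr, Expr.eval_arr, eval_codeExpr t3 fun u hu => (hus u hu).1, Test.Holds]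
    rw [hτ.arr 5 (by omega)]
    have h1 := hσ.dict (us.map f) (by
      intro x hx
      obtain ⟨u, hu, rfl⟩ := List.mem_map.1 hx
      exact (hus u hu).2)
    by_cases h : isEdge (us.map f)
    · rw [truth_of h, h1.1 h]
    · rw [truth_of_not h, h1.2 h]

/-- An expression for the truth value of the conjunction of conditions. -/
def testsExpr (ix : V → ℕ) : List (Test V) → Expr
  | [] => .const 1
  | T :: Ts => T.expr ix * testsExpr ix Ts

theorem testsExpr_ok (hσ : Prepared B n N ρ D close nbr isEdge σ) (hN : 2 ≤ N) (ht : 6 ≤ t)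
    {Ts : List (Test V)} (hTs : ∀ T ∈ Ts, N ^ (T.verts.length + 1) ≤ B) {τ : State}
    (hτ : Static σ t τ) {f : V → ℕ}
    (hf : ∀ T ∈ Ts, ∀ u ∈ T.verts, τ.reg (vreg ix u) = f u ∧ f u < n) :
    (testsExpr ix Ts).Ok B τ ∧ (testsExpr ix Ts).eval τ =
      truth (∀ T ∈ Ts, T.Holds ix (σ.arr 1) close isEdge f) := by
  induction Ts with
  | nil => exact ⟨trivial, (truth_of (by simp)).symm⟩
  | cons T Ts ih =>
    obtain ⟨h1, h2⟩ := ih (fun T hT => hTs T (by simp [hT])) fun T hT => hf T (by simp [hT])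
    obtain ⟨h3, h4⟩ := T.expr_ok hσ hN ht (hTs T (by simp)) hτ (hf T (by simp))
    simp only [testsExpr, Expr.ok_mul, Expr.eval_mul, h2, h4, List.forall_mem_cons, truth_and]
    refine ⟨⟨h3, h1, ?_⟩, trivial⟩
    have hB : 8 < B := by
      have := hσ.layout.bound
      have : 2 * 2 * 2 ≤ N * N * N := by gcongr
      omega
    calc _ ≤ 1 * 1 := Nat.mul_le_mul (truth_le_one _) (truth_le_one _)
      _ < B := by omega

/-- The loop over the values of `v`: over all vertices, or over the adjacency list of the value
of an earlier element. -/
def mkLevel (ix : V → ℕ) (v : V) : Option V → Level V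
  | none => ⟨v, none, .reg 1, .reg (ireg ix v)⟩
  | some u => ⟨v, some u, .arr 3 (slot (.reg (vreg ix u))),
      .arr 4 (pair (.reg (vreg ix u)) (.reg (ireg ix v)))⟩

/-- The values visited by a loop. -/
def levelValues (n : ℕ) (nbr : ℕ → List ℕ) (lv : Level V) (f : V → ℕ) : List ℕ :=
  match lv.src with
  | none => List.range n
  | some u => nbr (f u)

/-- The number of rounds of a loop. -/
def levelBound (n D : ℕ) (lv : Level V) : ℕ :=
  match lv.src with
  | none => n
  | some _ => D

/-- The description of a node: its elements, for each of them an earlier one whose adjacency list is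
searched, if there is one, and the conditions to be verified. -/
structure Cell (V : Type*) where
  verts : List V
  src : V → Option V
  tests : List (Test V)

/-- The node described by a cell. -/
def Cell.node (ix : V → ℕ) (q : Cell V) : Node V where
  levels := q.verts.map fun v => mkLevel ix v (q.src v)
  weight := testsExpr ix q.tests
  deg := 0

theorem mkLevel_v (ix : V → ℕ) (v : V) (o : Option V) : (mkLevel ix v o).v = v := by
  cases o <;> rfl

theorem mkLevel_src (ix : V → ℕ) (v : V) (o : Option V) : (mkLevel ix v o).src = o := by
  cases o <;> rfl

theorem Cell.verts_node (ix : V → ℕ) (q : Cell V) : (q.node ix).verts = q.verts := by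
  simp [Cell.node, Node.verts, Function.comp_def, mkLevel_v]

/-- Sources come earlier, and searching the adjacency list of the source loses nothing. -/
structure Cell.Valid (q : Cell V) : Prop where
  nodup : q.verts.Nodup
  src_mem : ∀ pre v post u, q.verts = pre ++ v :: post → q.src v = some u → u ∈ pre
  near_mem : ∀ v ∈ q.verts, ∀ u, q.src v = some u → Test.near u v ∈ q.tests
  tests_sub : ∀ T ∈ q.tests, ∀ v ∈ T.verts, v ∈ q.verts

theorem mkLevel_ok (hσ : Prepared B n N ρ D close nbr isEdge σ) (ht : 6 ≤ t) (v : V)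
    (o : Option V) {τ : State} {f : V → ℕ} (hτ : Static σ t τ)
    (ho : ∀ u, o = some u → τ.reg (vreg ix u) = f u ∧ f u < n) :
    (mkLevel ix v o).bound.Ok B τ ∧
      (mkLevel ix v o).bound.eval τ = (levelValues n nbr (mkLevel ix v o) f).length ∧
      (levelValues n nbr (mkLevel ix v o) f).length < B ∧
      (levelValues n nbr (mkLevel ix v o) f).length ≤ levelBound n D (mkLevel ix v o) ∧
      (∀ x ∈ levelValues n nbr (mkLevel ix v o) f, x < n) ∧
      ∀ i (h : i < (levelValues n nbr (mkLevel ix v o) f).length), τ.reg (ireg ix v) = i →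
        (mkLevel ix v o).val.Ok B τ ∧
        (mkLevel ix v o).val.eval τ = (levelValues n nbr (mkLevel ix v o) f)[i] := by
  have hl := hσ.layout
  have hn := hl.lt
  have hNB : N ≤ N * N * N := by
    rw [mul_assoc]
    exact Nat.le_mul_of_pos_right _ (Nat.mul_pos (by omega) (by omega))
  have hb := hl.bound
  cases o with
  | none =>
    simp only [mkLevel, levelValues, levelBound, List.length_range, Expr.ok_reg, Expr.eval_reg,
      List.mem_range, true_and, List.getElem_range, imp_self, implies_true, and_true, le_refl]
    refine ⟨?_, by omega⟩
    rw [hτ.reg 1 (by omega) (by omega)]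
    exact hσ.vertices
  | some u =>
    obtain ⟨hu1, hu2⟩ := ho u rfl
    have hlen := hσ.table.length_lt hσ.lt hn (f u)
    have h1 := slot_lt hl.round_lt (show f u < N by omega)
    have h2 : (ρ * N + f u) * N + N ≤ N * N * N := by nlinarith
    have h3 : N * N ≤ N * N * N := Nat.le_mul_of_pos_right _ (by omega)
    have t3 : τ.reg 3 = N := (hτ.reg 3 (by omega) (by omega)).trans hl.base
    have t4 : τ.reg 4 = ρ := (hτ.reg 4 (by omega) (by omega)).trans hl.round
    simp only [mkLevel, levelValues, levelBound, pair, slot, Expr.ok_arr, Expr.ok_add,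
      Expr.ok_mul, Expr.ok_reg, Expr.eval_arr, Expr.eval_add, Expr.eval_mul, Expr.eval_reg,
      t3, t4, hu1, hτ.arr 3 (by omega), hτ.arr 4 (by omega), true_and]
    refine ⟨⟨by omega, by omega⟩, hσ.table.deg _ (by omega), by omega, hσ.few _ hu2, ?_, ?_⟩
    · intro x hx
      exact hσ.lt _ _ ((hσ.table.mem _ _).1 hx)
    · intro i hi hri
      rw [hri]
      refine ⟨⟨⟨⟨by omega, by omega⟩, by omega⟩, by omega⟩, ?_⟩
      exact hσ.table.adj _ (by omega) i hi

theorem levelsOk_mkLevel (hσ : Prepared B n N ρ D close nbr isEdge σ) (ht : 6 ≤ t)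
    (src : V → Option V) (vs ds : List V)
    (hsrc : ∀ pre v post u, vs = pre ++ v :: post → src v = some u → u ∈ ds ∨ u ∈ pre) :
    LevelsOk B n ix (Static σ t) (levelValues n nbr) (levelBound n D) ds
      (vs.map fun v => mkLevel ix v (src v)) := by
  induction vs generalizing ds with
  | nil => trivial
  | cons v vs ih =>
    refine ⟨fun τ f hτ hf => ?_, ?_⟩
    · rw [mkLevel_v]
      refine mkLevel_ok hσ ht v (src v) hτ fun u hu => hf u ?_
      rcases hsrc [] v vs u rfl hu with h | h
      · exact h
      · simp at h
    · rw [mkLevel_v]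
      refine ih _ fun pre w post u h hw => ?_
      rcases hsrc (v :: pre) w post u (by rw [h]; rfl) hw with h | h
      · exact Or.inl (by simp [h])
      · rcases List.mem_cons.1 h with rfl | h
        · exact Or.inl (by simp)
        · exact Or.inr h

theorem valuesOk_mkLevel (hσ : Prepared B n N ρ D close nbr isEdge σ) {W : (V → ℕ) → ℕ}
    (src : V → Option V) (vs ds : List V)
    (hsrc : ∀ pre v post u, vs = pre ++ v :: post → src v = some u → u ∈ ds ∨ u ∈ pre)
    (hW : ∀ f, ∀ v ∈ vs, ¬ f v < n → W f = 0)
    (hW' : ∀ f, ∀ v ∈ vs, ∀ u, src v = some u → ¬ close (f u) (f v) → W f = 0) :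
    ValuesOk n (levelValues n nbr) W ds (vs.map fun v => mkLevel ix v (src v)) := by
  induction vs generalizing ds with
  | nil => trivial
  | cons v vs ih =>
    refine ⟨?_, ?_, ?_, ?_, ?_⟩
    · intro f g hfg
      simp only [levelValues, mkLevel_src]
      cases hv : src v with
      | none => rfl
      | some u =>
        rcases hsrc [] v vs u rfl hv with h | h
        · simp only [hfg u h]
        · simp at h
    · intro f
      simp only [levelValues, mkLevel_src]
      cases src v with
      | none => exact List.nodup_range
      | some u => exact hσ.table.nodup _
    · intro f x
      simp only [levelValues, mkLevel_src]
      cases src v with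
      | none => simp
      | some u =>
        intro hx
        exact hσ.lt _ _ ((hσ.table.mem _ _).1 hx)
    · intro f
      simp only [levelValues, mkLevel_src, mkLevel_v]
      cases hv : src v with
      | none =>
        intro h
        exact hW f v (by simp) (by simpa using h)
      | some u =>
        intro h
        exact hW' f v (by simp) u hv (by rwa [← hσ.table.mem])
    · rw [mkLevel_v]
      refine ih _ (fun pre w post u h hw => ?_) (fun f w hw => hW f w (by simp [hw]))
        fun f w hw => hW' f w (by simp [hw])
      rcases hsrc (v :: pre) w post u (by rw [h]; rfl) hw with h | h
      · exact Or.inl (by simp [h])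
      · rcases List.mem_cons.1 h with rfl | h
        · exact Or.inl (by simp)
        · exact Or.inr h

/-- The weight computed by a cell. -/
noncomputable def Cell.weight (n : ℕ) (ix : V → ℕ) (key : ℕ → ℕ) (close : ℕ → ℕ → Prop)
    (isEdge : List ℕ → Prop) (q : Cell V) (f : V → ℕ) : ℕ :=
  truth ((∀ v ∈ q.verts, f v < n) ∧ ∀ T ∈ q.tests, T.Holds ix key close isEdge f)

theorem Test.holds_congr {key : ℕ → ℕ} {f g : V → ℕ} {T : Test V}
    (h : ∀ v ∈ T.verts, f v = g v) :
    T.Holds ix key close isEdge f ↔ T.Holds ix key close isEdge g := by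
  cases T with
  | near u v =>
    simp only [Test.Holds, h u (by simp [Test.verts]), h v (by simp [Test.verts])]
  | before u v =>
    simp only [Test.Holds, Precedes, h u (by simp [Test.verts]), h v (by simp [Test.verts])]
  | edge us =>
    simp only [Test.Holds]
    rw [List.map_congr_left (l := us) h]

/-- The loops of a cell lose nothing: the values that they omit fail one of its tests. -/
theorem Cell.nodeOk (hσ : Prepared B n N ρ D close nbr isEdge σ) (hN : 2 ≤ N) (ht : 6 ≤ t)
    {q : Cell V} (hq : q.Valid) (hB : ∀ T ∈ q.tests, N ^ (T.verts.length + 1) ≤ B) :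
    NodeOk B n N ix (Static σ t) (levelValues n nbr) (levelBound n D) (q.node ix)
      (q.weight n ix (σ.arr 1) close isEdge) where
  nodup := by
    rw [q.verts_node]
    exact hq.nodup
  levels := levelsOk_mkLevel hσ ht _ _ _ fun pre v post u h hv =>
    Or.inr (hq.src_mem pre v post u h hv)
  values := valuesOk_mkLevel hσ _ _ _
    (fun pre v post u h hv => Or.inr (hq.src_mem pre v post u h hv))
    (fun f v hv hfv => truth_of_not fun h => hfv (h.1 v hv))
    fun f v hv u hu hfv => truth_of_not fun h => hfv (h.2 _ (hq.near_mem v hv u hu))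
  depends f g hfg := by
    rw [q.verts_node] at hfg
    unfold Cell.weight
    congr 1
    refine propext (and_congr ?_ ?_)
    · exact forall₂_congr fun v hv => by rw [hfg v hv]
    · exact forall₂_congr fun T hT => Test.holds_congr fun v hv => hfg v (hq.tests_sub T hT v hv)
  weight τ f hτ hf := by
    rw [q.verts_node] at hf
    have := testsExpr_ok hσ hN ht hB hτ fun T hT u hu => hf u (hq.tests_sub T hT u hu)
    refine ⟨this.1, this.2.trans ?_⟩
    unfold Cell.weight
    rw [truth_and, truth_of fun v hv => (hf v hv).2, one_mul]
  le f _ := by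
    simp only [Cell.node, pow_zero]
    exact truth_le_one _

end

theorem prod_levelBound_le (n D : ℕ) (ix : V → ℕ) (q : Cell V) :
    ((q.node ix).levels.map fun lv => levelBound n D lv + 1).prod ≤
      (n + 1) ^ (q.verts.countP fun v => (q.src v).isNone) * (D + 1) ^ q.verts.length := by
  simp only [Cell.node, List.map_map]
  induction q.verts with
  | nil => simp
  | cons v vs ih =>
    rw [List.map_cons, List.prod_cons, List.countP_cons, List.length_cons]
    cases hv : q.src v with
    | none =>
      simp only [Function.comp_apply, levelBound, mkLevel_src, hv, Option.isNone_none, if_true,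
        pow_succ]
      calc _ ≤ (n + 1) * ((n + 1) ^ (vs.countP fun v => (q.src v).isNone) * (D + 1) ^ vs.length) :=
            Nat.mul_le_mul_left _ ih
        _ ≤ (n + 1) * ((n + 1) ^ (vs.countP fun v => (q.src v).isNone) * (D + 1) ^ vs.length) *
            (D + 1) := Nat.le_mul_of_pos_right _ (by omega)
        _ = _ := by ring
    | some u =>
      simp only [Function.comp_apply, levelBound, mkLevel_src, hv, Option.isNone_some,
        Bool.false_eq_true, if_false, add_zero, pow_succ]
      calc _ ≤ (D + 1) * ((n + 1) ^ (vs.countP fun v => (q.src v).isNone) * (D + 1) ^ vs.length) :=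
            Nat.mul_le_mul_left _ ih
        _ = _ := by ring

end ArrayMachine

/-! ### The running intersection property of tree decompositions -/

namespace ArrayMachine

/-- In a rooted tree, the neighbour `p` of `i` that is closer to the root lies on every path from
`i` to a vertex `j ≠ i` that is not farther from the root. -/
theorem mem_support_of_dist_le {T : Type*} {G : SimpleGraph T} (hG : G.IsTree) {root i p j : T}
    (hip : G.Adj i p) (hp : G.dist root p < G.dist root i) (hij : i ≠ j)
    (hj : G.dist root j ≤ G.dist root i) (w : G.Walk i j) : p ∈ w.support := by
  have avoid : ∀ x, x ≠ i → G.dist root x ≤ G.dist root i →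
      ∃ q : G.Walk root x, i ∉ q.support := by
    intro x hx hxi
    obtain ⟨q, hq⟩ := hG.connected.exists_walk_length_eq_dist root x
    refine ⟨q, fun hi => hx ?_⟩
    classical
    have h1 := congrArg SimpleGraph.Walk.length (q.take_spec hi)
    rw [SimpleGraph.Walk.length_append, hq] at h1
    have h2 := SimpleGraph.dist_le (q.takeUntil i hi)
    have h3 : (q.dropUntil i hi).length = 0 := by omega
    exact (SimpleGraph.Walk.eq_of_length_eq_zero h3).symm
  obtain ⟨q₁, hq₁⟩ := avoid j hij.symm hj
  obtain ⟨q₂, hq₂⟩ := avoid p hip.ne' hp.le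
  -- The edge between `i` and `p` is a bridge, and it is on no path to the root from `j` or `p`.
  have hb := SimpleGraph.isAcyclic_iff_forall_isBridge.1 hG.isAcyclic
    ((SimpleGraph.mem_edgeSet G).2 hip)
  rw [SimpleGraph.isBridge_iff_forall_walk_mem_edges] at hb
  have h := hb (w.append (q₁.reverse.append q₂))
  simp only [SimpleGraph.Walk.edges_append, List.mem_append, SimpleGraph.Walk.edges_reverse,
    List.mem_reverse] at h
  rcases h with h | h | h
  · exact w.snd_mem_support_of_mem_edges h
  · exact absurd (q₁.fst_mem_support_of_mem_edges h) hq₁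
  · exact absurd (q₂.fst_mem_support_of_mem_edges h) hq₂

theorem exists_adj_dist_lt {T : Type*} {G : SimpleGraph T} (hG : G.Connected) {root i : T}
    (h : i ≠ root) : ∃ p, G.Adj i p ∧ G.dist root p < G.dist root i := by
  obtain ⟨q, hq⟩ := hG.exists_walk_length_eq_dist i root
  cases q with
  | nil => exact absurd rfl h
  | @cons _ p _ hip q =>
    refine ⟨p, hip, ?_⟩
    have := SimpleGraph.dist_le q
    rw [SimpleGraph.Walk.length_cons] at hq
    rw [SimpleGraph.dist_comm, SimpleGraph.dist_comm (u := root)]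
    omega

/-- In an order by decreasing distance from the root, all later nodes are outside the subtree below the
current node, so whatever it shares with them is also in the bag of its parent. The last hypothesis
makes the parent appear in the list. -/
theorem runningIntersection_of_isTree {V T : Type*} {G : SimpleGraph T} (hG : G.IsTree) (root : T)
    (R : T → List V) (hR : ∀ (i j : T) (w : G.Walk i j), w.IsPath → ∀ b ∈ w.support,
      ∀ v ∈ R i, v ∈ R j → v ∈ R b) (l : List T) (hnd : l.Nodup)
    (hl : l.Pairwise fun a b => G.dist root b ≤ G.dist root a)
    (hall : ∀ x, x ∈ l ∨ ∀ y ∈ l, G.dist root y ≤ G.dist root x) :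
    RunningIntersection (l.map R) := by
  induction l with
  | nil => trivial
  | cons i l ih =>
    rw [List.pairwise_cons] at hl
    rw [List.nodup_cons] at hnd
    refine ⟨?_, ih hnd.2 hl.2 fun x => ?_⟩
    · by_cases hi : i = root
      · left
        subst hi
        rw [List.map_eq_nil_iff, List.eq_nil_iff_forall_not_mem]
        intro j hj
        have := hl.1 j hj
        rw [SimpleGraph.dist_self, Nat.le_zero, hG.connected.dist_eq_zero_iff] at this
        subst this
        exact hnd.1 hj
      · right
        obtain ⟨p, hip, hp⟩ := exists_adj_dist_lt hG.connected hi
        have hpl : p ∈ l := by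
          rcases hall p with h | h
          · exact List.mem_of_ne_of_mem hip.ne' h
          · exact absurd (h i (by simp)) (by omega)
        refine ⟨R p, List.mem_map_of_mem hpl, ?_⟩
        rintro v hv ⟨_, hRj, hvj⟩
        obtain ⟨j, hj, rfl⟩ := List.mem_map.1 hRj
        obtain ⟨w, hw⟩ := hG.connected.exists_isPath i j
        exact hR i j w hw p (mem_support_of_dist_le hG hip hp (fun h => hnd.1 (h ▸ hj))
          (hl.1 j hj) w) v hv hvj
    · rcases hall x with h | h
      · rcases List.mem_cons.1 h with rfl | h
        · exact Or.inr hl.1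
        · exact Or.inl h
      · exact Or.inr fun y hy => h y (by simp [hy])

/-- The nodes of a rooted tree can be ordered in such a way that the lists attached to them have
the running intersection property. -/
theorem exists_runningIntersection {V : Type*} {k : ℕ} {G : SimpleGraph (Fin k)} (hG : G.IsTree)
    (root : Fin k) (R : Fin k → List V) (hR : ∀ (i j : Fin k) (w : G.Walk i j), w.IsPath →
      ∀ b ∈ w.support, ∀ v ∈ R i, v ∈ R j → v ∈ R b) :
    ∃ l : List (Fin k), (∀ i, i ∈ l) ∧ RunningIntersection (l.map R) := by
  have h1 : ((List.finRange k).mergeSort fun a b => decide (G.dist root b ≤ G.dist root a)).Perm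
      (List.finRange k) := List.mergeSort_perm _ _
  refine ⟨_, fun i => h1.mem_iff.2 (List.mem_finRange i),
    runningIntersection_of_isTree hG root R hR _ (h1.nodup_iff.2 (List.nodup_finRange k)) ?_
      fun x => Or.inl (h1.mem_iff.2 (List.mem_finRange x))⟩
  have h2 := List.pairwise_mergeSort (le := fun a b => decide (G.dist root b ≤ G.dist root a))
    (fun a b c h1 h2 => by simp at h1 h2 ⊢; omega) (fun a b => by simp; omega) (List.finRange k)
  exact h2.imp fun h => by simpa using h

end ArrayMachine

/-! ### Skeletons and their decompositions -/

namespace Digraph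

variable {V : Type*} {D : Digraph V}

theorem exists_adj_of_mem_reach {B : Set V} {v : V} (hv : v ∈ D.reach B) (hvB : v ∉ B) :
    ∃ u ∈ D.reach B, D.Adj u v := by
  obtain ⟨s, hs, hsv⟩ := hv
  rcases Relation.ReflTransGen.cases_tail hsv with h | ⟨u, hsu, huv⟩
  · exact absurd (h ▸ hs) hvB
  · exact ⟨u, ⟨s, hs, hsu⟩, huv⟩

theorem exists_source_of_lt {π : V → ℕ} (hπ : ∀ u v, D.Adj u v → π u < π v) (v : V) :
    ∃ s ∈ D.sources, Relation.ReflTransGen D.Adj s v := by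
  induction h : π v using Nat.strong_induction_on generalizing v with
  | _ k ih =>
    by_cases hv : v ∈ D.sources
    · exact ⟨v, hv, .refl⟩
    · simp only [sources, Set.mem_ofPred_eq, not_forall, not_not] at hv
      obtain ⟨u, hu⟩ := hv
      obtain ⟨s, hs, hsu⟩ := ih (π u) (h ▸ hπ u v hu) u rfl
      exact ⟨s, hs, hsu.tail hu⟩

theorem exists_width_eq_dagTreewidth [Finite V] (D : Digraph V) :
    ∃ T : D.DAGTreeDecomposition, T.width = D.dagTreewidth := by
  classical
  refine Nat.sInf_mem (s := {k : ℕ | ∃ T : D.DAGTreeDecomposition, T.width = k}) ⟨_, ?_, rfl⟩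
  have : Fintype V := Fintype.ofFinite V
  exact
    { size := 1
      tree := ⊥
      isTree := SimpleGraph.IsTree.of_subsingleton
      root := 0
      bag := fun _ => D.sources.toFinset
      bag_subset := fun _ => by simp
      covers := fun s hs => ⟨0, by simpa using hs⟩
      reach_inter := fun i j p _ b _ => by simp }

theorem one_le_dagTreewidth [Finite V] (D : Digraph V) {s : V} (hs : s ∈ D.sources) :
    1 ≤ D.dagTreewidth := by
  obtain ⟨T, hT⟩ := D.exists_width_eq_dagTreewidth
  obtain ⟨i, hi⟩ := T.covers s hs
  rw [← hT]
  exact (Finset.card_pos.2 ⟨s, hi⟩).trans_le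
    (Finset.le_sup (f := fun i => (T.bag i).card) (Finset.mem_univ i))

end Digraph

namespace Hypergraph

variable {α : Type*} {H : Hypergraph α} {l : ℕ∞}

theorem skeleton_dagTreewidth_le [Finite V(H)] (π : V(H) ≃ Fin V(H).ncard) :
    (H.skeleton l π).dagTreewidth ≤ H.dagTreewidth l :=
  le_ciSup (f := fun π : V(H) ≃ Fin V(H).ncard => (H.skeleton l π).dagTreewidth)
    (Set.finite_range _).bddAbove π

theorem lt_of_skeleton_adj {π : V(H) ≃ Fin V(H).ncard} {u v : V(H)}
    (h : (H.skeleton l π).Adj u v) : π u < π v := by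
  obtain ⟨e, -, -, -, h, -⟩ := h
  exact h

/-- The list `Es` contains an enumeration of each hyperedge, without repetition. -/
structure EnumeratesEdges (H : Hypergraph α) (Es : List (List V(H))) : Prop where
  nodup : ∀ us ∈ Es, us.Nodup
  ne_nil : ∀ us ∈ Es, us ≠ []
  exists_edge : ∀ us ∈ Es, ∃ e ∈ E(H), ∀ v : V(H), v ∈ us ↔ (v : α) ∈ e
  exists_list : ∀ e ∈ E(H), ∃ us ∈ Es, ∀ v : V(H), v ∈ us ↔ (v : α) ∈ e

theorem exists_enumeratesEdges [Finite V(H)] (hne : ∅ ∉ E(H)) :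
    ∃ Es, H.EnumeratesEdges Es := by
  classical
  have : Fintype V(H) := Fintype.ofFinite _
  have hfin : E(H).Finite := by
    refine (Set.toFinite V(H)).finite_subsets.subset fun e he => ?_
    exact H.subset_vertexSet_of_mem_edgeSet he
  have key : ∀ e : Set α, ∀ v : V(H), v ∈ (Finset.univ.filter fun v : V(H) => (v : α) ∈ e).toList ↔
      (v : α) ∈ e := by simp
  refine ⟨hfin.toFinset.toList.map fun e => (Finset.univ.filter fun v : V(H) => (v : α) ∈ e).toList,
    ?_, ?_, ?_, ?_⟩
  · intro us hus
    obtain ⟨e, -, rfl⟩ := List.mem_map.1 hus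
    exact Finset.nodup_toList _
  · intro us hus
    obtain ⟨e, he, rfl⟩ := List.mem_map.1 hus
    replace he : e ∈ E(H) := by simpa using he
    obtain ⟨x, hx⟩ := Set.nonempty_iff_ne_empty.2 fun h : e = ∅ => hne (h ▸ he)
    exact List.ne_nil_of_mem ((key e ⟨x, H.subset_vertexSet_of_mem_edgeSet he hx⟩).2 hx)
  · intro us hus
    obtain ⟨e, he, rfl⟩ := List.mem_map.1 hus
    exact ⟨e, by simpa using he, key e⟩
  · intro e he
    exact ⟨_, List.mem_map_of_mem (by simpa using he), key e⟩

/-- All vertices of a hyperedge are reachable from a common source of the skeleton. -/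
theorem EnumeratesEdges.exists_source {Es : List (List V(H))} (hEs : H.EnumeratesEdges Es)
    (π : V(H) ≃ Fin V(H).ncard) {us : List V(H)} (hus : us ∈ Es) :
    ∃ s ∈ (H.skeleton l π).sources, ∀ v ∈ us,
      Relation.ReflTransGen (H.skeleton l π).Adj s v := by
  obtain ⟨e, he, hue⟩ := hEs.exists_edge us hus
  obtain ⟨u, hu, hmin⟩ : ∃ u ∈ us, ∀ v ∈ us, π u ≤ π v := by
    classical
    obtain ⟨u, hu, hmin⟩ := us.toFinset.exists_min_image π
      (by simpa using hEs.ne_nil us hus)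
    exact ⟨u, by simpa using hu, fun v hv => hmin v (by simpa using hv)⟩
  obtain ⟨s, hs, hsu⟩ := Digraph.exists_source_of_lt (D := H.skeleton l π)
    (π := fun v => (π v : ℕ)) (fun u v h => lt_of_skeleton_adj h) u
  refine ⟨s, hs, fun v hv => ?_⟩
  by_cases huv : u = v
  · exact huv ▸ hsu
  · refine hsu.tail ⟨e, he, (hue u).1 hu, (hue v).1 hv,
      lt_of_le_of_ne (hmin v hv) fun h => huv (π.injective h), ?_⟩
    have : {x : V(H) | (x : α) ∈ e ∧ π x < π u} = ∅ := by
      rw [Set.eq_empty_iff_forall_notMem]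
      rintro x ⟨hx, hlt⟩
      exact absurd (hmin x ((hue x).2 hx)) (not_le.2 hlt)
    rw [this, Set.encard_empty]
    exact zero_le

end Hypergraph

namespace ArrayMachine

open Hypergraph

variable {α : Type*} {H : Hypergraph α} {l : ℕ∞}

/-- The values of `f` on the hyperedges of `H` are sets of entries of lists in `L`. -/
def MapsEdges (Es : List (List V(H))) (L : List (List ℕ)) (f : V(H) → ℕ) : Prop :=
  ∀ us ∈ Es, ∃ a ∈ L, ∀ x, x ∈ us.map f ↔ x ∈ a

/-- The order induced by `f` agrees with the ordering `π` within hyperedges. -/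
def Oriented (ix : V(H) → ℕ) (key : ℕ → ℕ) (Es : List (List V(H)))
    (π : V(H) ≃ Fin V(H).ncard) (f : V(H) → ℕ) : Prop :=
  ∀ us ∈ Es, ∀ u ∈ us, ∀ v ∈ us, π u < π v → Precedes ix key f u v

theorem Precedes.asymm {V : Type*} {ix : V → ℕ} {key : ℕ → ℕ} {f : V → ℕ} {u v : V}
    (h : Precedes ix key f u v) : ¬ Precedes ix key f v u := by
  unfold Precedes at *
  omega

/-- Arcs of the skeleton are mapped to pairs in the adjacency lists. -/
theorem close_of_adj {ix : V(H) → ℕ} {key : ℕ → ℕ} {Es : List (List V(H))} {L : List (List ℕ)}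
    {π : V(H) ≃ Fin V(H).ncard} {f : V(H) → ℕ} (hEs : H.EnumeratesEdges Es)
    (hL : ∀ a ∈ L, a.Nodup) (hf : MapsEdges Es L f) (ho : Oriented ix key Es π f) {u v : V(H)}
    (h : (H.skeleton l π).Adj u v) : Close key l L (f u) (f v) := by
  obtain ⟨e, he, hue, hve, huv, hl⟩ := h
  obtain ⟨us, hus, hmem⟩ := hEs.exists_list e he
  obtain ⟨a, ha, hfa⟩ := hf us hus
  have hu := (hmem u).2 hue
  have hv := (hmem v).2 hve
  refine ⟨a, ha, (hfa _).1 (List.mem_map_of_mem hu), (hfa _).1 (List.mem_map_of_mem hv), ?_, ?_⟩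
  · have := ho us hus u hu v hv huv
    unfold Precedes at this
    omega
  · -- Vertices of the image with a greater key are images of vertices that precede `u`.
    have h1 : (a.filter fun z => key (f u) < key z).Nodup := (hL a ha).filter _
    have h2 : {z | z ∈ a.filter fun z => key (f u) < key z} ⊆
        f '' {x : V(H) | (x : α) ∈ e ∧ π x < π u} := by
      intro z hz
      simp only [Set.mem_ofPred_eq, List.mem_filter, decide_eq_true_eq] at hz
      obtain ⟨x, hx, rfl⟩ := List.mem_map.1 ((hfa z).2 hz.1)
      refine ⟨x, ⟨(hmem x).1 hx, ?_⟩, rfl⟩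
      rcases lt_trichotomy (π x) (π u) with h | h | h
      · exact h
      · rw [π.injective h] at hz
        exact absurd hz.2 (lt_irrefl _)
      · have := ho us hus u hu x hx h
        unfold Precedes at this
        omega
    have h3 : ({z | z ∈ a.filter fun z => key (f u) < key z} : Set ℕ).encard =
        (a.countP fun z => key (f u) < key z : ℕ) := by
      classical
      rw [List.countP_eq_length_filter, ← List.toFinset_card_of_nodup h1, ← Set.encard_coe_eq_coe_finsetCard]
      congr 1
      ext z
      simp
    rw [← h3]
    exact (Set.encard_le_encard h2).trans ((Set.encard_image_le _ _).trans hl)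

section

variable (H l)

/-- The vertices of `H`, in the order `π`. -/
noncomputable def sortedVerts (π : V(H) ≃ Fin V(H).ncard) : List V(H) :=
  (List.finRange V(H).ncard).map π.symm

variable {H}

theorem pairwise_sortedVerts (π : V(H) ≃ Fin V(H).ncard) :
    (sortedVerts H π).Pairwise fun u v => π u < π v := by
  rw [sortedVerts, List.pairwise_map]
  simpa using List.pairwise_lt_finRange _

theorem mem_sortedVerts (π : V(H) ≃ Fin V(H).ncard) (v : V(H)) : v ∈ sortedVerts H π :=
  List.mem_map.2 ⟨π v, List.mem_finRange _, by simp⟩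

open scoped Classical in
/-- The adjacency list from which the values for `v` are taken is that of the value of some vertex
with an arc to `v`, unless `v` is in the bag. -/
noncomputable def bagSrc (π : V(H) ≃ Fin V(H).ncard) (b : Finset V(H)) (v : V(H)) :
    Option V(H) :=
  if h : v ∉ b ∧ ∃ u ∈ (H.skeleton l π).reach b, (H.skeleton l π).Adj u v
    then some h.2.choose else none

open scoped Classical in
/-- The cell for a bag enumerates the assignments to all vertices reachable from the bag, and
verifies the hyperedges among these vertices, and their orientations. -/
noncomputable def bagCell (π : V(H) ≃ Fin V(H).ncard) (Es : List (List V(H)))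
    (b : Finset V(H)) : Cell V(H) where
  verts := (sortedVerts H π).filter fun v => v ∈ (H.skeleton l π).reach b
  src := bagSrc l π b
  tests := (((sortedVerts H π).filter fun v => v ∈ (H.skeleton l π).reach b).filterMap fun v =>
      (bagSrc l π b v).map fun u => .near u v) ++
    (Es.filter fun us => ∀ v ∈ us, v ∈ (H.skeleton l π).reach b).flatMap fun us =>
      .edge us :: ((us.product us).filter fun uv => π uv.1 < π uv.2).map fun uv =>
        .before uv.1 uv.2

end

theorem bagSrc_eq_some {π : V(H) ≃ Fin V(H).ncard} {b : Finset V(H)} {u v : V(H)}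
    (h : bagSrc l π b v = some u) :
    u ∈ (H.skeleton l π).reach b ∧ (H.skeleton l π).Adj u v := by
  unfold bagSrc at h
  split_ifs at h with h1
  rw [Option.some.injEq] at h
  exact h ▸ h1.2.choose_spec

theorem mem_of_bagSrc_eq_none {π : V(H) ≃ Fin V(H).ncard} {b : Finset V(H)} {v : V(H)}
    (hv : v ∈ (H.skeleton l π).reach b) (h : bagSrc l π b v = none) : v ∈ b := by
  unfold bagSrc at h
  by_contra hb
  rw [dif_pos ⟨hb, Digraph.exists_adj_of_mem_reach hv hb⟩] at h
  exact absurd h (by simp)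

theorem mem_verts_bagCell {π : V(H) ≃ Fin V(H).ncard} {Es : List (List V(H))} {b : Finset V(H)}
    {v : V(H)} : v ∈ (bagCell l π Es b).verts ↔ v ∈ (H.skeleton l π).reach b := by
  simp [bagCell, mem_sortedVerts]

theorem mem_tests_bagCell {π : V(H) ≃ Fin V(H).ncard} {Es : List (List V(H))} {b : Finset V(H)}
    {T : Test V(H)} : T ∈ (bagCell l π Es b).tests ↔
      (∃ u v, v ∈ (H.skeleton l π).reach b ∧ bagSrc l π b v = some u ∧ T = .near u v) ∨
      ∃ us ∈ Es, (∀ v ∈ us, v ∈ (H.skeleton l π).reach b) ∧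
        (T = .edge us ∨ ∃ u ∈ us, ∃ v ∈ us, π u < π v ∧ T = .before u v) := by
  simp only [bagCell, List.mem_append, List.mem_filterMap, List.mem_filter, List.mem_flatMap,
    List.mem_cons, List.mem_map, decide_eq_true_eq, Option.map_eq_some_iff, mem_sortedVerts,
    true_and]
  refine or_congr ?_ ?_
  · constructor
    · rintro ⟨v, hv, u, hu, rfl⟩
      exact ⟨u, v, hv, hu, rfl⟩
    · rintro ⟨u, v, hv, hu, rfl⟩
      exact ⟨v, hv, u, hu, rfl⟩
  · refine exists_congr fun us => ?_
    rw [and_assoc]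
    refine and_congr_right fun _ => and_congr_right fun _ => or_congr_right ?_
    constructor
    · rintro ⟨⟨u, v⟩, ⟨h1, h2⟩, rfl⟩
      obtain ⟨hu, hv⟩ := List.pair_mem_product.1 h1
      exact ⟨u, hu, v, hv, h2, rfl⟩
    · rintro ⟨u, hu, v, hv, h2, rfl⟩
      exact ⟨(u, v), ⟨List.pair_mem_product.2 ⟨hu, hv⟩, h2⟩, rfl⟩

theorem pairwise_verts_bagCell (π : V(H) ≃ Fin V(H).ncard) (Es : List (List V(H)))
    (b : Finset V(H)) : (bagCell l π Es b).verts.Pairwise fun u v => π u < π v :=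
  (pairwise_sortedVerts π).filter _

theorem valid_bagCell (π : V(H) ≃ Fin V(H).ncard) (Es : List (List V(H))) (b : Finset V(H)) :
    (bagCell l π Es b).Valid where
  nodup := (pairwise_verts_bagCell π Es b).imp fun h => by
    rintro rfl
    exact lt_irrefl _ h
  src_mem pre v post u h hv := by
    obtain ⟨h1, h2⟩ := bagSrc_eq_some hv
    have h3 := lt_of_skeleton_adj h2
    have h4 := mem_verts_bagCell (Es := Es).2 h1
    have h5 := pairwise_verts_bagCell (l := l) π Es b
    rw [h, List.pairwise_append, List.pairwise_cons] at h5
    rw [h, List.mem_append, List.mem_cons] at h4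
    rcases h4 with h4 | rfl | h4
    · exact h4
    · exact absurd h3 (lt_irrefl _)
    · exact absurd (h5.2.1.1 u h4) (not_lt.2 h3.le)
  near_mem v hv u hu := mem_tests_bagCell.2 (Or.inl ⟨u, v, mem_verts_bagCell.1 hv, hu, rfl⟩)
  tests_sub T hT v hv := by
    rw [mem_verts_bagCell]
    rcases mem_tests_bagCell.1 hT with ⟨x, y, hy, hxy, rfl⟩ | ⟨us, -, h, rfl | ⟨x, hx, y, hy, -, rfl⟩⟩
    · simp only [Test.verts, List.mem_cons, List.not_mem_nil, or_false] at hv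
      rcases hv with rfl | rfl
      · exact (bagSrc_eq_some hxy).1
      · exact hy
    · exact h v hv
    · simp only [Test.verts, List.mem_cons, List.not_mem_nil, or_false] at hv
      rcases hv with rfl | rfl
      · exact h _ hx
      · exact h _ hy

theorem countP_bagCell_le (π : V(H) ≃ Fin V(H).ncard) (Es : List (List V(H))) (b : Finset V(H)) :
    (bagCell l π Es b).verts.countP (fun v => ((bagCell l π Es b).src v).isNone) ≤ b.card := by
  classical
  rw [List.countP_eq_length_filter,
    ← List.toFinset_card_of_nodup ((valid_bagCell π Es b).nodup.filter _)]
  refine Finset.card_le_card fun v hv => ?_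
  rw [List.mem_toFinset, List.mem_filter, mem_verts_bagCell, Option.isNone_iff_eq_none] at hv
  exact mem_of_bagSrc_eq_none hv.1 hv.2

/-- For each orientation of `H` there is a sequence of cells that enumerates the homomorphisms
with this orientation, and whose cells have at most `τ_l(H)` vertices that range over all vertices
of `G`. -/
theorem exists_cells [Finite V(H)] (l : ℕ∞) (π : V(H) ≃ Fin V(H).ncard) {Es : List (List V(H))}
    (hEs : H.EnumeratesEdges Es) :
    ∃ qs : List (Cell V(H)), qs ≠ [] ∧ RunningIntersection (qs.map Cell.verts) ∧
      (∀ q ∈ qs, q.Valid ∧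
        (q.verts.countP fun v => (q.src v).isNone) ≤ H.dagTreewidth l ∧
        ∀ us, .edge us ∈ q.tests → us ∈ Es) ∧
      (∀ v, ∃ q ∈ qs, v ∈ q.verts) ∧
      ∀ (ix : V(H) → ℕ) (key : ℕ → ℕ) (L : List (List ℕ)) (isEdge : List ℕ → Prop) (f : V(H) → ℕ),
        (∀ a ∈ L, a.Nodup) →
        (∀ us ∈ Es, isEdge (us.map f) ↔ ∃ a ∈ L, ∀ x, x ∈ us.map f ↔ x ∈ a) →
        ((∀ q ∈ qs, ∀ T ∈ q.tests, T.Holds ix key (Close key l L) isEdge f) ↔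
          MapsEdges Es L f ∧ Oriented ix key Es π f) := by
  obtain ⟨T, hT⟩ := (H.skeleton l π).exists_width_eq_dagTreewidth
  obtain ⟨is, his, hri⟩ := exists_runningIntersection T.isTree T.root
    (fun i => (bagCell l π Es (T.bag i)).verts) fun i j w hw b hb v hvi hvj => by
      rw [mem_verts_bagCell] at hvi hvj ⊢
      exact T.reach_inter i j w hw b hb ⟨hvi, hvj⟩
  refine ⟨is.map fun i => bagCell l π Es (T.bag i), ?_, ?_, ?_, ?_, ?_⟩
  · simpa using List.ne_nil_of_mem (his T.root)
  · simpa [Function.comp_def] using hri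
  · intro q hq
    obtain ⟨i, -, rfl⟩ := List.mem_map.1 hq
    refine ⟨valid_bagCell π Es _, (countP_bagCell_le π Es _).trans ?_, fun us hus => ?_⟩
    · refine le_trans ?_ (hT.le.trans (skeleton_dagTreewidth_le π))
      exact Finset.le_sup (f := fun i => (T.bag i).card) (Finset.mem_univ i)
    · rcases mem_tests_bagCell.1 hus with ⟨_, _, -, -, h⟩ | ⟨vs, hvs, -, h | ⟨_, -, _, -, -, h⟩⟩
      · simp at h
      · rw [Test.edge.injEq] at h
        exact h ▸ hvs
      · simp at h
  · intro v
    obtain ⟨s, hs, hsv⟩ := Digraph.exists_source_of_lt (D := H.skeleton l π)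
      (π := fun v => (π v : ℕ)) (fun u v h => lt_of_skeleton_adj h) v
    obtain ⟨i, hi⟩ := T.covers s hs
    exact ⟨_, List.mem_map_of_mem (his i), mem_verts_bagCell.2 ⟨s, hi, hsv⟩⟩
  · intro ix key L isEdge f hL hisEdge
    constructor
    · intro h
      have hcell : ∀ us ∈ Es, ∃ i, ∀ v ∈ us, v ∈ (H.skeleton l π).reach (T.bag i) := by
        intro us hus
        obtain ⟨s, hs, hsv⟩ := hEs.exists_source (l := l) π hus
        obtain ⟨i, hi⟩ := T.covers s hs
        exact ⟨i, fun v hv => ⟨s, hi, hsv v hv⟩⟩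
      constructor
      · intro us hus
        obtain ⟨i, hi⟩ := hcell us hus
        exact (hisEdge us hus).1 (h _ (List.mem_map_of_mem (his i)) (.edge us)
          (mem_tests_bagCell.2 (Or.inr ⟨us, hus, hi, Or.inl rfl⟩)))
      · intro us hus u hu v hv huv
        obtain ⟨i, hi⟩ := hcell us hus
        exact h _ (List.mem_map_of_mem (his i)) (.before u v)
          (mem_tests_bagCell.2 (Or.inr ⟨us, hus, hi, Or.inr ⟨u, hu, v, hv, huv, rfl⟩⟩))
    · rintro ⟨hf, ho⟩ q hq T' hT'
      obtain ⟨i, -, rfl⟩ := List.mem_map.1 hq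
      rcases mem_tests_bagCell.1 hT' with ⟨u, v, -, huv, rfl⟩ | ⟨us, hus, -, rfl | ⟨u, hu, v, hv, h, rfl⟩⟩
      · exact close_of_adj hEs hL hf ho (bagSrc_eq_some huv).2
      · exact (hisEdge us hus).2 (hf us hus)
      · exact ho us hus u hu v hv h

end ArrayMachine

/-! ### Partition of the homomorphisms by orientation -/

namespace ArrayMachine

open Hypergraph

/-- An injective map to a linear order induces an enumeration of its domain. -/
theorem exists_equiv_lt_iff {V Γ : Type*} [Finite V] [LinearOrder Γ] {g : V → Γ}
    (hg : g.Injective) {k : ℕ} (hk : Nat.card V = k) :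
    ∃ π : V ≃ Fin k, ∀ u v, π u < π v ↔ g u < g v := by
  have : Fintype V := Fintype.ofFinite V
  let : LinearOrder V := LinearOrder.lift' g hg
  rw [Nat.card_eq_fintype_card] at hk
  exact ⟨(Fintype.orderIsoFinOfCardEq V hk).symm.toEquiv, fun u v =>
    (Fintype.orderIsoFinOfCardEq V hk).symm.lt_iff_lt⟩

variable {α : Type*} {H : Hypergraph α}

theorem exists_equiv_lt_iff_precedes [Finite V(H)] {ix : V(H) → ℕ} (hix : ix.Injective)
    (key : ℕ → ℕ) (f : V(H) → ℕ) :
    ∃ π : V(H) ≃ Fin V(H).ncard, ∀ u v, π u < π v ↔ Precedes ix key f u v := by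
  obtain ⟨π, hπ⟩ := exists_equiv_lt_iff (V := V(H)) (k := V(H).ncard)
    (g := fun v => toLex (OrderDual.toDual (key (f v)), ix v))
    (fun u v h => hix (by simpa using congrArg (fun x => (ofLex x).2) h))
    (Nat.card_coe_set_eq _)
  refine ⟨π, fun u v => (hπ u v).trans ?_⟩
  rw [Prod.Lex.toLex_lt_toLex]
  simp [Precedes]

/-- A list of orderings such that each assignment is oriented according to exactly one of them. -/
theorem exists_orientations [Finite V(H)] {ix : V(H) → ℕ} (hix : ix.Injective)
    (Es : List (List V(H))) :
    ∃ πs : List (V(H) ≃ Fin V(H).ncard), ∀ key f,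
      (πs.map fun π => truth (Oriented ix key Es π f)).sum = 1 := by
  classical
  have : Fintype V(H) := Fintype.ofFinite _
  set o : (V(H) ≃ Fin V(H).ncard) → Finset (V(H) × V(H)) := fun π =>
    Finset.univ.filter fun uv => ∃ us ∈ Es, uv.1 ∈ us ∧ uv.2 ∈ us ∧ π uv.1 < π uv.2 with ho
  have : Nonempty (V(H) ≃ Fin V(H).ncard) :=
    let ⟨π, _⟩ := exists_equiv_lt_iff_precedes hix id 0
    ⟨π⟩
  refine ⟨(Finset.univ.image o).toList.map (Function.invFun o), fun key f => ?_⟩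
  obtain ⟨π₀, hπ₀⟩ := exists_equiv_lt_iff_precedes hix key f
  have h1 : ∀ π, Oriented ix key Es π f ↔ o π = o π₀ := by
    intro π
    constructor
    · intro h
      ext ⟨u, v⟩
      simp only [ho, Finset.mem_filter, Finset.mem_univ, true_and, hπ₀]
      refine exists_congr fun us => and_congr_right fun hus => and_congr_right fun hu =>
        and_congr_right fun hv => ⟨h us hus u hu v hv, fun huv => ?_⟩
      rcases lt_trichotomy (π u) (π v) with h' | h' | h'
      · exact h'
      · rw [π.injective h'] at huv
        exact absurd huv huv.asymm
      · exact absurd huv (h us hus v hv u hu h').asymm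
    · intro h us hus u hu v hv huv
      have : (u, v) ∈ o π := by
        simp only [ho, Finset.mem_filter, Finset.mem_univ, true_and]
        exact ⟨us, hus, hu, hv, huv⟩
      rw [h] at this
      simp only [ho, Finset.mem_filter, Finset.mem_univ, true_and] at this
      obtain ⟨-, -, -, -, h'⟩ := this
      exact (hπ₀ u v).1 h'
  rw [List.map_map, Finset.sum_map_toList, Finset.sum_eq_single (o π₀)]
  · exact truth_of ((h1 _).2 (Function.invFun_eq ⟨π₀, rfl⟩))
  · intro s hs hne
    obtain ⟨π, -, rfl⟩ := Finset.mem_image.1 hs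
    refine truth_of_not fun h => hne ?_
    rw [h1, Function.invFun_eq (f := o) ⟨π, rfl⟩] at h
    exact h
  · intro h
    exact absurd (Finset.mem_image_of_mem o (Finset.mem_univ _)) h

/-- The number of homomorphisms as a sum over all assignments. -/
theorem homCount_eq_marginal [Fintype V(H)] [DecidableEq V(H)] {G : Hypergraph ℕ} {n : ℕ}
    {L : List (List ℕ)} (hG : G.IsListing n L) {Es : List (List V(H))}
    (hEs : H.EnumeratesEdges Es) :
    H.homCount G = marginal n Finset.univ (fun f => truth (MapsEdges Es L f)) 0 := by
  classical
  have hV : ∀ x, x ∈ V(G) ↔ x < n := fun x => by rw [hG.vertexSet_eq]; rfl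
  have hiff : ∀ φ : V(H) → V(G), H.IsHom G φ ↔ MapsEdges Es L fun v => (φ v : ℕ) := by
    intro φ
    have himg : ∀ us : List V(H), ∀ e : Set α, (∀ v : V(H), v ∈ us ↔ (v : α) ∈ e) → ∀ a : List ℕ,
        ((fun v : V(H) => (φ v : ℕ)) '' {v : V(H) | (v : α) ∈ e} = {x | x ∈ a} ↔
          ∀ x, x ∈ us.map (fun v => (φ v : ℕ)) ↔ x ∈ a) := by
      intro us e hue a
      rw [Set.ext_iff]
      refine forall_congr' fun x => ?_
      simp only [Set.mem_image, Set.mem_ofPred_eq, List.mem_map, hue]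
    unfold Hypergraph.IsHom MapsEdges
    rw [hG.edgeSet_eq]
    constructor
    · intro h us hus
      obtain ⟨e, he, hue⟩ := hEs.exists_edge us hus
      obtain ⟨a, ha, h1⟩ := h e he
      exact ⟨a, ha, (himg us e hue a).1 h1⟩
    · intro h e he
      obtain ⟨us, hus, hue⟩ := hEs.exists_list e he
      obtain ⟨a, ha, h1⟩ := h us hus
      exact ⟨a, ha, (himg us e hue a).2 h1⟩
  have h1 : marginal n Finset.univ (fun f => truth (MapsEdges Es L f)) 0 =
      ((Fintype.piFinset fun v => if v ∈ (Finset.univ : Finset V(H)) then Finset.range n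
        else {(0 : V(H) → ℕ) v}).filter fun f => MapsEdges Es L f).card := by
    rw [Finset.card_filter]
    refine Finset.sum_congr rfl fun f _ => ?_
    unfold truth
    congr
  have hmem : ∀ φ : V(H) → V(G), (∀ v, (φ v : ℕ) < n) := fun φ v => (hV _).1 (φ v).2
  rw [h1, Hypergraph.homCount, ← Nat.card_eq_finsetCard]
  refine Nat.card_eq_of_bijective (fun φ => ⟨fun v => (φ.1 v : ℕ), Finset.mem_filter.2
    ⟨mem_box.2 ⟨fun v _ => hmem φ.1 v, by simp⟩, (hiff φ.1).1 φ.2⟩⟩) ⟨fun φ ψ h => ?_, fun f => ?_⟩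
  · rw [Subtype.mk.injEq, funext_iff] at h
    exact Subtype.ext (funext fun v => Subtype.ext (h v))
  · obtain ⟨f, hf⟩ := f
    rw [Finset.mem_filter, mem_box] at hf
    exact ⟨⟨fun v => ⟨f v, (hV _).2 (hf.1.1 v (Finset.mem_univ v))⟩, (hiff _).2 hf.2⟩, rfl⟩

end ArrayMachine

/-! ### The sum over all orientations -/

namespace ArrayMachine

open Hypergraph

/-- Dynamic programming leaves the tables of the input intact. -/
theorem Prepared.static {B n N ρ D t : ℕ} {close : ℕ → ℕ → Prop} {nbr : ℕ → List ℕ}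
    {isEdge : List ℕ → Prop} {σ τ : State} (hσ : Prepared B n N ρ D close nbr isEdge σ)
    (h : Static σ t τ) (ht : 6 ≤ t) : Prepared B n N ρ D close nbr isEdge τ where
  layout := ⟨(h.reg 3 (by omega) (by omega)).trans hσ.layout.base,
    (h.reg 4 (by omega) (by omega)).trans hσ.layout.round, hσ.layout.lt, hσ.layout.round_lt,
    hσ.layout.bound⟩
  vertices := (h.reg 1 (by omega) (by omega)).trans hσ.vertices
  table := hσ.table.congr (h.arr 2 (by omega)) (h.arr 3 (by omega)) (h.arr 4 (by omega))
  lt := hσ.lt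
  few := hσ.few
  dict xs hxs := by
    rw [h.arr 5 (by omega)]
    exact hσ.dict xs hxs

section

variable {V : Type*} [DecidableEq V]

/-- Dynamic programming over several sequences of cells, with tables in the arrays from the `t`-th
on. -/
def sumCells (ix : V → ℕ) (t : ℕ) : List (List (Cell V)) → Stmt
  | [] => .skip
  | qs :: qss => .seq (sumNodes ix t (qs.map (Cell.node ix))) (sumCells ix (t + qs.length) qss)

/-- A sequence of cells to which dynamic programming applies. -/
structure Decomposes (qs : List (Cell V)) : Prop where
  ne_nil : qs ≠ []
  inter : RunningIntersection (qs.map Cell.verts)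
  valid : ∀ q ∈ qs, q.Valid
  covers : ∀ v, ∃ q ∈ qs, v ∈ q.verts

/-- An exponent that bounds all numbers that occur in dynamic programming. -/
def cellsBudget (ix : V → ℕ) (qs : List (Cell V)) : ℕ :=
  budget (qs.map (Cell.node ix)) + 1 +
    (qs.map fun q => (q.tests.map fun T => T.verts.length + 1).sum).sum

/-- The number of assignments that satisfy the conditions of all cells. -/
noncomputable def cellsCount [Fintype V] (n : ℕ) (ix : V → ℕ) (key : ℕ → ℕ)
    (close : ℕ → ℕ → Prop) (isEdge : List ℕ → Prop) (qs : List (Cell V)) : ℕ :=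
  marginal n Finset.univ (fun f => (qs.map fun q => q.weight n ix key close isEdge f).prod) 0

/-- The constant depends on the cells only, and `X` bounds the number of steps of each nest of loops. -/
theorem exists_wp_sumCells [Fintype V] {ix : V → ℕ} (hix : ix.Injective) (qss : List (List (Cell V)))
    (hqss : ∀ qs ∈ qss, Decomposes qs) (t : ℕ) (ht : 6 ≤ t) :
    ∃ C, ∀ (B n N ρ D X : ℕ) (close : ℕ → ℕ → Prop) (nbr : ℕ → List ℕ) (isEdge : List ℕ → Prop)
      (σ : State), 2 ≤ N → Prepared B n N ρ D close nbr isEdge σ →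
      (∀ qs ∈ qss, N ^ cellsBudget ix qs ≤ B) → (∀ k, t ≤ k → ∀ a, σ.arr k a = 0) →
      (∀ qs ∈ qss, ∀ q ∈ qs, ((q.node ix).levels.map fun lv => levelBound n D lv + 1).prod ≤ X) →
      1 ≤ X →
      σ.reg 0 + (qss.map (cellsCount n ix (σ.arr 1) close isEdge)).sum < B →
      Wp B (sumCells ix t qss) (C * X) σ fun τ =>
        τ.reg 0 = σ.reg 0 + (qss.map (cellsCount n ix (σ.arr 1) close isEdge)).sum := by
  induction qss generalizing t with
  | nil =>
    refine ⟨1, fun B n N ρ D X close nbr isEdge σ _ _ _ _ _ hX _ => ?_⟩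
    exact Wp.skip (by omega) (by simp)
  | cons qs qss ih =>
    obtain ⟨C₂, h₂⟩ := ih (fun qs h => hqss qs (by simp [h])) (t + qs.length) (by omega)
    have hqs := hqss qs (by simp)
    have hverts : (qs.map (Cell.node ix)).map Node.verts = qs.map Cell.verts := by
      rw [List.map_map]
      exact List.map_congr_left fun q _ => q.verts_node ix
    obtain ⟨C₁, h₁⟩ := exists_wp_sumNodes hix t (qs.map (Cell.node ix))
      (by simpa using hqs.ne_nil) (by rw [hverts]; exact hqs.inter)
    refine ⟨C₁ + C₂, fun B n N ρ D X close nbr isEdge σ hN hσ hB h0 hX hX1 hans => ?_⟩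
    simp only [List.map_cons, List.sum_cons] at hans ⊢
    have hall : allVerts (qs.map (Cell.node ix)) = Finset.univ := by
      refine Finset.eq_univ_of_forall fun v => mem_allVerts.2 ?_
      obtain ⟨q, hq, hv⟩ := hqs.covers v
      exact ⟨_, List.mem_map_of_mem hq, by rwa [q.verts_node]⟩
    have hBqs := hB qs (by simp)
    have hpow : ∀ j, j ≤ cellsBudget ix qs → N ^ j ≤ B := fun j hj =>
      (Nat.pow_le_pow_right (by omega) hj).trans hBqs
    have hokq : List.Forall₂ (NodeOk B n N ix (Static σ t) (levelValues n nbr) (levelBound n D))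
        (qs.map (Cell.node ix)) (qs.map fun q => q.weight n ix (σ.arr 1) close isEdge) := by
      rw [List.forall₂_map_left_iff, List.forall₂_map_right_iff, List.forall₂_same]
      intro q hq
      refine q.nodeOk hσ hN ht (hqs.valid q hq) fun T hT => hpow _ ?_
      have a1 := List.single_le_sum (l := q.tests.map fun T => T.verts.length + 1) (by simp) _
        (List.mem_map_of_mem hT)
      have a2 := List.single_le_sum
        (l := qs.map fun q => (q.tests.map fun T => T.verts.length + 1).sum) (by simp) _
        (List.mem_map_of_mem hq)
      simp only [cellsBudget]
      omega
    have hcount : marginal n (allVerts (qs.map (Cell.node ix)))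
        (fun f => ((qs.map fun q => q.weight n ix (σ.arr 1) close isEdge).map fun w => w f).prod) 0 =
        cellsCount n ix (σ.arr 1) close isEdge qs := by
      rw [hall]
      simp only [List.map_map]
      rfl
    have hrun := h₁ B n N X _ _ σ _ hN hσ.layout.lt.le (hpow _ (by simp only [cellsBudget]; omega))
      hσ.layout.base (fun k hk _ a => h0 k hk a) hokq
      (by
        intro ls hls
        rw [List.map_map] at hls
        obtain ⟨q, hq, rfl⟩ := List.mem_map.1 hls
        exact hX qs (by simp) q hq) hX1 (by rw [hcount]; omega)
    rw [hcount] at hrun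
    refine Wp.seq hrun (T₂ := C₂ * X) (fun τ hag hτ => ?_) (by rw [← add_mul])
    obtain ⟨hr, ha⟩ := frame_sumNodes ix t (qs.map (Cell.node ix))
    rw [List.length_map] at ha
    have hst : Static σ t τ := ⟨fun i h1 h2 => hag.reg i fun h => by have := hr i h; omega,
      fun k hk => hag.arr k fun h => by have := ha k h; omega⟩
    have hkey : τ.arr 1 = σ.arr 1 := hst.arr 1 (by omega)
    have := h₂ B n N ρ D X close nbr isEdge τ hN (hσ.static hst ht)
      (fun qs h => hB qs (by simp [h]))
      (fun k hk a => by
        rw [hag.arr k fun h => by have := ha k h; omega]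
        exact h0 k (by omega) a)
      (fun qs h => hX qs (by simp [h])) hX1 (by rw [hkey, hτ]; omega)
    refine this.mono le_rfl fun υ _ hυ => ?_
    rw [hυ, hkey, hτ]
    omega

theorem marginal_sum {ι : Type*} [Fintype V] (n : ℕ) (S : Finset V) (l : List ι)
    (W : ι → (V → ℕ) → ℕ) (f : V → ℕ) : (l.map fun i => marginal n S (W i) f).sum =
      marginal n S (fun φ => (l.map fun i => W i φ).sum) f := by
  unfold marginal
  induction l with
  | nil => simp
  | cons i l ih => simp only [List.map_cons, List.sum_cons, ih, Finset.sum_add_distrib]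

theorem prod_truth {ι : Type*} (l : List ι) (p : ι → Prop) :
    (l.map fun i => truth (p i)).prod = truth (∀ i ∈ l, p i) := by
  induction l with
  | nil => exact (truth_of (by simp)).symm
  | cons i l ih => simp only [List.map_cons, List.prod_cons, ih, List.forall_mem_cons, truth_and]

end

/-- Sequences of cells, one for each orientation, that together enumerate the homomorphisms
from `H`. -/
theorem exists_cells_homCount {α : Type*} {H : Hypergraph α} [Fintype V(H)] [DecidableEq V(H)]
    (l : ℕ∞) {ix : V(H) → ℕ} (hix : ix.Injective) {Es : List (List V(H))}
    (hEs : H.EnumeratesEdges Es) :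
    ∃ qss : List (List (Cell V(H))), (∀ qs ∈ qss, Decomposes qs ∧
        ∀ q ∈ qs, (q.verts.countP fun v => (q.src v).isNone) ≤ H.dagTreewidth l) ∧
      ∀ (G : Hypergraph ℕ) (n : ℕ) (L : List (List ℕ)) (key : ℕ → ℕ) (isEdge : List ℕ → Prop),
        G.IsListing n L →
        (∀ us ∈ Es, ∀ f : V(H) → ℕ,
          isEdge (us.map f) ↔ ∃ a ∈ L, ∀ x, x ∈ us.map f ↔ x ∈ a) →
        (qss.map (cellsCount n ix key (Close key l L) isEdge)).sum = H.homCount G := by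
  obtain ⟨πs, hπs⟩ := exists_orientations hix Es
  choose qs h1 h2 h3 h4 h5 using fun π => exists_cells (H := H) l π hEs
  refine ⟨πs.map qs, fun qs' hqs' => ?_, fun G n L key isEdge hG hisEdge => ?_⟩
  · obtain ⟨π, -, rfl⟩ := List.mem_map.1 hqs'
    exact ⟨⟨h1 π, h2 π, fun q hq => (h3 π q hq).1, h4 π⟩, fun q hq => (h3 π q hq).2.1⟩
  · have hcount : ∀ π, cellsCount n ix key (Close key l L) isEdge (qs π) =
        marginal n Finset.univ
          (fun f => truth (MapsEdges Es L f) * truth (Oriented ix key Es π f)) 0 := by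
      intro π
      refine marginal_congr fun f hf _ => ?_
      unfold Cell.weight
      rw [prod_truth, ← truth_and]
      congr 1
      rw [← h5 π ix key L isEdge f hG.edge_nodup fun us hus => hisEdge us hus f]
      exact propext (forall₂_congr fun q _ => and_iff_right fun v _ => hf v (Finset.mem_univ v))
    rw [List.map_map, homCount_eq_marginal hG hEs]
    simp only [Function.comp_def, hcount]
    rw [marginal_sum]
    refine marginal_congr fun f _ _ => ?_
    rw [List.sum_map_mul_left, hπs, mul_one]

end ArrayMachine

/-! ### The program -/

namespace ArrayMachine

open WordRAM (Program Exec)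

/-- Computes `r₁ := r₆ ^ k`. -/
def powCode : ℕ → Program
  | 0 => .instr (.const 1 1)
  | k + 1 => .seq (powCode k) (.instr (.op .mul 1 1 6))

/-- Reads `n` and `m` and computes `N = n + m + 2` and `N ^ k`. -/
def prologue (k : ℕ) : Program :=
  .seq (.instr (.const 3 0)) <| .seq (.instr (.load 2 3)) <| .seq (.instr (.const 3 1)) <|
    .seq (.instr (.load 4 3)) <| .seq (.instr (.const 3 2)) <| .seq (.instr (.op .add 6 2 4)) <|
    .seq (.instr (.op .add 6 6 3)) (powCode k)

/-- The initial state of the array machine. -/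
def inputState (n : ℕ) (L : List (List ℕ)) : State where
  reg i := if i = 1 then n else if i = 2 then L.length else if i = 3 then n + L.length + 2 else 0
  arr k a := if k = 0 then (Hypergraph.encode n L).getD a 0 else 0

theorem exec_powCode {w N k : ℕ} (hN : 1 ≤ N) (hk : N ^ k < 2 ^ w) {s : WordRAM.State}
    (h6 : s.reg 6 = N) :
    Exec w (powCode k) s (k + 1) { s with reg := Function.update s.reg 1 (N ^ k) } := by
  induction k with
  | zero =>
    have := Exec.instr (w := w) (.const 1 1) s
    rw [WordRAM.Instr.exec, Nat.mod_eq_of_lt (by simpa using hk)] at this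
    simpa [powCode] using this
  | succ k ih =>
    have h1 := ih (lt_of_le_of_lt (Nat.pow_le_pow_right hN (by omega)) hk)
    refine Exec.seq (t₂ := 1) h1 ?_
    have := Exec.instr (w := w) (.op .mul 1 1 6)
      { s with reg := Function.update s.reg 1 (N ^ k) }
    simp only [WordRAM.Instr.exec, WordRAM.Op.eval, Function.update_self, Function.update_idem,
      Function.update_of_ne (show 6 ≠ 1 by omega), h6, ← pow_succ, Nat.mod_eq_of_lt hk] at this
    exact this

theorem length_encode_le {G : Hypergraph ℕ} {n : ℕ} {L : List (List ℕ)} (hG : G.IsListing n L) :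
    (Hypergraph.encode n L).length + 1 < (n + L.length + 2) ^ 3 := by
  have h1 : ∀ a ∈ L, a.length ≤ n := by
    intro a ha
    have := List.toFinset_card_of_nodup (hG.edge_nodup a ha)
    rw [← this, ← Finset.card_range n]
    exact Finset.card_le_card fun v hv => by simpa using hG.lt_of_mem a ha v (by simpa using hv)
  have h2 : ∀ L : List (List ℕ), (∀ a ∈ L, a.length ≤ n) →
      (L.flatMap fun a => a.length :: a).length ≤ L.length * (n + 1) := by
    intro L hL
    induction L with
    | nil => simp
    | cons a L ih =>
      have i1 := ih fun b hb => hL b (by simp [hb])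
      have i2 := hL a (by simp)
      simp only [List.flatMap_cons, List.length_append, List.length_cons, add_mul] at i1 ⊢
      omega
  have h3 := h2 L h1
  simp only [Hypergraph.encode, List.length_cons]
  calc _ ≤ L.length * (n + 1) + 3 := by omega
    _ < _ := by
      ring_nf
      have : 0 ≤ n * L.length := Nat.zero_le _
      nlinarith [Nat.zero_le (n * L.length), Nat.zero_le (n ^ 2), Nat.zero_le (L.length ^ 2),
        Nat.zero_le (n ^ 3), Nat.zero_le (L.length ^ 3), Nat.zero_le (n ^ 2 * L.length),
        Nat.zero_le (n * L.length ^ 2)]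

theorem encode_getD_lt {G : Hypergraph ℕ} {n : ℕ} {L : List (List ℕ)} (hG : G.IsListing n L)
    (a : ℕ) : (Hypergraph.encode n L).getD a 0 < n + L.length + 2 := by
  have h : ∀ x ∈ Hypergraph.encode n L, x < n + L.length + 2 := by
    intro x hx
    simp only [Hypergraph.encode, List.mem_cons, List.mem_flatMap] at hx
    rcases hx with rfl | rfl | ⟨b, hb, rfl | hx⟩
    · omega
    · omega
    · have := List.toFinset_card_of_nodup (hG.edge_nodup b hb)
      have h2 : b.toFinset.card ≤ (Finset.range n).card :=
        Finset.card_le_card fun v hv => by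
          simpa using hG.lt_of_mem b hb v (by simpa using hv)
      rw [Finset.card_range] at h2
      omega
    · have := hG.lt_of_mem b hb x hx
      omega
  rcases lt_or_ge a (Hypergraph.encode n L).length with ha | ha
  · rw [List.getD_eq_getElem _ _ ha]
    exact h _ (List.getElem_mem ha)
  · rw [List.getD_eq_default _ _ ha]
    omega

theorem bounded_inputState {G : Hypergraph ℕ} {n B : ℕ} {L : List (List ℕ)}
    (hG : G.IsListing n L) (hB : n + L.length + 2 < B) : Bounded B (inputState n L) where
  reg i := by
    simp only [inputState]
    split_ifs <;> omega
  arr k a := by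
    simp only [inputState]
    have := encode_getD_lt hG a
    split_ifs <;> omega

theorem exec_prologue {G : Hypergraph ℕ} {n w k T : ℕ} {L : List (List ℕ)} (hG : G.IsListing n L)
    (hk : 3 ≤ k) (hw : (n + L.length + 2) ^ k < 2 ^ w) :
    ∃ s, Exec w (prologue k) (WordRAM.init (Hypergraph.encode n L)) (k + 8) s ∧
      Represents ((n + L.length + 2) ^ k) T (inputState n L) s := by
  set N := n + L.length + 2 with hN
  have hNk : N ^ 3 ≤ N ^ k := Nat.pow_le_pow_right (by omega) hk
  have hN1 : N ≤ N ^ 3 := Nat.le_self_pow (by omega) N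
  set s₀ := WordRAM.init (Hypergraph.encode n L) with hs₀
  have e0 : s₀.mem 0 = n := rfl
  have e1 : s₀.mem 1 = L.length := rfl
  have hmod : ∀ x, x ≤ N → x % 2 ^ w = x := fun x hx => Nat.mod_eq_of_lt (by omega)
  have step : ∀ (a : WordRAM.Instr) (p : Program) (s s' s'' : WordRAM.State) (t : ℕ),
      a.exec w s = s' → Exec w p s' t s'' → Exec w (.seq (.instr a) p) s (t + 1) s'' := by
    rintro a p s _ s'' t rfl h
    rw [add_comm]
    exact .seq (.instr a s) h
  let r₁ : ℕ → ℕ := Function.update (fun _ => 0) 3 0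
  let r₂ := Function.update r₁ 2 n
  let r₃ := Function.update r₂ 3 1
  let r₄ := Function.update r₃ 4 L.length
  let r₅ := Function.update r₄ 3 2
  let r₆ := Function.update r₅ 6 (n + L.length)
  let r₇ := Function.update r₆ 6 N
  refine ⟨⟨Function.update r₇ 1 (N ^ k), s₀.mem⟩, ?_, ?_, ?_, ?_⟩
  · refine step _ _ _ ⟨r₁, s₀.mem⟩ _ _ ?_ <| step _ _ _ ⟨r₂, s₀.mem⟩ _ _ ?_ <|
      step _ _ _ ⟨r₃, s₀.mem⟩ _ _ ?_ <| step _ _ _ ⟨r₄, s₀.mem⟩ _ _ ?_ <|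
      step _ _ _ ⟨r₅, s₀.mem⟩ _ _ ?_ <| step _ _ _ ⟨r₆, s₀.mem⟩ _ _ ?_ <|
      step _ _ _ ⟨r₇, s₀.mem⟩ _ _ ?_ <| exec_powCode (s := ⟨r₇, s₀.mem⟩) (by omega) hw ?_
    · simp only [WordRAM.Instr.exec, hmod 0 (by omega)]
      rfl
    · simp [WordRAM.Instr.exec, e0, r₁, r₂]
    · simp [WordRAM.Instr.exec, hmod 1 (by omega), r₃]
    · simp [WordRAM.Instr.exec, e1, r₃, r₄]
    · simp [WordRAM.Instr.exec, hmod 2 (by omega), r₅]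
    · simp [WordRAM.Instr.exec, WordRAM.Op.eval, hmod (n + L.length) (by omega), r₁, r₂, r₃, r₄, r₅,
        r₆]
    · simp [WordRAM.Instr.exec, WordRAM.Op.eval, ← hN, hmod N (by omega), r₅, r₆, r₇]
    · simp [r₇]
  · intro i
    simp only [r₁, r₂, r₃, r₄, r₅, r₆, r₇, Function.update_apply, inputState]
    split_ifs <;> omega
  · simp
  · intro j _ a ha
    simp only [hs₀, WordRAM.init, inputState]
    split_ifs with hj
    · simp [hj]
    · rw [List.getD_eq_default]
      have := length_encode_le hG
      rw [← hN] at this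
      have : N ^ k ≤ j * N ^ k := Nat.le_mul_of_pos_left _ (by omega)
      omega

variable {α : Type*} {H : Hypergraph α}

/-- The tables after the preprocessing. -/
theorem PeelState.prepared {G : Hypergraph ℕ} {B n N ρ D : ℕ} {l : ℕ∞} {L : List (List ℕ)}
    {σ τ : State} {isEdge : List ℕ → Prop} (hG : G.IsListing n L)
    (h : PeelState B l L n N ρ D ∅ σ) (hr : ∀ i, 1 ≤ i → i < 5 → τ.reg i = σ.reg i)
    (ha : ∀ k, k < 5 → τ.arr k = σ.arr k) (hd : HasDict N isEdge τ.arr) :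
    ∃ nbr, Prepared B n N ρ D (Close (τ.arr 1) l L) nbr isEdge τ := by
  obtain ⟨nbr, ht⟩ := h.table.1
  have hl := h.layout
  rw [ha 1 (by omega)]
  refine ⟨nbr, ⟨(hr 3 (by omega) (by omega)).trans hl.base,
    (hr 4 (by omega) (by omega)).trans hl.round, hl.lt, hl.round_lt, hl.bound⟩,
    (hr 1 (by omega) (by omega)).trans h.vertices,
    ht.congr (ha 2 (by omega)) (ha 3 (by omega)) (ha 4 (by omega)), h.table.2, fun x hx => ?_, hd⟩
  have hxN : x < N := hx.trans hl.lt
  rw [← ht.deg x hxN, h.table.deg_eq hG.lt_of_mem hxN]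
  exact h.peeling.few x hx (by simp)

theorem one_le_log_max (m : ℕ) : 1 ≤ Nat.log 2 (max m 2) :=
  Nat.log_pos one_lt_two (le_max_right _ _)

/-- The three phases are peeling, tabulation of hyperedges and dynamic programming. -/
theorem time_bound {n m r κ τ h A C₁ C₂ t₁ t₂ t₃ : ℕ} (hm : m ≤ κ * n) (hτ : 1 ≤ τ)
    (h₁ : t₁ ≤ (r + Nat.log 2 m + 3) * (n * 128 + m * A + 120)) (h₂ : t₂ ≤ C₁ * (m + 1))
    (h₃ : t₃ ≤ C₂ * ((n + 1) ^ τ * (2 * (r * r * κ) + 1) ^ h)) :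
    t₁ + (t₂ + t₃) ≤ ((r + 4) * (248 + κ * A) + C₁ * (κ + 1) +
      C₂ * 2 ^ τ * (2 * (r * r * κ) + 1) ^ h) * (max n 1) ^ τ * Nat.log 2 (max m 2) := by
  set n' := max n 1
  set lg := Nat.log 2 (max m 2)
  have hn : n ≤ n' := le_max_left _ _
  have hn1 : 1 ≤ n' := le_max_right _ _
  have hP : n' ≤ n' ^ τ := Nat.le_self_pow (by omega) _
  have hlg : 1 ≤ lg := one_le_log_max m
  have hlogm : Nat.log 2 m ≤ lg := Nat.log_mono_right (le_max_left _ _)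
  have hm' : m ≤ κ * n' := hm.trans (Nat.mul_le_mul_left _ hn)
  have e1 : t₁ ≤ ((r + 4) * (248 + κ * A)) * n' ^ τ * lg := by
    calc t₁ ≤ (r + Nat.log 2 m + 3) * (n * 128 + m * A + 120) := h₁
      _ ≤ ((r + 3) * lg + lg) * (n' * 128 + κ * n' * A + 120 * n') := by
        have : r + 3 ≤ (r + 3) * lg := Nat.le_mul_of_pos_right _ hlg
        have h' : m * A ≤ κ * n' * A := Nat.mul_le_mul_right _ hm'
        exact Nat.mul_le_mul (by omega) (by omega)
      _ = ((r + 4) * (248 + κ * A)) * n' * lg := by ring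
      _ ≤ _ := by gcongr
  have e2 : t₂ ≤ (C₁ * (κ + 1)) * n' ^ τ * lg := by
    calc t₂ ≤ C₁ * (m + 1) := h₂
      _ ≤ C₁ * (κ * n' + n') := by gcongr
      _ = C₁ * (κ + 1) * n' * 1 := by ring
      _ ≤ _ := by gcongr
  have e3 : t₃ ≤ (C₂ * 2 ^ τ * (2 * (r * r * κ) + 1) ^ h) * n' ^ τ * lg := by
    calc t₃ ≤ C₂ * ((n + 1) ^ τ * (2 * (r * r * κ) + 1) ^ h) := h₃
      _ ≤ C₂ * ((2 * n') ^ τ * (2 * (r * r * κ) + 1) ^ h) := by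
        gcongr
        omega
      _ = C₂ * 2 ^ τ * (2 * (r * r * κ) + 1) ^ h * n' ^ τ * 1 := by
        rw [mul_pow]
        ring
      _ ≤ _ := by gcongr
  calc _ ≤ _ := add_le_add e1 (add_le_add e2 e3)
    _ = _ := by ring

/-- The program for `H`: it removes the vertices of `G` in the order of a degenerate ordering,
tabulates the hyperedges, and sums over the orientations of `H`. -/
noncomputable def homProgram (l : ℕ∞) (ix : V(H) → ℕ) [DecidableEq V(H)] (Es : List (List V(H)))
    (qss : List (List (Cell V(H)))) : Stmt :=
  .seq (peel l) (.seq (recordAll ix Es) (sumCells ix 6 qss))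

theorem one_le_dagTreewidth [Finite V(H)] [Nonempty V(H)] (l : ℕ∞) : 1 ≤ H.dagTreewidth l := by
  obtain ⟨π⟩ : Nonempty (V(H) ≃ Fin V(H).ncard) :=
    ⟨(Finite.equivFinOfCardEq (Nat.card_coe_set_eq _))⟩
  obtain ⟨s, hs, -⟩ := Digraph.exists_source_of_lt (D := H.skeleton l π)
    (π := fun v => (π v : ℕ)) (fun u v h => Hypergraph.lt_of_skeleton_adj h)
    (Classical.arbitrary V(H))
  exact ((H.skeleton l π).one_le_dagTreewidth hs).trans (Hypergraph.skeleton_dagTreewidth_le π)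

/-- Correctness and running time on the array machine, whose numbers are bounded by a power of
`N = n + m + 2`. -/
theorem exists_wp_homCount [Finite V(H)] [Nonempty V(H)] (hne : ∅ ∉ E(H)) (l : ℕ∞) :
    ∃ (P : Stmt) (k : ℕ), 4 ≤ k ∧ P.top ≤ k ∧ ∀ r : ℕ, ∃ p : Polynomial ℕ,
      ∀ (n : ℕ) (G : Hypergraph ℕ) (L : List (List ℕ)), G.IsListing n L → ∅ ∉ E(G) → G.rank ≤ r →
        Wp ((n + L.length + 2) ^ k) P (p.eval (G.degeneracy l) * (max n 1) ^ H.dagTreewidth l *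
          Nat.log 2 (max L.length 2)) (inputState n L) fun τ => τ.reg 0 = H.homCount G := by
  classical
  have : Fintype V(H) := Fintype.ofFinite _
  obtain ⟨Es, hEs⟩ := Hypergraph.exists_enumeratesEdges (H := H) hne
  set ix : V(H) → ℕ := fun v => Fintype.equivFin V(H) v with hixdef
  have hix : ix.Injective := fun u v h => (Fintype.equivFin V(H)).injective (Fin.ext h)
  obtain ⟨qss, hqss, hcount⟩ := exists_cells_homCount (H := H) l hix hEs
  obtain ⟨C₂, hC₂⟩ := exists_wp_sumCells hix qss (fun qs h => (hqss qs h).1) 6 le_rfl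
  set k := 4 + (homProgram l ix Es qss).top + (qss.map (cellsBudget ix)).sum +
    (Es.map fun us => us.length + 1).sum + (Fintype.card V(H) + 1) with hk
  refine ⟨homProgram l ix Es qss, k, by omega, by omega, fun r => ?_⟩
  obtain ⟨C₁, hC₁⟩ := recordTime_le ix r Es
  set A := r * (r * 220 + 140) + 80 with hA
  refine ⟨Polynomial.C (r + 4) * (Polynomial.C 248 + Polynomial.X * Polynomial.C A) +
    Polynomial.C C₁ * (Polynomial.X + 1) + Polynomial.C (C₂ * 2 ^ H.dagTreewidth l) *
      (Polynomial.C 2 * (Polynomial.C (r * r) * Polynomial.X) + 1) ^ Fintype.card V(H),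
    fun n G L hG hGne hrank => ?_⟩
  simp only [Polynomial.eval_add, Polynomial.eval_mul, Polynomial.eval_pow, Polynomial.eval_C,
    Polynomial.eval_X, Polynomial.eval_one]
  set κ := G.degeneracy l with hκ
  set N := n + L.length + 2 with hN
  set D := 2 * (r * r * κ) with hD
  have hN2 : 2 ≤ N := by omega
  have hpow : ∀ j, j ≤ k → N ^ j ≤ N ^ k := fun j hj => Nat.pow_le_pow_right (by omega) hj
  have hkB : k < N ^ k := Nat.lt_two_pow_self.trans_le (Nat.pow_le_pow_left hN2 k)
  have h3B : N * N * N < N ^ k := by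
    calc N * N * N = N ^ 3 := by ring
      _ < N ^ 4 := Nat.pow_lt_pow_right (by omega) (by omega)
      _ ≤ N ^ k := hpow 4 (by omega)
  have hencB : (Hypergraph.encode n L).length + 1 < N ^ k := by
    refine (length_encode_le hG).trans_le (hpow 3 (by omega))
  have hr := hG.length_le_of_rank_le hrank
  have hus : ∀ us ∈ Es, us.length + 1 ≤ k := by
    intro us hus
    have := List.single_le_sum (l := Es.map fun us => us.length + 1) (by simp) _
      (List.mem_map_of_mem hus)
    omega
  have hpeel := Wp.peel (l := l) hG hr hencB (show n + 1 < N by omega) h3B (σ := inputState n L)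
    rfl rfl rfl (fun i => rfl) (fun j hj => by
      ext a
      simp only [inputState]
      rw [if_neg (by omega)])
  have hsum : (H.homCount G : ℕ) < N ^ k := by
    rw [homCount_eq_marginal hG hEs]
    calc _ ≤ n ^ (Finset.univ : Finset V(H)).card * 1 := marginal_le n fun _ _ _ => truth_le_one _
      _ ≤ N ^ Fintype.card V(H) := by
        rw [mul_one, Finset.card_univ]
        exact Nat.pow_le_pow_left (by omega) _
      _ < N ^ (Fintype.card V(H) + 1) := Nat.pow_lt_pow_right (by omega) (by omega)
      _ ≤ N ^ k := hpow _ (by omega)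
  refine Wp.seq hpeel (T₂ := recordTime ix r L.length Es +
    C₂ * ((n + 1) ^ H.dagTreewidth l * (D + 1) ^ Fintype.card V(H))) ?_
    (time_bound (hG.length_le hGne l) (one_le_dagTreewidth l) le_rfl (hC₁ _) le_rfl)
  rintro τ₁ hag₁ ⟨ρ, hps⟩
  have reg₁ : ∀ i, i < 4 → τ₁.reg i = (inputState n L).reg i := fun i hi =>
    hag₁.reg i (by simp; omega)
  have arr₁ : ∀ j, 5 ≤ j → τ₁.arr j = (inputState n L).arr j := fun j hj =>
    hag₁.arr j (by simp; omega)
  have zero : ∀ j, 1 ≤ j → (inputState n L).arr j = fun _ => 0 := fun j hj => by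
    ext a
    simp only [inputState]
    rw [if_neg (by omega)]
  refine Wp.seq (Wp.recordAll hix Es hEs.nodup hps.input hps.edges hps.layout.base hencB hN2
    (show n < N by omega) (fun us h => ⟨hpow _ (hus us h), (hus us h).trans_lt hkB⟩) hG.lt_of_mem
    hG.edge_nodup hr (P := fun _ => False)
    (fun xs _ => ⟨False.elim, fun _ => by rw [arr₁ 5 le_rfl, zero 5 (by omega)]⟩))
    (T₂ := C₂ * ((n + 1) ^ H.dagTreewidth l * (D + 1) ^ Fintype.card V(H))) ?_ le_rfl
  intro τ₂ hag₂ hd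
  have reg₂ : ∀ i, i < 5 → τ₂.reg i = τ₁.reg i := fun i hi => hag₂.reg i fun h => by
    have := regs_recordAll ix Es h
    simp only [Set.mem_union, Set.mem_insert_iff, Set.mem_singleton_iff, Set.mem_ofPred_eq] at this
    omega
  have arr₂ : ∀ j, j ≠ 5 → τ₂.arr j = τ₁.arr j := fun j hj => hag₂.arr j fun h =>
    hj (arrs_recordAll ix Es h)
  obtain ⟨nbr, hprep⟩ := hps.prepared hG (fun i _ hi => reg₂ i hi)
    (fun j hj => arr₂ j (by omega)) hd
  have h0 : τ₂.reg 0 = 0 := by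
    rw [reg₂ 0 (by omega), reg₁ 0 (by omega)]
    rfl
  have htotal := hcount G n L (τ₂.arr 1) (fun xs => False ∨
    (∃ us ∈ Es, xs.length = us.length) ∧ ∃ a ∈ L, ∀ x, x ∈ xs ↔ x ∈ a) hG (fun us hus f => by
      simp only [false_or]
      exact and_iff_right ⟨us, hus, by simp⟩)
  have hfinal := hC₂ (N ^ k) n N ρ D ((n + 1) ^ H.dagTreewidth l * (D + 1) ^ Fintype.card V(H)) _
    nbr _ τ₂ hN2 hprep (fun qs hqs => hpow _ ?_) (fun j hj a => ?_) (fun qs hqs q hq => ?_)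
    (Nat.mul_pos (by positivity) (by positivity)) (by rw [htotal, h0, zero_add]; exact hsum)
  · refine hfinal.mono le_rfl fun τ _ hτ => ?_
    rw [hτ, htotal, h0, zero_add]
  · have := List.single_le_sum (l := qss.map (cellsBudget ix)) (by simp) _
      (List.mem_map_of_mem hqs)
    omega
  · rw [arr₂ j (by omega), arr₁ j (by omega), zero j (by omega)]
  · refine (prod_levelBound_le n D ix q).trans (Nat.mul_le_mul ?_ ?_)
    · exact Nat.pow_le_pow_right (by omega) ((hqss qs hqs).2 q hq)
    · exact Nat.pow_le_pow_right (by omega) ((hqss qs hqs).1.valid q hq).nodup.length_le_card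

end ArrayMachine

/-- For every finite hypergraph `H` and every `l ∈ ℕ ∪ {∞}` there is a word RAM program that
computes the number of homomorphisms from `H` to an input hypergraph `G` of bounded rank, with
`n` vertices and `m` hyperedges, in time `poly(κ_l(G)) · n ^ τ_l(H) · log m`, on words of
`O(log (n + m))` bits. The factors `n` and `log m` are replaced by `1` where they are less. -/
theorem mainTheorem4 {α : Type*} (H : Hypergraph α) (hfin : H.vertexSet.Finite)
    (hne : ∅ ∉ H.edgeSet) (l : ℕ∞) :
    ∃ P : WordRAM.Program, ∀ r : ℕ, ∃ (c : ℕ) (p : Polynomial ℕ),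
      ∀ (n m : ℕ) (G : Hypergraph ℕ) (L : List (List ℕ)),
        G.IsListing n L → ∅ ∉ G.edgeSet → G.edgeSet.ncard = m → G.rank ≤ r →
        ∀ w : ℕ, (n + m + 2) ^ c ≤ 2 ^ w →
          ∃ (t : ℕ) (s : WordRAM.State),
            WordRAM.Exec w P (WordRAM.init (Hypergraph.encode n L)) t s ∧
            s.reg 0 = H.homCount G ∧
            t ≤ p.eval (G.degeneracy l) * (max n 1) ^ H.dagTreewidth l * Nat.log 2 (max m 2) := by
  have : Finite V(H) := hfin
  have hlog := ArrayMachine.one_le_log_max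
  rcases isEmpty_or_nonempty V(H) with hV | hV
  · -- The only assignment is the empty one.
    refine ⟨.instr (.const 0 1), fun r => ⟨1, 1, fun n m G L _ _ _ _ w hw => ⟨1, _, .instr _ _, ?_,
      ?_⟩⟩⟩
    · have h1 : H.homCount G = 1 := by
        have : Unique {φ : V(H) → V(G) // H.IsHom G φ} :=
          { default := ⟨isEmptyElim, fun e he => absurd (Set.eq_empty_of_forall_notMem fun x hx =>
              hV.false ⟨x, H.subset_vertexSet_of_mem_edgeSet he hx⟩) fun h => hne (h ▸ he)⟩
            uniq := fun φ => Subtype.ext (funext isEmptyElim) }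
        exact Nat.card_unique
      rw [h1]
      simp only [WordRAM.Instr.exec, Function.update_self]
      exact Nat.mod_eq_of_lt (by rw [pow_one] at hw; omega)
    · rw [Polynomial.eval_one, one_mul]
      exact Nat.mul_pos (Nat.pow_pos (by omega)) (hlog m)
  · obtain ⟨P, k, hk, hP, hrun⟩ := ArrayMachine.exists_wp_homCount (H := H) hne l
    refine ⟨.seq (ArrayMachine.prologue k) P.code, fun r => ?_⟩
    obtain ⟨p, hp⟩ := hrun r
    -- All addresses are less than `(N ^ k) ^ 2`, and the prologue takes `k + 8` steps.
    refine ⟨2 * k, Polynomial.C (k + 8) + p, fun n m G L hG hGne hm hrank w hw => ?_⟩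
    have hm' : L.length = m := hG.length_eq.trans hm
    subst hm'
    set N := n + L.length + 2 with hN
    have hkB : k < N ^ k := Nat.lt_two_pow_self.trans_le (Nat.pow_le_pow_left (by omega) k)
    have hNk : N < N ^ k := by
      calc N = N ^ 1 := (pow_one N).symm
        _ < N ^ k := Nat.pow_lt_pow_right (by omega) (by omega)
    have hsq : N ^ k * N ^ k ≤ 2 ^ w := by
      rwa [← pow_add, ← two_mul]
    have hlt : N ^ k < 2 ^ w := by
      have : 2 * N ^ k ≤ N ^ k * N ^ k := Nat.mul_le_mul_right _ (by omega)
      omega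
    obtain ⟨t, τ, hrunP, ht, hτ⟩ := hp n G L hG hGne hrank
    obtain ⟨s₁, hs₁, hrep⟩ := ArrayMachine.exec_prologue (T := P.top) (w := w) (k := k) hG
      (by omega) hlt
    obtain ⟨s₂, hs₂, hrep₂⟩ := hrunP.exec_code (w := w) (T := P.top) (by omega) (by omega)
      ((Nat.mul_le_mul_right _ (show P.top + 1 ≤ N ^ k by omega)).trans hsq)
      (ArrayMachine.bounded_inputState hG hNk) le_rfl s₁ hrep
    refine ⟨_, s₂, .seq hs₁ hs₂, (hrep₂.reg 0).trans hτ, ?_⟩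
    have h1 : 1 ≤ (max n 1) ^ H.dagTreewidth l * Nat.log 2 (max L.length 2) :=
      Nat.mul_pos (Nat.pow_pos (by omega)) (hlog _)
    rw [Polynomial.eval_add, Polynomial.eval_C, mul_assoc, add_mul, ← mul_assoc (Polynomial.eval _ p)]
    exact add_le_add (Nat.le_mul_of_pos_right _ h1) ht
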